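/- Fix an integer $r\ge 1$. **Counts.** For $g\ge 0$, $n\ge 1$ and positive integers $\mu_1,\dots,\mu_n$ put $d=\mu_1+\cdots+\mu_n$ and $s=2g-2+\frac dr+n$. An edge-labelled $r$-Hurwitz graph on $d$ numbered dots is a tuple $(\varphi;\tau_1,\dots,\tau_s)$ of permutations of $\{1,\dots,d\}$ such that all cycles of $\varphi$ have length $r$ (these are the faces, each carrying $r$ cyclically ordered dots), every $\tau_\alpha$ is a transposition (these are the labelled edges) and the group generated by $\varphi,\tau_1,\dots,\tau_s$ is transitive. Its vertices are the cycles of $\varphi\tau_1\cdots\tau_s$; the length of a cycle is the number of dots clustered at the vertex. Equivalently, this is the monodromy of a connected genus-$g$ cover of $\mathbb P^1$ with profile $(r,\dots,r)$ over $0$, the vertices as the points over $\infty$, and $s$ simple branch points. It is of type $\mu$ if it has $n$ vertices, labelled $1,\dots,n$, Vertex $i$ having $\mu_i$ dots; it is arrowed if moreover one dot is chosen at each vertex. Let $H^r_{g,n}(\mu)$ (the orbifold Hurwitz number) and $\mathcal H^r_{g,n}(\mu)$ be $\frac{1}{d!\,s!}$ times the number of such graphs of type $\mu$, respectively of arrowed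 such graphs of type $\mu$; both are $0$ if $r\nmid d$. Let $$F_{g,n}(x_1,\dots,x_n)=\sum_{\mu_1,\dots,\mu_n\ge1}\frac{\mathcal H^r_{g,n}(\mu_1,\dots,\mu_n)}{\mu_1\cdots\mu_n}\,x_1^{\mu_1}\cdots x_n^{\mu_n},\qquad x(z)=ze^{-z^r}.$$ **Proposition (closed formula for $F_{0,2}$).** 1. There is $\varepsilon>0$ such that for all $z_1,z_2\in\mathbb C$ with $|z_1|,|z_2|<\varepsilon$ the series $F_{0,2}(x(z_1),x(z_2))$ converges (absolutely) and $$F_{0,2}\big(x(z_1),x(z_2)\big)=\log\frac{z_1-z_2}{x(z_1)-x(z_2)}-(z_1^r+z_2^r),$$ where $\log$ is the principal branch and the quotient is extended to $z_1=z_2=z$ by its limit $1/x'(z)$. 2. For all $\mu_1,\mu_2\ge1$ the $(0,2)$ edge-contraction formula holds: $$\frac{\mu_1+\mu_2}{r}\,\mathcal H^r_{0,2}(\mu_1,\mu_2)=\mu_1\mu_2\,\mathcal H^r_{0,1}(\mu_1+\mu_2)+\mu_1\sum_{\substack{\alpha+\beta=\mu_1\\ \alpha,\beta\ge1}}\mathcal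 H^r_{0,1}(\alpha)\mathcal H^r_{0,2}(\beta,\mu_2)+\mu_2\sum_{\substack{\alpha+\beta=\mu_2\\ \alpha,\beta\ge1}}\mathcal H^r_{0,1}(\alpha)\mathcal H^r_{0,2}(\mu_1,\beta).$$ 3. The function $f(z_1,z_2)=F_{0,2}(x(z_1),x(z_2))$ is analytic at $(0,0)$, vanishes on both axes near the origin, and satisfies near the origin the first-order equation that the $(0,2)$ edge-contraction formula gives in the coordinates $z_i$, $$\frac1r\Big(z_1\frac{\partial}{\partial z_1}+z_2\frac{\partial}{\partial z_2}\Big)f=\frac{x(z_1)z_1^r-x(z_2)z_2^r}{x(z_1)-x(z_2)}-(z_1^r+z_2^r)$$ (the quotient being extended to the diagonal by its limit). Every function that is analytic at $(0,0)$, satisfies this equation near the origin and vanishes on both axes near the origin coincides with $f$ near the origin. 4. For all $d,\mu_1,\mu_2\ge1$, $$H^r_{0,1}(d)=\begin{cases}\dfrac{d^{\frac dr-2}}{(d/r)!}& r\mid d\\ 0&\text{otherwise,}\end{cases}\qquad H^r_{0,2}(\mu_1,\mu_2)=\begin{cases}r^{\langle\mu_1/r\rangle+\langle\mu_2/r\rangle}\,\dfrac{1}{\mu_1+\mu_2}\,\dfrac{\mu_1^{\lfloor\mu_1/r\rfloor}\mu_2^{\lfloor\mu_2/r\rfloor}}{\lfloor\mu_1/r\rfloor!\,\lfloor\mu_2/r\rfloor!}&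 r\mid \mu_1+\mu_2\\ 0&\text{otherwise,}\end{cases}$$ where $\langle q\rangle=q-\lfloor q\rfloor$ is the fractional part (the Johnson–Pandharipande–Tseng formulas). -/

import Mathlib

open Complex Topology

/-!
An edge-labelled `r`-Hurwitz graph with `d` dots and `s` edges is recorded by its effect on the dots,
which are numbered by `Fin d`:

* `face` sends a dot to the next dot, counter-clockwise, in the same face; so the faces are the
  cycles of `face`, and each of them has `r` cyclically ordered dots.
  The `r` dots of a face cut it (around its centre) into `r` sectors, one following each dot.
* In the dual picture the edge with label `α` joins two sectors, one at each of its two ends, and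
  inside a sector the edges are met in the order of their labels.  The two sectors are distinct
  (an edge bounding the same face twice has `r'` dots on one side with `0 < r' < r`).
  The edge is recorded as the transposition `edge α` of the two sectors.
* Walking around a vertex one meets its dots in the cyclic order given by
  `face * edge 0 * ⋯ * edge (s - 1)`; so the vertices are the cycles of that permutation and the
  length of a cycle is the number of dots clustered at the vertex.

The same data is the monodromy of a covering of the orbifold `ℙ¹[r]`: the `d` sheets are the dots,
`face` is the monodromy around the orbifold point `0` (profile `(r, …, r)`), `edge α` is the
monodromy around the `α`-th simple branch point, and the product is (up to inversion) the monodromy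
around `∞`.
-/

/-- Connected edge-labelled `r`-Hurwitz graphs on `d` numbered dots with `s` edges
(connected degree `d` covers with profile `(r, …, r)` over `0` and `s` simple branch points). -/
def IsHurwitzGraph (r : ℕ) {d s : ℕ} (face : Equiv.Perm (Fin d))
    (edge : Fin s → Equiv.Perm (Fin d)) : Prop :=
  (∀ k, Function.minimalPeriod face k = r) ∧
  (∀ α, (edge α).IsSwap) ∧
  MulAction.IsPretransitive (Subgroup.closure ({face} ∪ Set.range edge)) (Fin d)

/-- The permutation of the dots whose cycles are the vertices
(the points over `∞`, in the language of covers). -/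
def vertexPerm {d s : ℕ} (face : Equiv.Perm (Fin d)) (edge : Fin s → Equiv.Perm (Fin d)) :
    Equiv.Perm (Fin d) :=
  face * (List.ofFn edge).prod

/-- The number `s = 2g - 2 + d/r + n` of edges (of simple branch points).  The subtraction is a
genuine one as soon as `n ≥ 1` and `d/r ≥ 1`. -/
def edgeCount (r g n d : ℕ) : ℕ := 2 * g + d / r + n - 2

/-- `𝓗_{g,n}^r(μ₁,…,μₙ)`: the number of arrowed `r`-Hurwitz graphs of type `(g,n,d)`,
`d = μ₁ + ⋯ + μₙ`, with labelled vertices `1, …, n` and `μᵢ` dots at Vertex `i`, one of which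
(namely `arrow i`) carries an arrow.  Numbered dots and labelled edges are counted, and the result
is divided by `d! s!`: by orbit-stabilizer, division by `d!` turns the number of structures on `d`
numbered dots into the number of isomorphism classes, each weighted by the inverse of the order of
its automorphism group. -/
noncomputable def arrowedHurwitzNumber (r g : ℕ) {n : ℕ} (μ : Fin n → ℕ) : ℚ :=
  (Nat.card {G : Equiv.Perm (Fin (∑ i, μ i)) ×
        (Fin (edgeCount r g n (∑ i, μ i)) → Equiv.Perm (Fin (∑ i, μ i))) ×
        (Fin n → Fin (∑ i, μ i)) //
      IsHurwitzGraph r G.1 G.2.1 ∧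
      (∀ i, Function.minimalPeriod (vertexPerm G.1 G.2.1) (G.2.2 i) = μ i) ∧
      ∀ k, ∃! i, (vertexPerm G.1 G.2.1).SameCycle (G.2.2 i) k} : ℚ) /
    ((∑ i, μ i).factorial * (edgeCount r g n (∑ i, μ i)).factorial)

/-- The orbifold Hurwitz number `H_{g,n}^r(μ₁,…,μₙ)`: the automorphism-weighted number of
connected genus `g` covers of `ℙ¹[r]` with profile `(r, …, r)` over `0`, with `n` points over `∞`
labelled by `1, …, n` and having ramification orders `μ₁, …, μₙ`, and with `s` further, simple
and unlabelled, branch points.  The map `G.2.2` sends a sheet to the label of the point over `∞`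
whose cycle contains the sheet. -/
noncomputable def orbifoldHurwitzNumber (r g : ℕ) {n : ℕ} (μ : Fin n → ℕ) : ℚ :=
  (Nat.card {G : Equiv.Perm (Fin (∑ i, μ i)) ×
        (Fin (edgeCount r g n (∑ i, μ i)) → Equiv.Perm (Fin (∑ i, μ i))) ×
        (Fin (∑ i, μ i) → Fin n) //
      IsHurwitzGraph r G.1 G.2.1 ∧
      (∀ j k, G.2.2 j = G.2.2 k ↔ (vertexPerm G.1 G.2.1).SameCycle j k) ∧
      ∀ i, Nat.card {k // G.2.2 k = i} = μ i} : ℚ) /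
    ((∑ i, μ i).factorial * (edgeCount r g n (∑ i, μ i)).factorial)

/-- The term of index `(μ₁,…,μₙ)`, all `μᵢ ≥ 1`, in the series `F_{g,n}(x₁,…,xₙ)`. -/
noncomputable def freeEnergyTerm (r g : ℕ) {n : ℕ} (x : Fin n → ℂ) (μ : Fin n → ℕ+) : ℂ :=
  (arrowedHurwitzNumber r g (fun i => (μ i : ℕ)) : ℂ) / (∏ i, (μ i : ℂ)) * ∏ i, x i ^ (μ i : ℕ)

/-- The free energy `F_{g,n}(x₁,…,xₙ)`, the sum of the series where it converges. -/
noncomputable def freeEnergy (r g : ℕ) {n : ℕ} (x : Fin n → ℂ) : ℂ :=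
  ∑' μ : Fin n → ℕ+, freeEnergyTerm r g x μ

/-- The coordinate `x(z) = z e^{-z^r}` on the spectral curve. -/
noncomputable def spectralX (r : ℕ) (z : ℂ) : ℂ := z * exp (-z ^ r)

/-- The quotient `(u(z₁) - u(z₂)) / (v(z₁) - v(z₂))`, extended to the diagonal by its limit
`u'(z) / v'(z)`. -/
noncomputable def diffQuot (u v : ℂ → ℂ) (z₁ z₂ : ℂ) : ℂ :=
  open Classical in
  if z₁ = z₂ then deriv u z₁ / deriv v z₁ else (u z₁ - u z₂) / (v z₁ - v z₂)

/-- `f` is an analytic solution near the origin of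
`(1/r) (z₁ ∂f/∂z₁ + z₂ ∂f/∂z₂) = (x₁ z₁^r - x₂ z₂^r) / (x₁ - x₂) - (z₁^r + z₂^r)`,
where `xᵢ = x(zᵢ)`, that vanishes on the two axes. -/
def IsAxisVanishingSolution (r : ℕ) (f : ℂ × ℂ → ℂ) : Prop :=
  AnalyticAt ℂ f 0 ∧
  (∀ᶠ p : ℂ × ℂ in 𝓝 0,
    1 / (r : ℂ) * (p.1 * deriv (fun t => f (t, p.2)) p.1 + p.2 * deriv (fun t => f (p.1, t)) p.2) =
      diffQuot (fun t => spectralX r t * t ^ r) (spectralX r) p.1 p.2 - (p.1 ^ r + p.2 ^ r)) ∧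
  (∀ᶠ z : ℂ in 𝓝 0, f (z, 0) = 0) ∧
  (∀ᶠ z : ℂ in 𝓝 0, f (0, z) = 0)

/-! ### Cutting and joining cycles of a permutation -/

section CutJoin

set_option linter.unusedSectionVars false

open Function Equiv Equiv.Perm

variable {α : Type*} [Fintype α] [DecidableEq α]

/-! Cut-and-join. Write the vertex permutation as `σ = φ τ₁ ⋯ τ_s` and remove the transpositions
from the right. Each removal either cuts a cycle in two or joins two cycles, so the number of cycles
changes by one, and it must end at the `d / r` cycles of `φ`. In genus 0 with one vertex every
removal is therefore a cut. With two vertices exactly one removal is a join, and connectedness means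
that some edge links the dots of the two vertices. Hence any weights satisfying the recursions
`IsDiscWeight` and `IsAnnulusWeight` count these graphs, up to the factor `s!` and the choice of
marked dots: `IsDiscWeight.factorizationCount_eq`, `IsAnnulusWeight.crossingCount_eq`.

The recursions are not solved but verified. `discWeight` and `annulusWeight` are defined by the
explicit formulas, and their generating series are computed in the coordinate `x = z e^{-z^r}`.
Lagrange inversion, proved through finite differences of powers, gives `∑ discWeight r n x^n = z^r`,
and gives `z^i / (1 - r z^r)` for the series of `floorCoeff r n x^n` over the residue class `i`
(`hasSum_discWeight`, `hasSum_floorCoeff_residue`). Since `(m + n) annulusWeight r m n` is a sum of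
products of such one-variable coefficients, the Euler derivative of the two-variable series is
explicit. It agrees with that of the logarithmic formula, and both functions vanish at the origin,
so they coincide: `annulusSeries_eq_logForm`.

Differentiating this closed formula in `z₁` and `z₂` gives the first-order equation, and comparing
coefficients of `x₁^m x₂^n` gives the recursion for `annulusWeight`. So the weights compute the
Hurwitz numbers, and the edge-contraction formula and the explicit values follow. Uniqueness holds
because the difference of two solutions has zero derivative along every complex line through the
origin. -/

theorem minimalPeriod_perm_pos (σ : Perm α) (x : α) : 0 < minimalPeriod σ x :=
  minimalPeriod_pos_of_mem_periodicPts ⟨orderOf σ, orderOf_pos σ, by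
    rw [IsPeriodicPt, ← Equiv.Perm.coe_pow, pow_orderOf_eq_one]; rfl⟩

theorem perm_pow_minimalPeriod (σ : Perm α) (x : α) : (σ ^ minimalPeriod σ x) x = x := by
  rw [Equiv.Perm.coe_pow]; exact isPeriodicPt_minimalPeriod σ x

theorem perm_pow_mod_minimalPeriod (σ : Perm α) (x : α) (n : ℕ) :
    (σ ^ (n % minimalPeriod σ x)) x = (σ ^ n) x := by
  simp only [Equiv.Perm.coe_pow]
  exact iterate_mod_minimalPeriod_eq

theorem perm_pow_injOn (σ : Perm α) (x : α) {i j : ℕ} (hi : i < minimalPeriod σ x)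
    (hj : j < minimalPeriod σ x) (h : (σ ^ i) x = (σ ^ j) x) : i = j := by
  simp only [Equiv.Perm.coe_pow] at h
  exact (iterate_eq_iterate_iff_of_lt_minimalPeriod hi hj).1 h

theorem sameCycle_iff_exists_lt (σ : Perm α) (x y : α) :
    σ.SameCycle x y ↔ ∃ k < minimalPeriod σ x, (σ ^ k) x = y := by
  constructor
  · intro h
    obtain ⟨k, hk⟩ := h.exists_nat_pow_eq
    exact ⟨k % minimalPeriod σ x, Nat.mod_lt _ (minimalPeriod_perm_pos σ x), by
      rw [perm_pow_mod_minimalPeriod, hk]⟩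
  · rintro ⟨k, -, hk⟩
    exact ⟨k, by simpa using hk⟩

/-- The cycle of `σ` through `x`, as a set. -/
def cycleSet (σ : Perm α) (x : α) : Finset α := Finset.univ.filter (σ.SameCycle x)

@[simp] theorem mem_cycleSet {σ : Perm α} {x y : α} : y ∈ cycleSet σ x ↔ σ.SameCycle x y := by
  simp [cycleSet]

theorem cycleSet_eq_image (σ : Perm α) (x : α) :
    cycleSet σ x = (Finset.range (minimalPeriod σ x)).image (fun k => (σ ^ k) x) := by
  ext y
  simp [sameCycle_iff_exists_lt]

theorem sum_cycleSet {M : Type*} [AddCommMonoid M] (σ : Perm α) (x : α) (g : α → M) :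
    ∑ b ∈ cycleSet σ x, g b = ∑ k ∈ Finset.range (minimalPeriod σ x), g ((σ ^ k) x) := by
  rw [cycleSet_eq_image, Finset.sum_image]
  intro i hi j hj h
  exact perm_pow_injOn σ x (by simpa using hi) (by simpa using hj) h

theorem card_cycleSet (σ : Perm α) (x : α) : (cycleSet σ x).card = minimalPeriod σ x := by
  rw [Finset.card_eq_sum_ones, sum_cycleSet]
  simp

theorem cycleSet_eq_iff {σ : Perm α} {x y : α} : cycleSet σ x = cycleSet σ y ↔ σ.SameCycle x y := by
  constructor
  · intro h
    have : y ∈ cycleSet σ x := by rw [h]; simp [SameCycle.refl]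
    simpa using this
  · intro h
    ext z
    simp only [mem_cycleSet]
    exact ⟨fun h' => h.symm.trans h', fun h' => h.trans h'⟩

theorem minimalPeriod_eq_of_sameCycle {σ : Perm α} {x y : α} (h : σ.SameCycle x y) :
    minimalPeriod σ x = minimalPeriod σ y := by
  rw [← card_cycleSet, ← card_cycleSet, cycleSet_eq_iff.2 h]

/-- Right multiplication by the swap acts first, so `b` is diverted to `σ a`; from then on the walk
follows `σ` until it next meets `a` or `b`. Both cutting and joining are read off from this. -/
theorem mul_swap_pow_apply {σ : Perm α} {a b : α} {k : ℕ}
    (h : ∀ i, 0 < i → i < k → (σ ^ i) a ≠ a ∧ (σ ^ i) a ≠ b) {j : ℕ} (hj : 0 < j) (hjk : j ≤ k) :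
    ((σ * swap a b) ^ j) b = (σ ^ j) a := by
  induction j with
  | zero => omega
  | succ j ih =>
    rcases Nat.eq_zero_or_pos j with rfl | hj'
    · simp
    · rw [pow_succ', Perm.mul_apply, ih hj' (by omega), pow_succ' σ, Perm.mul_apply, Perm.mul_apply,
        swap_apply_of_ne_of_ne (h j hj' (by omega)).1 (h j hj' (by omega)).2]

section Cut

variable {σ : Perm α} {a b : α} {k : ℕ}

theorem cut_pow_apply (hk' : k < minimalPeriod σ a) (hb : (σ ^ k) a = b) {j : ℕ}
    (hj : 0 < j) (hjk : j ≤ k) : ((σ * swap a b) ^ j) b = (σ ^ j) a := by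
  refine mul_swap_pow_apply (k := k) (fun i hi hik => ⟨?_, ?_⟩) hj hjk
  · intro h
    have := perm_pow_injOn σ a (i := i) (j := 0) (by omega) (by omega) (by simpa using h)
    omega
  · intro h
    have := perm_pow_injOn σ a (i := i) (j := k) (by omega) (by omega) (by rw [h, hb])
    omega

theorem minimalPeriod_cut_right (hk : 0 < k) (hk' : k < minimalPeriod σ a) (hb : (σ ^ k) a = b) :
    minimalPeriod (σ * swap a b) b = k := by
  have h1 : IsPeriodicPt (σ * swap a b) k b := by
    rw [IsPeriodicPt, IsFixedPt, ← Equiv.Perm.coe_pow, cut_pow_apply hk' hb hk le_rfl, hb]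
  refine le_antisymm (h1.minimalPeriod_le hk) ?_
  by_contra hlt
  push Not at hlt
  have hpos := minimalPeriod_perm_pos (σ * swap a b) b
  have h2 := perm_pow_minimalPeriod (σ * swap a b) b
  rw [cut_pow_apply hk' hb hpos hlt.le] at h2
  have := perm_pow_injOn σ a (by omega) hk' (h2.trans hb.symm)
  omega

theorem sameCycle_cut_right (hk : 0 < k) (hk' : k < minimalPeriod σ a) (hb : (σ ^ k) a = b)
    (x : α) : (σ * swap a b).SameCycle b x ↔ ∃ j, 0 < j ∧ j ≤ k ∧ (σ ^ j) a = x := by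
  rw [sameCycle_iff_exists_lt, minimalPeriod_cut_right hk hk' hb]
  constructor
  · rintro ⟨j, hj, rfl⟩
    rcases Nat.eq_zero_or_pos j with rfl | hj'
    · exact ⟨k, hk, le_rfl, by simpa using hb⟩
    · exact ⟨j, hj', hj.le, (cut_pow_apply hk' hb hj' hj.le).symm⟩
  · rintro ⟨j, hj, hjk, rfl⟩
    rcases hjk.eq_or_lt with rfl | hlt
    · exact ⟨0, hk, by simp [hb]⟩
    · exact ⟨j, hlt, cut_pow_apply hk' hb hj hjk⟩

theorem minimalPeriod_cut_left (hk : 0 < k) (hk' : k < minimalPeriod σ a) (hb : (σ ^ k) a = b) :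
    minimalPeriod (σ * swap a b) a = minimalPeriod σ a - k := by
  have hab : σ.SameCycle a b := ⟨k, by simpa using hb⟩
  -- Exchange the roles: `a` is reached from `b` after the remaining `minimalPeriod σ a - k` steps.
  rw [swap_comm]
  refine minimalPeriod_cut_right (by omega) ?_ ?_
  · rw [← minimalPeriod_eq_of_sameCycle hab]; omega
  · rw [← hb, ← Perm.mul_apply, ← pow_add, Nat.sub_add_cancel hk'.le, perm_pow_minimalPeriod]

theorem not_sameCycle_cut (hk : 0 < k) (hk' : k < minimalPeriod σ a) (hb : (σ ^ k) a = b) :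
    ¬ (σ * swap a b).SameCycle a b := by
  intro h
  obtain ⟨j, hj, hjk, hja⟩ := (sameCycle_cut_right hk hk' hb a).1 h.symm
  have := perm_pow_injOn σ a (i := j) (j := 0) (by omega) (by omega) (by simpa using hja)
  omega

end Cut

theorem exists_pow_of_sameCycle_ne {σ : Perm α} {a b : α} (h : σ.SameCycle a b) (hab : a ≠ b) :
    ∃ k, 0 < k ∧ k < minimalPeriod σ a ∧ (σ ^ k) a = b := by
  obtain ⟨k, hk, hkb⟩ := (sameCycle_iff_exists_lt σ a b).1 h
  refine ⟨k, Nat.pos_of_ne_zero ?_, hk, hkb⟩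
  rintro rfl
  exact hab (by simpa using hkb)

section Join

variable {σ : Perm α} {a b : α}

/-- Starting at `b`, the new permutation runs through the whole `σ`-cycle of `a`, which does not
contain `b`, and arrives at `a`. -/
theorem sameCycle_join (h : ¬ σ.SameCycle a b) : (σ * swap a b).SameCycle a b := by
  have key := mul_swap_pow_apply (σ := σ) (a := a) (b := b) (k := minimalPeriod σ a)
    (fun i hi hik => ⟨fun h' => ?_, fun h' => h ⟨i, by simpa using h'⟩⟩)
    (minimalPeriod_perm_pos σ a) le_rfl
  · rw [perm_pow_minimalPeriod] at key
    exact SameCycle.symm ⟨minimalPeriod σ a, by simpa using key⟩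
  · have := perm_pow_injOn σ a (i := i) (j := 0) hik (by omega) (by simpa using h')
    omega

theorem minimalPeriod_join (h : ¬ σ.SameCycle a b) :
    minimalPeriod (σ * swap a b) a = minimalPeriod σ a + minimalPeriod σ b := by
  have hab : a ≠ b := by rintro rfl; exact h (SameCycle.refl _ _)
  obtain ⟨k, hk, hk', hb⟩ := exists_pow_of_sameCycle_ne (sameCycle_join h) hab
  have h1 := minimalPeriod_cut_right hk hk' hb
  have h2 := minimalPeriod_cut_left hk hk' hb
  -- The same swap undoes the join, so the two lengths are those of the pieces obtained by cutting
  -- the joined cycle.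
  rw [mul_assoc, swap_mul_self, mul_one] at h1 h2
  omega

end Join

section Untouched

variable {σ : Perm α} {a b x : α}

theorem mul_swap_pow_apply_of_not_sameCycle (ha : ¬ σ.SameCycle a x) (hb : ¬ σ.SameCycle b x)
    (j : ℕ) : ((σ * swap a b) ^ j) x = (σ ^ j) x := by
  induction j with
  | zero => rfl
  | succ j ih =>
    rw [pow_succ', Perm.mul_apply, ih, pow_succ' σ, Perm.mul_apply, Perm.mul_apply,
      swap_apply_of_ne_of_ne]
    · rintro h; exact ha (SameCycle.symm ⟨j, by simpa using h⟩)
    · rintro h; exact hb (SameCycle.symm ⟨j, by simpa using h⟩)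

theorem cycleSet_mul_swap_of_not_sameCycle (ha : ¬ σ.SameCycle a x) (hb : ¬ σ.SameCycle b x) :
    cycleSet (σ * swap a b) x = cycleSet σ x := by
  ext y
  simp only [mem_cycleSet]
  constructor
  · intro h
    obtain ⟨j, rfl⟩ := h.exists_nat_pow_eq
    exact ⟨j, by simp [mul_swap_pow_apply_of_not_sameCycle ha hb]⟩
  · intro h
    obtain ⟨j, rfl⟩ := h.exists_nat_pow_eq
    exact ⟨j, by simp [mul_swap_pow_apply_of_not_sameCycle ha hb]⟩

theorem minimalPeriod_mul_swap_of_not_sameCycle (ha : ¬ σ.SameCycle a x)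
    (hb : ¬ σ.SameCycle b x) : minimalPeriod (σ * swap a b) x = minimalPeriod σ x := by
  rw [← card_cycleSet, ← card_cycleSet, cycleSet_mul_swap_of_not_sameCycle ha hb]

end Untouched

/-- The cycles of `σ` that do not meet `M`. -/
def cyclesAvoiding (σ : Perm α) (M : Finset α) : Finset (Finset α) :=
  (Finset.univ.filter (fun z => ∀ m ∈ M, ¬ σ.SameCycle m z)).image (cycleSet σ)

theorem mem_cyclesAvoiding {σ : Perm α} {M : Finset α} {E : Finset α} :
    E ∈ cyclesAvoiding σ M ↔ ∃ z, (∀ m ∈ M, ¬ σ.SameCycle m z) ∧ cycleSet σ z = E := by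
  simp [cyclesAvoiding]

theorem cycleSet_mem_cyclesAvoiding {σ : Perm α} {M : Finset α} {x : α} :
    cycleSet σ x ∈ cyclesAvoiding σ M ↔ ∀ m ∈ M, ¬ σ.SameCycle m x := by
  rw [mem_cyclesAvoiding]
  constructor
  · rintro ⟨z, hz, h⟩ m hm h'
    exact hz m hm (h'.trans (cycleSet_eq_iff.1 h).symm)
  · intro h; exact ⟨x, h, rfl⟩

/-- Cycles away from `a` and `b` are untouched. One inclusion, for all permutations, suffices
because the same swap leads back. -/
theorem cyclesAvoiding_mul_swap (σ : Perm α) {M : Finset α} {a b : α} (ha : a ∈ M) (hb : b ∈ M) :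
    cyclesAvoiding (σ * swap a b) M = cyclesAvoiding σ M := by
  have key : ∀ τ : Perm α, cyclesAvoiding τ M ⊆ cyclesAvoiding (τ * swap a b) M := by
    intro τ E hE
    obtain ⟨z, hz, rfl⟩ := mem_cyclesAvoiding.1 hE
    rw [← cycleSet_mul_swap_of_not_sameCycle (hz a ha) (hz b hb), cycleSet_mem_cyclesAvoiding]
    intro m hm h
    have : m ∈ cycleSet (τ * swap a b) z := by simpa using h.symm
    rw [cycleSet_mul_swap_of_not_sameCycle (hz a ha) (hz b hb), mem_cycleSet] at this
    exact hz m hm this.symm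
  refine subset_antisymm ?_ (key σ)
  have := key (σ * swap a b)
  rwa [mul_assoc, swap_mul_self, mul_one] at this

theorem cyclesAvoiding_insert_of_sameCycle {σ : Perm α} {M : Finset α} {m x : α} (hm : m ∈ M)
    (h : σ.SameCycle m x) : cyclesAvoiding σ (insert x M) = cyclesAvoiding σ M := by
  ext E
  simp only [mem_cyclesAvoiding, Finset.mem_insert, forall_eq_or_imp]
  constructor
  · rintro ⟨z, ⟨-, hz⟩, rfl⟩; exact ⟨z, hz, rfl⟩
  · rintro ⟨z, hz, rfl⟩
    exact ⟨z, ⟨fun hx => hz m hm (h.trans hx), hz⟩, rfl⟩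

theorem cyclesAvoiding_eq_insert {σ : Perm α} {M : Finset α} {x : α}
    (h : ∀ m ∈ M, ¬ σ.SameCycle m x) :
    cyclesAvoiding σ M = insert (cycleSet σ x) (cyclesAvoiding σ (insert x M)) := by
  ext E
  simp only [Finset.mem_insert, mem_cyclesAvoiding, forall_eq_or_imp]
  constructor
  · rintro ⟨z, hz, rfl⟩
    by_cases hxz : σ.SameCycle x z
    · exact Or.inl (cycleSet_eq_iff.2 hxz.symm)
    · exact Or.inr ⟨z, ⟨hxz, hz⟩, rfl⟩
  · rintro (rfl | ⟨z, ⟨-, hz⟩, rfl⟩)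
    · exact ⟨x, h, rfl⟩
    · exact ⟨z, hz, rfl⟩

theorem cycleSet_notMem_cyclesAvoiding_insert (σ : Perm α) (M : Finset α) (x : α) :
    cycleSet σ x ∉ cyclesAvoiding σ (insert x M) := by
  rw [cycleSet_mem_cyclesAvoiding]
  intro h
  exact h x (Finset.mem_insert_self _ _) (SameCycle.refl _ _)

/-- The number of cycles of `σ`, fixed points included. -/
def cycleCount (σ : Perm α) : ℕ := (cyclesAvoiding σ ∅).card

/-- The product of the weights of the cycles of `σ` that do not meet `M`. -/
def cycleWeight (w : ℕ → ℚ) (σ : Perm α) (M : Finset α) : ℚ :=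
  ∏ E ∈ cyclesAvoiding σ M, w E.card

theorem card_cyclesAvoiding_eq_succ {σ : Perm α} {M : Finset α} {x : α}
    (h : ∀ m ∈ M, ¬ σ.SameCycle m x) :
    (cyclesAvoiding σ M).card = (cyclesAvoiding σ (insert x M)).card + 1 := by
  rw [cyclesAvoiding_eq_insert h,
    Finset.card_insert_of_notMem (cycleSet_notMem_cyclesAvoiding_insert σ M x)]

theorem cycleWeight_eq_mul (w : ℕ → ℚ) {σ : Perm α} {M : Finset α} {x : α}
    (h : ∀ m ∈ M, ¬ σ.SameCycle m x) :
    cycleWeight w σ M = w (minimalPeriod σ x) * cycleWeight w σ (insert x M) := by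
  rw [cycleWeight, cyclesAvoiding_eq_insert h,
    Finset.prod_insert (cycleSet_notMem_cyclesAvoiding_insert σ M x), card_cycleSet, cycleWeight]

theorem cycleWeight_mul_swap (w : ℕ → ℚ) (σ : Perm α) {M : Finset α} {a b : α} (ha : a ∈ M)
    (hb : b ∈ M) : cycleWeight w (σ * swap a b) M = cycleWeight w σ M := by
  rw [cycleWeight, cyclesAvoiding_mul_swap σ ha hb, cycleWeight]

theorem cycleWeight_insert_of_sameCycle (w : ℕ → ℚ) {σ : Perm α} {M : Finset α} {m x : α}
    (hm : m ∈ M) (h : σ.SameCycle m x) : cycleWeight w σ (insert x M) = cycleWeight w σ M := by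
  rw [cycleWeight, cyclesAvoiding_insert_of_sameCycle hm h, cycleWeight]

theorem cycleCount_eq_of_sameCycle {σ : Perm α} {a b : α} (h : σ.SameCycle a b) :
    cycleCount σ = (cyclesAvoiding σ {a, b}).card + 1 := by
  rw [cycleCount, card_cyclesAvoiding_eq_succ (x := a) (by simp), Finset.pair_comm,
    cyclesAvoiding_insert_of_sameCycle (m := a) (by simp) h]
  rfl

theorem cycleCount_eq_of_not_sameCycle {σ : Perm α} {a b : α} (h : ¬ σ.SameCycle a b) :
    cycleCount σ = (cyclesAvoiding σ {a, b}).card + 2 := by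
  rw [cycleCount, card_cyclesAvoiding_eq_succ (x := a) (by simp),
    card_cyclesAvoiding_eq_succ (x := b) (by simpa using h), Finset.pair_comm]
  rfl

theorem cycleCount_cut {σ : Perm α} {a b : α} (h : σ.SameCycle a b) (hab : a ≠ b) :
    cycleCount (σ * swap a b) = cycleCount σ + 1 := by
  obtain ⟨k, hk, hk', hb⟩ := exists_pow_of_sameCycle_ne h hab
  rw [cycleCount_eq_of_sameCycle h, cycleCount_eq_of_not_sameCycle (not_sameCycle_cut hk hk' hb),
    cyclesAvoiding_mul_swap σ (by simp) (by simp)]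

theorem cycleCount_join {σ : Perm α} {a b : α} (h : ¬ σ.SameCycle a b) :
    cycleCount (σ * swap a b) + 1 = cycleCount σ := by
  rw [cycleCount_eq_of_not_sameCycle h, cycleCount_eq_of_sameCycle (sameCycle_join h),
    cyclesAvoiding_mul_swap σ (by simp) (by simp)]

theorem cycleCount_mul_swap_le (σ : Perm α) {a b : α} (hab : a ≠ b) :
    cycleCount (σ * swap a b) ≤ cycleCount σ + 1 := by
  by_cases h : σ.SameCycle a b
  · exact (cycleCount_cut h hab).le
  · have := cycleCount_join h
    omega

/-- Summing over the dots, each cycle being weighted by the inverse of its length. -/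
theorem sum_avoiding_eq_sum_cyclesAvoiding (σ : Perm α) (M : Finset α) (g : ℕ → ℚ) :
    ∑ x ∈ Finset.univ.filter (fun z => ∀ m ∈ M, ¬ σ.SameCycle m z), g (minimalPeriod σ x) =
      ∑ E ∈ cyclesAvoiding σ M, E.card * g E.card := by
  rw [cyclesAvoiding, ← Finset.sum_fiberwise_of_maps_to
    (t := (Finset.univ.filter (fun z => ∀ m ∈ M, ¬ σ.SameCycle m z)).image (cycleSet σ))
    (g := cycleSet σ) (fun x hx => Finset.mem_image_of_mem _ hx)]
  refine Finset.sum_congr rfl fun E hE => ?_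
  obtain ⟨z, hz, rfl⟩ := Finset.mem_image.1 hE
  have hfil : (Finset.univ.filter (fun z => ∀ m ∈ M, ¬ σ.SameCycle m z)).filter
      (fun x => cycleSet σ x = cycleSet σ z) = cycleSet σ z := by
    ext x
    simp only [Finset.mem_filter, Finset.mem_univ, true_and, cycleSet_eq_iff, mem_cycleSet] at hz ⊢
    exact ⟨fun h => h.2.symm, fun h => ⟨fun m hm hmx => hz m hm (hmx.trans h.symm), h.symm⟩⟩
  rw [hfil, Finset.sum_congr rfl (g := fun _ => g (cycleSet σ z).card), Finset.sum_const,
    nsmul_eq_mul]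
  intro x hx
  rw [card_cycleSet, minimalPeriod_eq_of_sameCycle (mem_cycleSet.1 hx)]

theorem sum_card_cyclesAvoiding_empty (σ : Perm α) :
    ∑ E ∈ cyclesAvoiding σ ∅, (E.card : ℚ) = Fintype.card α := by
  have := sum_avoiding_eq_sum_cyclesAvoiding σ ∅ (fun _ => 1)
  simpa using this.symm

end CutJoin

/-! ### Counting factorizations into transpositions -/

section FactorizationCount

set_option linter.unusedSectionVars false

open Function Equiv Equiv.Perm

variable {α : Type*} [Fintype α] [DecidableEq α]

open Classical in
/-- The transpositions of `α`. -/
noncomputable def swapFinset (α : Type*) [Fintype α] [DecidableEq α] : Finset (Perm α) :=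
  Finset.univ.filter Equiv.Perm.IsSwap

theorem mem_swapFinset {τ : Perm α} : τ ∈ swapFinset α ↔ τ.IsSwap := by simp [swapFinset]

/-- A transposition moves two points, so the pairs `(τ, a)` with `a` moved by `τ` correspond to the
ordered pairs `(a, τ a)`. -/
theorem two_mul_sum_swapFinset (g : Perm α → ℚ) :
    2 * ∑ τ ∈ swapFinset α, g τ =
      ∑ a, ∑ b ∈ Finset.univ.filter (fun b => a ≠ b), g (swap a b) := by
  have h : ∀ τ ∈ swapFinset α, 2 * g τ = ∑ _a ∈ τ.support, g τ := by
    intro τ hτ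
    rw [Finset.sum_const, card_support_eq_two.2 (mem_swapFinset.1 hτ), nsmul_eq_mul]
    norm_num
  rw [Finset.mul_sum, Finset.sum_congr rfl h, Finset.sum_sigma', Finset.sum_sigma']
  refine Finset.sum_bij' (fun p _ => ⟨p.2, p.1 p.2⟩) (fun q _ => ⟨swap q.1 q.2, q.1⟩) ?_ ?_ ?_ ?_ ?_
  · rintro ⟨τ, a⟩ h
    simp only [Finset.mem_sigma, Perm.mem_support] at h
    simpa using Ne.symm h.2
  · rintro ⟨a, b⟩ h
    simp only [Finset.mem_sigma, Finset.mem_univ, Finset.mem_filter, true_and] at h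
    simp only [Finset.mem_sigma, mem_swapFinset, Perm.mem_support, swap_apply_left]
    exact ⟨⟨a, b, h, rfl⟩, h.symm⟩
  · rintro ⟨τ, a⟩ h
    simp only [Finset.mem_sigma, Perm.mem_support, mem_swapFinset] at h
    obtain ⟨⟨x, y, hxy, rfl⟩, ha⟩ := h
    rcases eq_or_ne a x with rfl | hx
    · simp
    · rcases eq_or_ne a y with rfl | hy
      · simp [swap_comm]
      · exact absurd (swap_apply_of_ne_of_ne hx hy) ha
  · rintro ⟨a, b⟩ h
    simp
  · rintro ⟨τ, a⟩ h
    simp only [Finset.mem_sigma, Perm.mem_support, mem_swapFinset] at h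
    obtain ⟨⟨x, y, hxy, rfl⟩, ha⟩ := h
    rcases eq_or_ne a x with rfl | hx
    · simp
    · rcases eq_or_ne a y with rfl | hy
      · simp [swap_comm]
      · exact absurd (swap_apply_of_ne_of_ne hx hy) ha

theorem sum_cycleSet_ne {M : Type*} [AddCommMonoid M] (σ : Perm α) (a : α) (g : α → M) :
    ∑ b ∈ (cycleSet σ a).filter (fun b => a ≠ b), g b =
      ∑ k ∈ Finset.Ico 1 (minimalPeriod σ a), g ((σ ^ k) a) := by
  rw [Finset.sum_filter, sum_cycleSet, Finset.range_eq_Ico,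
    Finset.sum_eq_sum_Ico_succ_bot (minimalPeriod_perm_pos σ a)]
  simp only [pow_zero, Perm.one_apply, ne_eq, not_true_eq_false, if_false, zero_add]
  refine Finset.sum_congr rfl fun k hk => ?_
  rw [if_pos]
  intro h
  rw [Finset.mem_Ico] at hk
  have := perm_pow_injOn σ a (i := 0) (j := k) (by omega) hk.2 (by simpa using h)
  omega

/-- The number of ways of writing `σ = φ τ₁ ⋯ τ_s` with `φ` having all its cycles of length `r`
and `τ₁, …, τ_s` transpositions. -/
noncomputable def factorizationCount (r : ℕ) : ℕ → Perm α → ℕ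
  | 0, σ => open Classical in if ∀ k, minimalPeriod σ k = r then 1 else 0
  | s + 1, σ => ∑ τ ∈ swapFinset α, factorizationCount r s (σ * τ)

/-- The number of ways of writing `σ = φ τ₁ ⋯ τ_s` with `φ` having all its cycles of length `r`
and `τ₁, …, τ_s` transpositions, one of which does not preserve `S`. -/
noncomputable def crossingCount (r : ℕ) (S : Finset α) : ℕ → Perm α → ℕ
  | 0, _ => 0
  | s + 1, σ => ∑ τ ∈ swapFinset α,
      if ∀ x, τ x ∈ S ↔ x ∈ S then crossingCount r S s (σ * τ) else factorizationCount r s (σ * τ)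

theorem swap_preserves_iff {S : Finset α} {a b : α} :
    (∀ x, swap a b x ∈ S ↔ x ∈ S) ↔ (a ∈ S ↔ b ∈ S) := by
  constructor
  · intro h
    have := h b
    rwa [swap_apply_right] at this
  · intro h x
    rcases eq_or_ne x a with rfl | hx
    · rw [swap_apply_left]; exact h.symm
    · rcases eq_or_ne x b with rfl | hy
      · rw [swap_apply_right]; exact h
      · rw [swap_apply_of_ne_of_ne hx hy]

theorem mem_iff_of_sameCycle {σ : Perm α} {S : Finset α} (hS : ∀ x, σ x ∈ S ↔ x ∈ S) {x y : α}
    (h : σ.SameCycle x y) : x ∈ S ↔ y ∈ S := by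
  obtain ⟨n, rfl⟩ := h.exists_nat_pow_eq
  induction n with
  | zero => rfl
  | succ n ih => rw [pow_succ', Perm.mul_apply, hS]; exact ih ⟨n, by simp⟩

theorem cycleCount_mul_eq_card {r : ℕ} {σ : Perm α} (h : ∀ k, minimalPeriod σ k = r) :
    cycleCount σ * r = Fintype.card α := by
  have := sum_card_cyclesAvoiding_empty σ
  rw [Finset.sum_congr rfl (g := fun _ => (r : ℚ)), Finset.sum_const, nsmul_eq_mul] at this
  · exact_mod_cast this
  · intro E hE
    obtain ⟨z, -, rfl⟩ := mem_cyclesAvoiding.1 hE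
    rw [card_cycleSet, h]

/-- Each transposition raises the number of cycles by at most one, and `φ` must have `card α / r` of
them. -/
theorem factorizationCount_eq_zero {r s : ℕ} {σ : Perm α}
    (h : (s + cycleCount σ) * r < Fintype.card α) : factorizationCount r s σ = 0 := by
  induction s generalizing σ with
  | zero =>
    rw [factorizationCount, if_neg]
    intro h'
    rw [zero_add, cycleCount_mul_eq_card h'] at h
    exact lt_irrefl _ h
  | succ s ih =>
    refine Finset.sum_eq_zero fun τ hτ => ?_
    obtain ⟨a, b, hab, rfl⟩ := mem_swapFinset.1 hτ
    refine ih (lt_of_le_of_lt (Nat.mul_le_mul_right r ?_) h)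
    have := cycleCount_mul_swap_le σ hab
    omega

/-- The crossing transposition costs one cycle instead of gaining one, so at most `s + cycleCount σ
- 2` cycles can be reached. -/
theorem crossingCount_eq_zero {r s : ℕ} {σ : Perm α} {S : Finset α}
    (hS : ∀ x, σ x ∈ S ↔ x ∈ S) (h : (s + cycleCount σ) * r < Fintype.card α + 2 * r) :
    crossingCount r S s σ = 0 := by
  induction s generalizing σ with
  | zero => rfl
  | succ s ih =>
    refine Finset.sum_eq_zero fun τ hτ => ?_
    obtain ⟨a, b, hab, rfl⟩ := mem_swapFinset.1 hτ
    split_ifs with hp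
    · refine ih (fun x => ?_) (lt_of_le_of_lt (Nat.mul_le_mul_right r ?_) h)
      · rw [Perm.mul_apply, hS, hp]
      · have := cycleCount_mul_swap_le σ hab
        omega
    · rw [swap_preserves_iff] at hp
      refine factorizationCount_eq_zero ?_
      -- `S` is a union of cycles of `σ`, so a transposition that does not preserve `S` joins two
      -- cycles.
      have hc := cycleCount_join (fun hsc => hp (mem_iff_of_sameCycle hS hsc))
      rw [← hc] at h
      nlinarith

section Cut

variable {w : ℕ → ℚ} {σ : Perm α} {a b : α} {k : ℕ}

theorem sameCycle_cut_or (hk : 0 < k) (hk' : k < minimalPeriod σ a) (hb : (σ ^ k) a = b) {x : α}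
    (hx : σ.SameCycle a x) : (σ * swap a b).SameCycle a x ∨ (σ * swap a b).SameCycle b x := by
  have hab : σ.SameCycle a b := ⟨k, by simpa using hb⟩
  obtain ⟨j, hj, rfl⟩ := (sameCycle_iff_exists_lt σ a x).1 hx
  rcases Nat.eq_zero_or_pos j with rfl | hj0
  · exact Or.inl (by simp [SameCycle.refl])
  rcases le_or_gt j k with hjk | hjk
  · exact Or.inr ((sameCycle_cut_right hk hk' hb _).2 ⟨j, hj0, hjk, rfl⟩)
  · left
    rw [swap_comm]
    refine (sameCycle_cut_right (k := minimalPeriod σ a - k) (by omega) ?_ ?_ _).2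
      ⟨j - k, by omega, by omega, ?_⟩
    · rw [← minimalPeriod_eq_of_sameCycle hab]; omega
    · rw [← hb, ← Perm.mul_apply, ← pow_add, Nat.sub_add_cancel hk'.le, perm_pow_minimalPeriod]
    · rw [← hb, ← Perm.mul_apply, ← pow_add, Nat.sub_add_cancel hjk.le]

theorem not_sameCycle_mul_swap {m : α} (ha : ¬ σ.SameCycle a m) (hb : ¬ σ.SameCycle b m) {z : α}
    (hz : ¬ σ.SameCycle m z) : ¬ (σ * swap a b).SameCycle m z := by
  rw [← mem_cycleSet, cycleSet_mul_swap_of_not_sameCycle ha hb]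
  simpa using hz

theorem cycleWeight_cut (hk : 0 < k) (hk' : k < minimalPeriod σ a) (hb : (σ ^ k) a = b)
    {M : Finset α} (hM : ∀ m ∈ M, ¬ σ.SameCycle m a) :
    cycleWeight w (σ * swap a b) M =
      w k * w (minimalPeriod σ a - k) * cycleWeight w σ (insert a M) := by
  have hab : σ.SameCycle a b := ⟨k, by simpa using hb⟩
  have hMb : ∀ m ∈ M, ¬ σ.SameCycle m b := fun m hm h => hM m hm (h.trans hab.symm)
  rw [cycleWeight_eq_mul w (x := a) (M := M), cycleWeight_eq_mul w (x := b) (M := insert a M),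
    minimalPeriod_cut_right hk hk' hb, minimalPeriod_cut_left hk hk' hb,
    cycleWeight_mul_swap w σ (by simp) (by simp),
    cycleWeight_insert_of_sameCycle w (m := a) (by simp) hab]
  · ring
  · simp only [Finset.mem_insert, forall_eq_or_imp]
    exact ⟨not_sameCycle_cut hk hk' hb, fun m hm => not_sameCycle_mul_swap
      (fun h => hM m hm h.symm) (fun h => hMb m hm h.symm) (hMb m hm)⟩
  · exact fun m hm => not_sameCycle_mul_swap
      (fun h => hM m hm h.symm) (fun h => hMb m hm h.symm) (hM m hm)

theorem cycleWeight_join (h : ¬ σ.SameCycle a b) :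
    cycleWeight w (σ * swap a b) ∅ =
      w (minimalPeriod σ a + minimalPeriod σ b) * cycleWeight w σ {a, b} := by
  rw [cycleWeight_eq_mul w (x := a) (by simp), minimalPeriod_join h,
    ← cycleWeight_insert_of_sameCycle w (m := a) (by simp) (sameCycle_join h),
    insert_empty_eq, Finset.pair_comm, cycleWeight_mul_swap w σ (by simp) (by simp)]

end Cut

/-- The weights of one-vertex graphs: they vanish off the multiples of `r`, are normalized, and
satisfy the cut-and-join recursion. -/
structure IsDiscWeight (r : ℕ) (w : ℕ → ℚ) : Prop where
  eq_zero : ∀ n, ¬ r ∣ n → w n = 0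
  apply_self : w r = 1
  cutJoin : ∀ n, 1 ≤ n →
    n * ∑ k ∈ Finset.Ico 1 n, w k * w (n - k) = 2 * ((n : ℚ) / r - 1) * w n

/-- The weights of two-vertex graphs: they satisfy the cut-and-join recursion. -/
def IsAnnulusWeight (r : ℕ) (w : ℕ → ℚ) (u : ℕ → ℕ → ℚ) : Prop :=
  ∀ m n, 1 ≤ m → 1 ≤ n → ((m + n : ℕ) : ℚ) / r * u m n =
    w (m + n) + ∑ k ∈ Finset.Ico 1 m, k * u k n * w (m - k) +
      ∑ k ∈ Finset.Ico 1 n, k * u m k * w (n - k)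

/-! ### Minimal factorizations are counted by the one-vertex weights. -/

section DiscWeight

variable {r : ℕ} {w : ℕ → ℚ}

/-- A cut at distance `k` splits the cycle of length `n` through `a` into pieces of lengths `k` and
`n - k`; this is the recursion `cutJoin` divided by `n`. -/
theorem IsDiscWeight.sum_cut (hw : IsDiscWeight r w) {σ : Perm α} {a : α} {M : Finset α}
    (hM : ∀ m ∈ M, ¬ σ.SameCycle m a) :
    ∑ k ∈ Finset.Ico 1 (minimalPeriod σ a), cycleWeight w (σ * swap a ((σ ^ k) a)) M =
      (2 / r - 2 / minimalPeriod σ a) * cycleWeight w σ M := by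
  have hpos : (0 : ℚ) < minimalPeriod σ a := by exact_mod_cast minimalPeriod_perm_pos σ a
  rw [cycleWeight_eq_mul w hM, Finset.sum_congr rfl fun k hk =>
    cycleWeight_cut (w := w) (k := k) (by simp at hk; omega) (by simp at hk; omega) rfl hM,
    ← Finset.sum_mul, ← mul_assoc]
  congr 1
  have := hw.cutJoin _ (minimalPeriod_perm_pos σ a)
  field_simp at this ⊢
  linear_combination this

/-- A cycle `E` contributes `|E| (2 / r - 2 / |E|)`. For `M = ∅` and a factorization by `s` cuts
alone the bracket equals `2 s`. -/
theorem IsDiscWeight.sum_sum_cut (hw : IsDiscWeight r w) (σ : Perm α) (M : Finset α) :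
    ∑ a ∈ Finset.univ.filter (fun z => ∀ m ∈ M, ¬ σ.SameCycle m z),
      ∑ b ∈ (cycleSet σ a).filter (fun b => a ≠ b), cycleWeight w (σ * swap a b) M =
      (2 * (∑ E ∈ cyclesAvoiding σ M, (E.card : ℚ)) / r - 2 * (cyclesAvoiding σ M).card) *
        cycleWeight w σ M := by
  have h1 : ∀ a ∈ Finset.univ.filter (fun z => ∀ m ∈ M, ¬ σ.SameCycle m z),
      ∑ b ∈ (cycleSet σ a).filter (fun b => a ≠ b), cycleWeight w (σ * swap a b) M =
        (2 / r - 2 / minimalPeriod σ a) * cycleWeight w σ M := by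
    intro a ha
    rw [sum_cycleSet_ne σ a (fun b => cycleWeight w (σ * swap a b) M)]
    exact hw.sum_cut (by simpa using ha)
  rw [Finset.sum_congr rfl h1, ← Finset.sum_mul,
    sum_avoiding_eq_sum_cyclesAvoiding σ M (fun n => (2 / r - 2 / n : ℚ))]
  congr 1
  rw [Finset.sum_congr rfl (g := fun E => 2 / (r : ℚ) * E.card - 2), Finset.sum_sub_distrib,
    ← Finset.mul_sum, Finset.sum_const, nsmul_eq_mul]
  · ring
  · intro E hE
    obtain ⟨z, -, rfl⟩ := mem_cyclesAvoiding.1 hE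
    have hpos : (0 : ℚ) < minimalPeriod σ z := by exact_mod_cast minimalPeriod_perm_pos σ z
    rw [card_cycleSet]
    field_simp

theorem IsDiscWeight.dvd_of_cycleWeight_ne_zero (hw : IsDiscWeight r w) {σ : Perm α}
    {M : Finset α} (h : cycleWeight w σ M ≠ 0) {E : Finset α} (hE : E ∈ cyclesAvoiding σ M) :
    r ∣ E.card ∧ r ≤ E.card := by
  have h1 : r ∣ E.card := by
    by_contra h'
    exact h (Finset.prod_eq_zero hE (hw.eq_zero _ h'))
  refine ⟨h1, Nat.le_of_dvd ?_ h1⟩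
  obtain ⟨z, -, rfl⟩ := mem_cyclesAvoiding.1 hE
  rw [card_cycleSet]
  exact minimalPeriod_perm_pos σ z

/-- The hypothesis leaves no room for a join: every removed transposition must cut. Summing over the
last one multiplies the weight by the number of transpositions, which builds up the factorial. -/
theorem IsDiscWeight.factorizationCount_eq (hr : 1 ≤ r) (hw : IsDiscWeight r w) {s : ℕ}
    {σ : Perm α} (h : (s + cycleCount σ) * r = Fintype.card α) :
    (factorizationCount r s σ : ℚ) = s.factorial * cycleWeight w σ ∅ := by
  induction s generalizing σ with
  | zero =>
    rw [factorizationCount]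
    split_ifs with h'
    · simp only [cycleWeight, Nat.factorial_zero, Nat.cast_one, one_mul]
      rw [Finset.prod_eq_one]
      intro E hE
      obtain ⟨z, -, rfl⟩ := mem_cyclesAvoiding.1 hE
      rw [card_cycleSet, h', hw.apply_self]
    -- A non-zero weight forces every cycle length to be a positive multiple of `r`; the average
    -- length being `r`, all of them equal `r`.
    · by_contra hne
      have hne' : cycleWeight w σ ∅ ≠ 0 := by
        intro h0
        rw [h0] at hne
        simp at hne
      have hsum : ∑ E ∈ cyclesAvoiding σ ∅, r = ∑ E ∈ cyclesAvoiding σ ∅, E.card := by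
        rw [Finset.sum_const, smul_eq_mul]
        have h2 := sum_card_cyclesAvoiding_empty σ
        rw [zero_add] at h
        have h3 : ∑ E ∈ cyclesAvoiding σ ∅, E.card = Fintype.card α := by exact_mod_cast h2
        rw [h3]
        exact h
      have hall := (Finset.sum_eq_sum_iff_of_le
        (fun E hE => (hw.dvd_of_cycleWeight_ne_zero hne' hE).2)).1 hsum
      refine h' fun k => ?_
      rw [← card_cycleSet]
      exact (hall _ (cycleSet_mem_cyclesAvoiding.2 (by simp))).symm
  | succ s ih =>
    have hterm : ∀ a b : α, a ≠ b → (factorizationCount r s (σ * swap a b) : ℚ) =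
        if b ∈ cycleSet σ a then s.factorial * cycleWeight w (σ * swap a b) ∅ else 0 := by
      intro a b hab
      split_ifs with hc <;> rw [mem_cycleSet] at hc
      · refine ih ?_
        rw [cycleCount_cut hc hab, ← h]; ring
      · have hj := cycleCount_join hc
        rw [factorizationCount_eq_zero, Nat.cast_zero]
        rw [← h, ← hj]
        exact Nat.mul_lt_mul_of_pos_right (by omega) hr
    have h2 : 2 * (factorizationCount r (s + 1) σ : ℚ) =
        2 * ((s + 1).factorial * cycleWeight w σ ∅) := by
      rw [factorizationCount, Nat.cast_sum,
        two_mul_sum_swapFinset (fun τ => (factorizationCount r s (σ * τ) : ℚ))]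
      have h3 : ∀ a : α, ∑ b ∈ Finset.univ.filter (fun b => a ≠ b),
          (factorizationCount r s (σ * swap a b) : ℚ) = s.factorial *
          ∑ b ∈ (cycleSet σ a).filter (fun b => a ≠ b), cycleWeight w (σ * swap a b) ∅ := by
        intro a
        rw [Finset.sum_congr rfl fun b hb => hterm a b (by simpa using hb), Finset.mul_sum,
          ← Finset.sum_filter, Finset.filter_filter]
        refine Finset.sum_congr ?_ fun _ _ => rfl
        ext b; simp [and_comm]
      rw [Finset.sum_congr rfl fun a _ => h3 a, ← Finset.mul_sum]
      have h4 := hw.sum_sum_cut σ ∅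
      simp only [Finset.notMem_empty, false_imp_iff, implies_true, Finset.filter_true] at h4
      rw [h4, sum_card_cyclesAvoiding_empty, ← h, Nat.factorial_succ]
      have hr' : (r : ℚ) ≠ 0 := by positivity
      push_cast
      rw [show (cyclesAvoiding σ ∅).card = cycleCount σ from rfl]
      field_simp
      ring
    linarith

end DiscWeight

end FactorizationCount

/-! ### Factorizations with a crossing transposition are counted by the two-vertex weights. -/

section CrossingCount

open Function Equiv Equiv.Perm

set_option linter.unusedSectionVars false

variable {α : Type*} [Fintype α] [DecidableEq α]

/-- There are `n - k` pairs `i < j < n` with difference `k`. -/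
theorem sum_range_sum_range_sub (h : ℕ → ℚ) (n : ℕ) :
    ∑ j ∈ Finset.range n, ∑ i ∈ Finset.range j, h (j - i) =
      ∑ k ∈ Finset.Ico 1 n, ((n - k : ℕ) : ℚ) * h k := by
  induction n with
  | zero => simp
  | succ n ih =>
    rw [Finset.sum_range_succ, ih]
    rcases Nat.eq_zero_or_pos n with rfl | hn
    · simp
    rw [Finset.sum_Ico_succ_top (by omega), ← Finset.sum_range_reflect, ]
    have h1 : ∑ j ∈ Finset.range n, h (n - (n - 1 - j)) = ∑ k ∈ Finset.Ico 1 (n + 1), h k := by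
      rw [Finset.sum_Ico_eq_sum_range]
      refine Finset.sum_congr (by simp) fun j hj => ?_
      rw [Finset.mem_range] at hj
      congr 1; omega
    rw [h1, Finset.sum_Ico_succ_top (by omega), ← add_assoc, ← Finset.sum_add_distrib]
    congr 1
    · refine Finset.sum_congr rfl fun k hk => ?_
      rw [Finset.mem_Ico] at hk
      rw [Nat.cast_sub hk.2.le, Nat.cast_sub (by omega)]
      push_cast
      ring
    · simp

theorem sum_ne_eq_two_mul_sum_lt (f : ℕ → ℕ → ℚ) (hf : ∀ i j, f i j = f j i) (n : ℕ) :
    ∑ i ∈ Finset.range n, ∑ j ∈ (Finset.range n).filter (fun j => i ≠ j), f i j =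
      2 * ∑ j ∈ Finset.range n, ∑ i ∈ Finset.range j, f i j := by
  induction n with
  | zero => simp
  | succ n ih =>
    have h1 : ∀ i ∈ Finset.range n, ∑ j ∈ (Finset.range (n + 1)).filter (fun j => i ≠ j), f i j =
        (∑ j ∈ (Finset.range n).filter (fun j => i ≠ j), f i j) + f i n := by
      intro i hi
      rw [Finset.mem_range] at hi
      rw [Finset.range_add_one, Finset.filter_insert, if_pos (by omega),
        Finset.sum_insert (by simp), add_comm]
    have h2 : (Finset.range (n + 1)).filter (fun j => n ≠ j) = Finset.range n := by
      ext j; simp; omega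
    rw [Finset.sum_range_succ, Finset.sum_congr rfl h1, Finset.sum_add_distrib, ih, h2,
      Finset.sum_range_succ, Finset.sum_congr rfl fun j _ => hf n j]
    ring

/-- The piece through `(σ ^ j) x` consists of the positions `i + 1, …, j`, so it misses position
`0`, which is `x`. -/
theorem minimalPeriod_cut_of_lt {σ : Perm α} {x : α} {i j : ℕ} (hij : i < j)
    (hj : j < minimalPeriod σ x) :
    minimalPeriod (σ * swap ((σ ^ i) x) ((σ ^ j) x)) x = minimalPeriod σ x - (j - i) ∧
    (σ * swap ((σ ^ i) x) ((σ ^ j) x)).SameCycle ((σ ^ i) x) x := by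
  have hix : σ.SameCycle ((σ ^ i) x) x := SameCycle.symm ⟨i, by simp⟩
  have hp := minimalPeriod_eq_of_sameCycle hix
  have hk : 0 < j - i := by omega
  have hk' : j - i < minimalPeriod σ ((σ ^ i) x) := by omega
  have hb : (σ ^ (j - i)) ((σ ^ i) x) = (σ ^ j) x := by
    rw [← Perm.mul_apply, ← pow_add, Nat.sub_add_cancel hij.le]
  have hs : (σ * swap ((σ ^ i) x) ((σ ^ j) x)).SameCycle ((σ ^ i) x) x := by
    refine (sameCycle_cut_or hk hk' hb hix).resolve_right fun h => ?_
    obtain ⟨m, hm, hmk, hmx⟩ := (sameCycle_cut_right hk hk' hb x).1 h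
    rw [← Perm.mul_apply, ← pow_add] at hmx
    have := perm_pow_injOn σ x (i := m + i) (j := 0) (by omega) (by omega) (by simpa using hmx)
    omega
  refine ⟨?_, hs⟩
  rw [← minimalPeriod_eq_of_sameCycle hs, minimalPeriod_cut_left hk hk' hb, hp]

/-- The weight of the two-vertex graphs in which the vertices through `x` and `y` are joined. -/
noncomputable def markedWeight (w : ℕ → ℚ) (u : ℕ → ℕ → ℚ) (σ : Perm α) (x y : α) : ℚ :=
  u (minimalPeriod σ x) (minimalPeriod σ y) * cycleWeight w σ {x, y}

variable {r : ℕ} {w : ℕ → ℚ} {u : ℕ → ℕ → ℚ} {σ : Perm α} {x y : α}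

theorem markedWeight_swap :
    markedWeight w u σ x y = markedWeight w (fun m n => u n m) σ y x := by
  rw [markedWeight, markedWeight, Finset.pair_comm]

theorem markedWeight_cut_of_lt (hxy : ¬ σ.SameCycle x y) {i j : ℕ} (hij : i < j)
    (hj : j < minimalPeriod σ x) :
    markedWeight w u (σ * swap ((σ ^ i) x) ((σ ^ j) x)) x y =
      u (minimalPeriod σ x - (j - i)) (minimalPeriod σ y) * w (j - i) *
        cycleWeight w σ {x, y} := by
  obtain ⟨hp, hs⟩ := minimalPeriod_cut_of_lt hij hj
  have hix : σ.SameCycle x ((σ ^ i) x) := ⟨i, by simp⟩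
  have hjx : σ.SameCycle x ((σ ^ j) x) := ⟨j, by simp⟩
  have hpi := minimalPeriod_eq_of_sameCycle hix
  have hk : 0 < j - i := by omega
  have hk' : j - i < minimalPeriod σ ((σ ^ i) x) := by omega
  have hb : (σ ^ (j - i)) ((σ ^ i) x) = (σ ^ j) x := by
    rw [← Perm.mul_apply, ← pow_add, Nat.sub_add_cancel hij.le]
  have hiy : ¬ σ.SameCycle ((σ ^ i) x) y := fun h => hxy (hix.trans h)
  have hjy : ¬ σ.SameCycle ((σ ^ j) x) y := fun h => hxy (hjx.trans h)
  rw [markedWeight, hp, minimalPeriod_mul_swap_of_not_sameCycle hiy hjy,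
    cycleWeight_eq_mul w (x := (σ ^ j) x) (M := {x, y}), minimalPeriod_cut_right hk hk' hb,
    ← cycleWeight_insert_of_sameCycle w (m := x) (x := (σ ^ i) x)
      (M := insert ((σ ^ j) x) {x, y}) (by simp) hs.symm,
    cycleWeight_mul_swap w σ (by simp) (by simp),
    cycleWeight_insert_of_sameCycle w (m := x) (by simp) hix,
    cycleWeight_insert_of_sameCycle w (m := x) (by simp) hjx]
  · ring
  · simp only [Finset.mem_insert, Finset.mem_singleton, forall_eq_or_imp, forall_eq]
    exact ⟨fun h => not_sameCycle_cut hk hk' hb (hs.trans h),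
      not_sameCycle_mul_swap hiy hjy (fun h => hjy h.symm)⟩

/-- Exactly `k` of the cuts at positions `i < j` leave `x` on a piece of length `k`. This is where
the factor `k` in `IsAnnulusWeight` comes from; the `2` counts ordered pairs. -/
theorem sum_sum_cut_markedWeight (hxy : ¬ σ.SameCycle x y) :
    ∑ a ∈ cycleSet σ x, ∑ b ∈ (cycleSet σ a).filter (fun b => a ≠ b),
      markedWeight w u (σ * swap a b) x y =
      2 * (∑ k ∈ Finset.Ico 1 (minimalPeriod σ x),
        k * u k (minimalPeriod σ y) * w (minimalPeriod σ x - k)) * cycleWeight w σ {x, y} := by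
  set n := minimalPeriod σ x with hn
  set f : ℕ → ℕ → ℚ := fun i j => markedWeight w u (σ * swap ((σ ^ i) x) ((σ ^ j) x)) x y with hf
  have h1 : ∀ a ∈ cycleSet σ x, ∑ b ∈ (cycleSet σ a).filter (fun b => a ≠ b),
      markedWeight w u (σ * swap a b) x y =
      ∑ b ∈ cycleSet σ x, if a ≠ b then markedWeight w u (σ * swap a b) x y else 0 := by
    intro a ha
    rw [Finset.sum_filter, cycleSet_eq_iff.2 (mem_cycleSet.1 ha)]
  have h2 : ∀ i ∈ Finset.range n, (∑ j ∈ Finset.range n, if (σ ^ i) x ≠ (σ ^ j) x then f i j else 0)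
      = ∑ j ∈ (Finset.range n).filter (fun j => i ≠ j), f i j := by
    intro i hi
    rw [Finset.sum_filter]
    refine Finset.sum_congr rfl fun j hj => ?_
    rw [Finset.mem_range] at hi hj
    refine if_congr ⟨fun h h' => h (by rw [h']), fun h h' => h (perm_pow_injOn σ x hi hj h')⟩ rfl rfl
  rw [Finset.sum_congr rfl h1, sum_cycleSet, Finset.sum_congr rfl fun i _ => sum_cycleSet σ x _,
    ← hn, Finset.sum_congr rfl h2,
    sum_ne_eq_two_mul_sum_lt f (fun i j => by simp only [hf, swap_comm])]
  have h3 : ∑ j ∈ Finset.range n, ∑ i ∈ Finset.range j, f i j =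
      ∑ j ∈ Finset.range n, ∑ i ∈ Finset.range j, (fun k => u (n - k) (minimalPeriod σ y) *
        w k * cycleWeight w σ {x, y}) (j - i) := by
    refine Finset.sum_congr rfl fun j hj => Finset.sum_congr rfl fun i hi => ?_
    rw [Finset.mem_range] at hi hj
    exact markedWeight_cut_of_lt hxy hi (hn ▸ hj)
  rw [h3, sum_range_sum_range_sub (fun k => u (n - k) (minimalPeriod σ y) * w k *
    cycleWeight w σ {x, y}), mul_assoc, Finset.sum_mul]
  congr 1
  refine Finset.sum_bij' (fun k _ => n - k) (fun k _ => n - k) ?_ ?_ ?_ ?_ ?_ <;>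
    intro k hk <;> rw [Finset.mem_Ico] at hk
  · rw [Finset.mem_Ico]; omega
  · rw [Finset.mem_Ico]; omega
  · omega
  · omega
  · rw [Nat.sub_sub_self hk.2.le]; ring

theorem sum_card_cyclesAvoiding_pair (hxy : ¬ σ.SameCycle x y) :
    ∑ E ∈ cyclesAvoiding σ {x, y}, (E.card : ℚ) =
      Fintype.card α - minimalPeriod σ x - minimalPeriod σ y := by
  rw [← sum_card_cyclesAvoiding_empty σ, cyclesAvoiding_eq_insert (x := x) (M := ∅) (by simp),
    Finset.sum_insert (cycleSet_notMem_cyclesAvoiding_insert σ _ x), insert_empty_eq,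
    cyclesAvoiding_eq_insert (x := y) (M := {x}) (by simpa using hxy),
    Finset.sum_insert (cycleSet_notMem_cyclesAvoiding_insert σ _ y), card_cycleSet, card_cycleSet,
    Finset.pair_comm]
  ring

/-- Cuts of the cycle of `x`, or of `y`, give the two sums of the annulus recursion; cuts elsewhere
are governed by the disc weights. What is missing for an eigenvalue equation is the `w (m + n)`
term, which the joins will supply. -/
theorem sum_markedWeight_cut (hw : IsDiscWeight r w) (hu : IsAnnulusWeight r w u)
    (hxy : ¬ σ.SameCycle x y) :
    ∑ a, ∑ b ∈ (cycleSet σ a).filter (fun b => a ≠ b), markedWeight w u (σ * swap a b) x y =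
      2 * ((Fintype.card α : ℚ) / r - cycleCount σ + 2) * markedWeight w u σ x y -
        2 * w (minimalPeriod σ x + minimalPeriod σ y) * cycleWeight w σ {x, y} := by
  classical
  set F : α → ℚ := fun a => ∑ b ∈ (cycleSet σ a).filter (fun b => a ≠ b),
    markedWeight w u (σ * swap a b) x y with hF
  have hsplit : ∑ a, F a = ∑ a ∈ cycleSet σ x, F a + ∑ a ∈ cycleSet σ y, F a +
      ∑ a ∈ Finset.univ.filter (fun z => ∀ m ∈ ({x, y} : Finset α), ¬ σ.SameCycle m z), F a := by
    rw [← Finset.sum_union, ← Finset.sum_filter_not_add_sum_filter Finset.univ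
      (fun z => ∀ m ∈ ({x, y} : Finset α), ¬ σ.SameCycle m z)]
    · congr 1
      refine Finset.sum_congr ?_ fun _ _ => rfl
      ext z
      simp only [Finset.mem_insert, Finset.mem_singleton, forall_eq_or_imp, forall_eq,
        Finset.mem_filter, Finset.mem_univ, true_and, Finset.mem_union, mem_cycleSet]
      tauto
    · rw [Finset.disjoint_left]
      intro z hz hz'
      exact hxy ((mem_cycleSet.1 hz).trans (mem_cycleSet.1 hz').symm)
  have hx : ∑ a ∈ cycleSet σ x, F a = _ := sum_sum_cut_markedWeight hxy
  have hy : ∑ a ∈ cycleSet σ y, F a =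
      2 * (∑ k ∈ Finset.Ico 1 (minimalPeriod σ y),
        k * u (minimalPeriod σ x) k * w (minimalPeriod σ y - k)) * cycleWeight w σ {x, y} := by
    simp only [hF, markedWeight_swap (u := u)]
    rw [sum_sum_cut_markedWeight (fun h => hxy h.symm), Finset.pair_comm]
  have hrest : ∑ a ∈ Finset.univ.filter
      (fun z => ∀ m ∈ ({x, y} : Finset α), ¬ σ.SameCycle m z), F a =
      u (minimalPeriod σ x) (minimalPeriod σ y) *
        ((2 * (∑ E ∈ cyclesAvoiding σ {x, y}, (E.card : ℚ)) / r -
          2 * (cyclesAvoiding σ {x, y}).card) * cycleWeight w σ {x, y}) := by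
    rw [← hw.sum_sum_cut, Finset.mul_sum]
    refine Finset.sum_congr rfl fun a ha => ?_
    rw [hF, Finset.mul_sum]
    refine Finset.sum_congr rfl fun b hb => ?_
    simp only [Finset.mem_insert, Finset.mem_singleton, forall_eq_or_imp, forall_eq,
        Finset.mem_filter, Finset.mem_univ, true_and, mem_cycleSet] at ha hb
    rw [markedWeight, minimalPeriod_mul_swap_of_not_sameCycle (fun h => ha.1 h.symm)
      (fun h => ha.1 (hb.1.trans h).symm), minimalPeriod_mul_swap_of_not_sameCycle
      (fun h => ha.2 h.symm) (fun h => ha.2 (hb.1.trans h).symm)]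
  have hc : (cycleCount σ : ℚ) = (cyclesAvoiding σ {x, y}).card + 2 := by
    exact_mod_cast cycleCount_eq_of_not_sameCycle hxy
  have hR := hu _ _ (minimalPeriod_perm_pos σ x) (minimalPeriod_perm_pos σ y)
  rw [hsplit, hx, hy, hrest, sum_card_cyclesAvoiding_pair hxy, hc, markedWeight]
  push_cast at hR
  linear_combination (-2 * cycleWeight w σ {x, y}) * hR

/-- With non-zero weight, the `cycleCount σ - 2` cycles off `x` and `y` would fill all the dots,
leaving none for the cycles of `x` and `y`. This starts the induction, when no transposition is
left. -/
theorem markedWeight_eq_zero_of_card_lt (hw : IsDiscWeight r w)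
    (hxy : ¬ σ.SameCycle x y) (h : cycleCount σ * r = Fintype.card α + 2 * r) :
    markedWeight w u σ x y = 0 := by
  rw [markedWeight]
  refine mul_eq_zero_of_right _ ?_
  by_contra hne
  have h1 : (cyclesAvoiding σ {x, y}).card * (r : ℚ) ≤
      ∑ E ∈ cyclesAvoiding σ {x, y}, (E.card : ℚ) := by
    rw [← nsmul_eq_mul]
    exact Finset.card_nsmul_le_sum _ _ _ fun E hE => by
      exact_mod_cast (hw.dvd_of_cycleWeight_ne_zero hne hE).2
  have hc : (cycleCount σ : ℚ) = (cyclesAvoiding σ {x, y}).card + 2 := by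
    exact_mod_cast cycleCount_eq_of_not_sameCycle hxy
  have h' : (cycleCount σ : ℚ) * r = Fintype.card α + 2 * r := by exact_mod_cast h
  have hx : (0 : ℚ) < minimalPeriod σ x := by exact_mod_cast minimalPeriod_perm_pos σ x
  have hy : (0 : ℚ) < minimalPeriod σ y := by exact_mod_cast minimalPeriod_perm_pos σ y
  rw [sum_card_cyclesAvoiding_pair hxy] at h1
  rw [hc] at h'
  linarith

/-- Consider the last transposition. A cut preserves `S` and leaves a problem of the same kind; a
join preserving `S` leaves too few cycles. A crossing join makes the rest an unconstrained minimal
factorization, counted by disc weights, and these terms cancel the deficit in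
`sum_markedWeight_cut`. -/
theorem IsAnnulusWeight.crossingCount_eq (hr : 1 ≤ r) (hw : IsDiscWeight r w)
    (hu : IsAnnulusWeight r w u) {S : Finset α} {s : ℕ} {σ : Perm α}
    (hS : ∀ x, σ x ∈ S ↔ x ∈ S) (h : (s + cycleCount σ) * r = Fintype.card α + 2 * r) :
    (crossingCount r S s σ : ℚ) =
      s.factorial * ∑ x ∈ S, ∑ y ∈ Sᶜ, markedWeight w u σ x y := by
  have hsc : ∀ {x y}, x ∈ S → y ∈ Sᶜ → ¬ σ.SameCycle x y := fun hx hy hxy =>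
    (Finset.mem_compl.1 hy) ((mem_iff_of_sameCycle hS hxy).1 hx)
  induction s generalizing σ with
  | zero =>
    rw [crossingCount, Finset.sum_eq_zero fun x hx => Finset.sum_eq_zero fun y hy =>
      markedWeight_eq_zero_of_card_lt hw (hsc hx hy) (by simpa using h)]
    simp
  | succ s ih =>
    have hS' : ∀ {a b}, (a ∈ S ↔ b ∈ S) → ∀ x, (σ * swap a b) x ∈ S ↔ x ∈ S := fun hab x => by
      rw [Perm.mul_apply, hS, swap_preserves_iff.2 hab]
    have hterm : ∀ a b : α, a ≠ b → (((if ∀ x, swap a b x ∈ S ↔ x ∈ S then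
        crossingCount r S s (σ * swap a b) else factorizationCount r s (σ * swap a b) : ℕ)) : ℚ) =
        (if b ∈ cycleSet σ a then s.factorial * ∑ x ∈ S, ∑ y ∈ Sᶜ,
          markedWeight w u (σ * swap a b) x y else 0) +
        (if a ∈ S ↔ b ∈ S then 0 else s.factorial *
          (w (minimalPeriod σ a + minimalPeriod σ b) * cycleWeight w σ {a, b})) := by
      intro a b hab
      rw [if_congr swap_preserves_iff rfl rfl]
      by_cases hc : σ.SameCycle a b
      · have hp := mem_iff_of_sameCycle hS hc
        rw [if_pos hp, if_pos (mem_cycleSet.2 hc), if_pos hp, add_zero]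
        refine ih (hS' hp) ?_ fun hx hy hxy =>
          (Finset.mem_compl.1 hy) ((mem_iff_of_sameCycle (hS' hp) hxy).1 hx)
        rw [cycleCount_cut hc hab, ← h]; ring
      · have hj := cycleCount_join hc
        rw [if_neg (mt mem_cycleSet.1 hc), zero_add]
        split_ifs with hp
        · rw [crossingCount_eq_zero (hS' hp), Nat.cast_zero]
          rw [← h, ← hj]
          exact Nat.mul_lt_mul_of_pos_right (by omega) hr
        · rw [hw.factorizationCount_eq hr, cycleWeight_join hc]
          rw [← hj] at h
          nlinarith
    have h3 : ∀ a : α, ∑ b ∈ Finset.univ.filter (fun b => a ≠ b),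
        (((if ∀ x, swap a b x ∈ S ↔ x ∈ S then
        crossingCount r S s (σ * swap a b) else factorizationCount r s (σ * swap a b) : ℕ)) : ℚ) =
        s.factorial * ((∑ x ∈ S, ∑ y ∈ Sᶜ, ∑ b ∈ (cycleSet σ a).filter (fun b => a ≠ b),
          markedWeight w u (σ * swap a b) x y) + ∑ b, if a ∈ S ↔ b ∈ S then 0 else
          (w (minimalPeriod σ a + minimalPeriod σ b) * cycleWeight w σ {a, b})) := by
      intro a
      rw [Finset.sum_congr rfl fun b hb => hterm a b (by simpa using hb), Finset.sum_add_distrib,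
        mul_add]
      congr 1
      · have hfil : Finset.univ.filter (fun b => a ≠ b ∧ b ∈ cycleSet σ a) =
            (cycleSet σ a).filter (fun b => a ≠ b) := by
          ext b; simp [and_comm]
        rw [← Finset.sum_filter, Finset.filter_filter, ← Finset.mul_sum, hfil, Finset.sum_comm]
        congr 1
        refine Finset.sum_congr rfl fun x _ => ?_
        rw [Finset.sum_comm]
      · rw [Finset.sum_filter, Finset.mul_sum]
        refine Finset.sum_congr rfl fun b _ => ?_
        by_cases hab : a = b
        · subst hab; simp
        · rw [if_pos hab]; split_ifs <;> simp
    have hcross : ∑ a, ∑ b, (if a ∈ S ↔ b ∈ S then 0 else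
        (w (minimalPeriod σ a + minimalPeriod σ b) * cycleWeight w σ {a, b})) =
        2 * ∑ x ∈ S, ∑ y ∈ Sᶜ,
          w (minimalPeriod σ x + minimalPeriod σ y) * cycleWeight w σ {x, y} := by
      set g : α → α → ℚ := fun a b =>
        w (minimalPeriod σ a + minimalPeriod σ b) * cycleWeight w σ {a, b} with hg
      have hgs : ∀ a b, g a b = g b a := fun a b => by
        simp only [hg, add_comm, Finset.pair_comm]
      have hin : ∀ a ∈ S, ∑ b, (if a ∈ S ↔ b ∈ S then 0 else g a b) = ∑ b ∈ Sᶜ, g a b := by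
        intro a ha
        rw [← Finset.sum_add_sum_compl S, Finset.sum_eq_zero, zero_add]
        · refine Finset.sum_congr rfl fun b hb => ?_
          rw [Finset.mem_compl] at hb
          simp [ha, hb]
        · intro b hb; simp [ha, hb]
      have hout : ∀ a ∈ Sᶜ, ∑ b, (if a ∈ S ↔ b ∈ S then 0 else g a b) = ∑ b ∈ S, g b a := by
        intro a ha
        rw [Finset.mem_compl] at ha
        rw [← Finset.sum_add_sum_compl S, add_comm, Finset.sum_eq_zero, zero_add]
        · refine Finset.sum_congr rfl fun b hb => ?_
          simp [ha, hb, hgs a b]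
        · intro b hb
          rw [Finset.mem_compl] at hb
          simp [ha, hb]
      rw [← Finset.sum_add_sum_compl S, Finset.sum_congr rfl hin, Finset.sum_congr rfl hout,
        Finset.sum_comm (s := Sᶜ)]
      ring
    have hcut : ∑ a, ∑ x ∈ S, ∑ y ∈ Sᶜ, ∑ b ∈ (cycleSet σ a).filter (fun b => a ≠ b),
          markedWeight w u (σ * swap a b) x y = ∑ x ∈ S, ∑ y ∈ Sᶜ,
          (2 * ((Fintype.card α : ℚ) / r - cycleCount σ + 2) * markedWeight w u σ x y -
        2 * (w (minimalPeriod σ x + minimalPeriod σ y) * cycleWeight w σ {x, y})) := by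
      rw [Finset.sum_comm]
      refine Finset.sum_congr rfl fun x hx => ?_
      rw [Finset.sum_comm]
      refine Finset.sum_congr rfl fun y hy => ?_
      rw [sum_markedWeight_cut hw hu (hsc hx hy)]
      ring
    -- The coefficient produced by the cuts is the number of transpositions, which turns `s!` into
    -- `(s + 1)!`.
    have hs : (Fintype.card α : ℚ) / r - cycleCount σ + 2 = s + 1 := by
      have hr' : (r : ℚ) ≠ 0 := by positivity
      have h' : ((s + 1 : ℕ) + cycleCount σ : ℚ) * r = Fintype.card α + 2 * r := by exact_mod_cast h
      push_cast at h'
      field_simp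
      linear_combination -h'
    have h2 : 2 * (crossingCount r S (s + 1) σ : ℚ) =
        2 * ((s + 1).factorial * ∑ x ∈ S, ∑ y ∈ Sᶜ, markedWeight w u σ x y) := by
      rw [crossingCount, Nat.cast_sum, two_mul_sum_swapFinset (fun τ =>
        (((if ∀ x, τ x ∈ S ↔ x ∈ S then crossingCount r S s (σ * τ)
          else factorizationCount r s (σ * τ) : ℕ)) : ℚ)),
        Finset.sum_congr rfl fun a _ => h3 a, ← Finset.mul_sum, Finset.sum_add_distrib, hcross,
        hcut, hs, Nat.factorial_succ]
      simp only [Finset.sum_sub_distrib, ← Finset.mul_sum]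
      push_cast
      ring
    linarith

end CrossingCount

/-! ### Tuples of transpositions; arrowings and labellings of the cycles. -/

section Tuples

open Function Equiv Equiv.Perm

set_option linter.unusedSectionVars false

variable {α : Type*} [Fintype α] [DecidableEq α]

/-- `σ = φ τ₁ ⋯ τ_s` with all cycles of `φ` of length `r` and `τ₁, …, τ_s` transpositions. -/
def IsFactorization (r : ℕ) {s : ℕ} (σ : Perm α) (τ : Fin s → Perm α) : Prop :=
  (∀ i, (τ i).IsSwap) ∧ ∀ k, minimalPeriod (σ * (List.ofFn τ).prod⁻¹) k = r

/-- A transposition is its own inverse, so moving the last factor to the other side replaces `σ` by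
`σ * ρ`, as in the recursion for `factorizationCount`. -/
theorem isFactorization_snoc {r s : ℕ} {σ : Perm α} {τ : Fin s → Perm α} {ρ : Perm α} :
    IsFactorization r σ (Fin.snoc τ ρ : Fin (s + 1) → Perm α) ↔
      ρ.IsSwap ∧ IsFactorization r (σ * ρ) τ := by
  have h1 : (∀ i, ((Fin.snoc τ ρ : Fin (s + 1) → Perm α) i).IsSwap) ↔
      (∀ i, (τ i).IsSwap) ∧ ρ.IsSwap := by
    simp [Fin.forall_fin_succ']
  have h2 : (List.ofFn (Fin.snoc τ ρ : Fin (s + 1) → Perm α)).prod = (List.ofFn τ).prod * ρ := by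
    rw [List.ofFn_succ', List.concat_eq_append]
    simp
  rw [IsFactorization, IsFactorization, h1, h2, mul_inv_rev, ← mul_assoc]
  constructor
  · rintro ⟨⟨h, a, b, hab, rfl⟩, h'⟩
    rw [swap_inv] at h'
    exact ⟨⟨a, b, hab, rfl⟩, h, h'⟩
  · rintro ⟨⟨a, b, hab, rfl⟩, h, h'⟩
    rw [swap_inv]
    exact ⟨⟨h, a, b, hab, rfl⟩, h'⟩

open Classical in
theorem card_factorizations (r s : ℕ) (σ : Perm α) :
    Nat.card {τ : Fin s → Perm α // IsFactorization r σ τ} = factorizationCount r s σ := by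
  rw [Nat.card_eq_fintype_card, Fintype.card_subtype, Finset.card_filter]
  induction s generalizing σ with
  | zero =>
    rw [Fintype.sum_unique, factorizationCount]
    simp [IsFactorization]
  | succ s ih =>
    rw [← (Fin.snocEquiv (fun _ : Fin (s + 1) => Perm α)).sum_comp, Fintype.sum_prod_type,
      factorizationCount, swapFinset, Finset.sum_filter]
    refine Finset.sum_congr rfl fun ρ _ => ?_
    rw [← ih (σ * ρ)]
    split_ifs with hρ
    · refine Finset.sum_congr rfl fun τ _ => if_congr ?_ rfl rfl
      exact isFactorization_snoc.trans (by simp [hρ])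
    · refine Finset.sum_eq_zero fun τ _ => if_neg ?_
      exact fun h => hρ (isFactorization_snoc.1 h).1

-- If the last transposition crosses, nothing is required of the earlier ones; otherwise one of
-- those must cross.
open Classical in
theorem card_crossing_factorizations (r s : ℕ) (S : Finset α) (σ : Perm α) :
    Nat.card {τ : Fin s → Perm α // IsFactorization r σ τ ∧ ∃ i, ¬ ∀ x, τ i x ∈ S ↔ x ∈ S} =
      crossingCount r S s σ := by
  rw [Nat.card_eq_fintype_card, Fintype.card_subtype, Finset.card_filter]
  induction s generalizing σ with
  | zero => simp [crossingCount]
  | succ s ih =>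
    rw [← (Fin.snocEquiv (fun _ : Fin (s + 1) => Perm α)).sum_comp, Fintype.sum_prod_type,
      crossingCount, swapFinset, Finset.sum_filter]
    refine Finset.sum_congr rfl fun ρ _ => ?_
    have hex : ∀ τ : Fin s → Perm α, (∃ i, ¬ ∀ x,
        (Fin.snoc τ ρ : Fin (s + 1) → Perm α) i x ∈ S ↔ x ∈ S) ↔
        (∃ i, ¬ ∀ x, τ i x ∈ S ↔ x ∈ S) ∨ ¬ ∀ x, ρ x ∈ S ↔ x ∈ S := by
      intro τ
      rw [Fin.exists_fin_succ']
      simp only [Fin.snoc_castSucc, Fin.snoc_last]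
    split_ifs with hρ hp
    · rw [← ih (σ * ρ)]
      refine Finset.sum_congr rfl fun τ _ => if_congr ?_ rfl rfl
      refine (and_congr isFactorization_snoc (hex τ)).trans ?_
      simp only [hρ, true_and]
      tauto
    · rw [← card_factorizations, Nat.card_eq_fintype_card, Fintype.card_subtype,
        Finset.card_filter]
      refine Finset.sum_congr rfl fun τ _ => if_congr ?_ rfl rfl
      refine (and_congr isFactorization_snoc (hex τ)).trans ?_
      simp only [hρ, true_and]
      tauto
    · refine Finset.sum_eq_zero fun τ _ => if_neg ?_
      exact fun h => hρ (isFactorization_snoc.1 h.1).1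

/-- `a i` is a dot on the `i`-th of the `n` cycles of `σ`, which has length `μ i`. -/
def IsArrowing {n : ℕ} (μ : Fin n → ℕ) (σ : Perm α) (a : Fin n → α) : Prop :=
  (∀ i, minimalPeriod σ (a i) = μ i) ∧ ∀ k, ∃! i, σ.SameCycle (a i) k

/-- `l` labels the `n` cycles of `σ`, the `i`-th one having length `μ i`. -/
def IsLabelling {n : ℕ} (μ : Fin n → ℕ) (σ : Perm α) (l : α → Fin n) : Prop :=
  (∀ j k, l j = l k ↔ σ.SameCycle j k) ∧ ∀ i, Nat.card {k // l k = i} = μ i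

theorem IsLabelling.isArrowing {n : ℕ} {μ : Fin n → ℕ} {σ : Perm α} {l : α → Fin n}
    (hl : IsLabelling μ σ l) {a : Fin n → α} (ha : ∀ i, l (a i) = i) : IsArrowing μ σ a := by
  classical
  have key : ∀ i k, σ.SameCycle (a i) k ↔ l k = i := fun i k => by
    rw [← hl.1, ha]; exact eq_comm
  constructor
  · intro i
    rw [← card_cycleSet, ← hl.2 i, Nat.card_eq_fintype_card, Fintype.card_subtype]
    congr 1
    ext k
    rw [mem_cycleSet, key]
    simp
  · intro k
    refine ⟨l k, (key _ _).2 rfl, fun i hi => ((key i k).1 hi).symm⟩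

theorem IsArrowing.exists_labelling {n : ℕ} {μ : Fin n → ℕ} {σ : Perm α} {a : Fin n → α}
    (ha : IsArrowing μ σ a) : ∃ l, IsLabelling μ σ l ∧ ∀ i, l (a i) = i := by
  classical
  choose l hl hl' using ha.2
  have key : ∀ k i, l k = i ↔ σ.SameCycle (a i) k := fun k i =>
    ⟨fun h => h ▸ hl k, fun h => (hl' k i h).symm⟩
  refine ⟨l, ⟨fun j k => ?_, fun i => ?_⟩, fun i => (key _ _).2 (SameCycle.refl _ _)⟩
  · rw [key]
    exact ⟨fun h => h.symm.trans (hl k), fun h => (hl k).trans h.symm⟩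
  · rw [← ha.1 i, ← card_cycleSet, Nat.card_eq_fintype_card, Fintype.card_subtype]
    congr 1
    ext k
    rw [mem_cycleSet, ← key]
    simp

/-- An arrowing is a labelling together with a dot on each cycle. -/
noncomputable def labellingSigmaEquiv {n : ℕ} (μ : Fin n → ℕ) (σ : Perm α) :
    (Σ l : {l : α → Fin n // IsLabelling μ σ l}, ∀ i, {k // l.1 k = i}) ≃
      {a : Fin n → α // IsArrowing μ σ a} :=
  Equiv.ofBijective (fun p => ⟨fun i => p.2 i, p.1.2.isArrowing fun i => (p.2 i).2⟩) <| by
    constructor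
    · rintro ⟨⟨l, hl⟩, a⟩ ⟨⟨l', hl'⟩, a'⟩ h
      have haa : ∀ i, (a i : α) = a' i := fun i => congrFun (congrArg Subtype.val h) i
      obtain rfl : l = l' := by
        ext k
        have h1 : σ.SameCycle (a (l k)) k := (hl.1 _ _).1 (a (l k)).2
        rw [haa, ← hl'.1] at h1
        have h2 : l' (a' (l k)) = l k := (a' (l k)).2
        exact congrArg _ (h2.symm.trans h1)
      obtain rfl : a = a' := funext fun i => Subtype.ext (haa i)
      rfl
    · rintro ⟨a, ha⟩
      obtain ⟨l, hl, hla⟩ := ha.exists_labelling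
      exact ⟨⟨⟨l, hl⟩, fun i => ⟨a i, hla i⟩⟩, rfl⟩

theorem card_arrowings {n : ℕ} (μ : Fin n → ℕ) (σ : Perm α) :
    Nat.card {a : Fin n → α // IsArrowing μ σ a} =
      (∏ i, μ i) * Nat.card {l : α → Fin n // IsLabelling μ σ l} := by
  classical
  rw [← Nat.card_congr (labellingSigmaEquiv μ σ), Nat.card_sigma,
    Finset.sum_congr rfl (g := fun _ => ∏ i, μ i), Finset.sum_const, smul_eq_mul, mul_comm,
    Nat.card_eq_fintype_card, Finset.card_univ]
  intro l _
  rw [Nat.card_pi]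
  exact Finset.prod_congr rfl fun i _ => l.2.2 i

/-! ### The number of arrowed permutations of a given cycle type. -/

section CountArrowings

variable {n : ℕ} {μ : Fin n → ℕ} [∀ i, NeZero (μ i)]

/-- The permutation with marked cycles given by a numbering of the dots along the cycles. -/
def rotationAlong (e : (Σ i, ZMod (μ i)) ≃ α) : Perm α :=
  (e.symm.trans (Equiv.sigmaCongrRight fun i => Equiv.addRight (1 : ZMod (μ i)))).trans e

theorem rotationAlong_pow (e : (Σ i, ZMod (μ i)) ≃ α) (i : Fin n) (z : ZMod (μ i)) (j : ℕ) :
    (rotationAlong e ^ j) (e ⟨i, z⟩) = e ⟨i, z + j⟩ := by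
  induction j with
  | zero => simp
  | succ j ih =>
    rw [pow_succ', Perm.mul_apply, ih]
    simp [rotationAlong, add_assoc]

theorem isArrowing_rotationAlong (e : (Σ i, ZMod (μ i)) ≃ α) :
    IsArrowing μ (rotationAlong e) (fun i => e ⟨i, 0⟩) := by
  constructor
  · intro i
    have h : ∀ j, minimalPeriod (rotationAlong e) (e ⟨i, 0⟩) ∣ j ↔ μ i ∣ j := fun j => by
      rw [← isPeriodicPt_iff_minimalPeriod_dvd, IsPeriodicPt, IsFixedPt, ← Equiv.Perm.coe_pow,
        rotationAlong_pow, e.injective.eq_iff]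
      simp [ZMod.natCast_eq_zero_iff]
    exact Nat.dvd_antisymm ((h _).2 dvd_rfl) ((h _).1 dvd_rfl)
  · intro k
    obtain ⟨⟨i, z⟩, rfl⟩ := e.surjective k
    refine ⟨i, ⟨z.val, ?_⟩, ?_⟩
    · rw [zpow_natCast, rotationAlong_pow]; simp
    · intro i' h
      obtain ⟨m, hm⟩ := h.exists_nat_pow_eq
      rw [rotationAlong_pow, e.injective.eq_iff] at hm
      exact congrArg Sigma.fst hm

theorem exists_rotationAlong {σ : Perm α} {a : Fin n → α} (h : IsArrowing μ σ a)
    (hcard : ∑ i, μ i = Fintype.card α) :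
    ∃ e : (Σ i, ZMod (μ i)) ≃ α, rotationAlong e = σ ∧ ∀ i, e ⟨i, 0⟩ = a i := by
  set f : (Σ i, ZMod (μ i)) → α := fun p => (σ ^ p.2.val) (a p.1) with hf
  have hsc : ∀ p, σ.SameCycle (a p.1) (f p) := fun p => ⟨p.2.val, by rw [zpow_natCast]⟩
  have hinj : Injective f := by
    rintro ⟨i, z⟩ ⟨i', z'⟩ hp
    obtain rfl : i = i' := (h.2 (f ⟨i, z⟩)).unique (hsc ⟨i, z⟩) (hp ▸ hsc ⟨i', z'⟩)
    have := perm_pow_injOn σ (a i) (by rw [h.1]; exact ZMod.val_lt z)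
      (by rw [h.1]; exact ZMod.val_lt z') hp
    obtain rfl : z = z' := ZMod.val_injective _ this
    rfl
  have hbij : Bijective f := by
    rw [Fintype.bijective_iff_injective_and_card]
    exact ⟨hinj, by simp [Fintype.card_sigma, ZMod.card, hcard]⟩
  have hcast : ∀ i (m : ℕ), f ⟨i, (m : ZMod (μ i))⟩ = (σ ^ m) (a i) := fun i m => by
    simp only [hf]
    rw [ZMod.val_natCast, ← h.1 i, perm_pow_mod_minimalPeriod]
  refine ⟨Equiv.ofBijective f hbij, ?_, fun i => by simpa using hcast i 0⟩
  ext x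
  obtain ⟨⟨i, z⟩, rfl⟩ := hbij.surjective x
  have h1 := rotationAlong_pow (Equiv.ofBijective f hbij) i z 1
  rw [pow_one, Equiv.ofBijective_apply, Equiv.ofBijective_apply] at h1
  rw [h1, ← ZMod.natCast_zmod_val z, ← Nat.cast_add, hcast, hcast, add_comm, pow_add,
    Perm.mul_apply, pow_one]

/-- Counting along each cycle from its arrow numbers the dots by `Σ i, ZMod (μ i)`, and every
numbering arises exactly once. The resulting factorial cancels the `d!` in the Hurwitz numbers. -/
theorem card_isArrowing (hcard : ∑ i, μ i = Fintype.card α) :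
    Nat.card {p : Perm α × (Fin n → α) // IsArrowing μ p.1 p.2} = (Fintype.card α).factorial := by
  have hc : Fintype.card (Σ i, ZMod (μ i)) = Fintype.card α := by
    simp [Fintype.card_sigma, ZMod.card, hcard]
  classical
  rw [← hc, ← Fintype.card_equiv (Fintype.equivOfCardEq hc), ← Nat.card_eq_fintype_card]
  refine (Nat.card_congr (Equiv.ofBijective
    (fun e : (Σ i, ZMod (μ i)) ≃ α => (⟨(rotationAlong e, fun i => e ⟨i, 0⟩),
      isArrowing_rotationAlong e⟩ : {p : Perm α × (Fin n → α) // IsArrowing μ p.1 p.2}))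
    ⟨fun e e' h => ?_, fun p => ?_⟩)).symm
  · simp only [Subtype.mk.injEq, Prod.mk.injEq] at h
    ext ⟨i, z⟩
    have h1 := rotationAlong_pow e i 0 z.val
    have h2 := rotationAlong_pow e' i 0 z.val
    rw [← h.1, ← congrFun h.2 i] at h2
    simpa using h1.symm.trans h2
  · obtain ⟨e, he, ha⟩ := exists_rotationAlong p.2 hcard
    refine ⟨e, Subtype.ext (Prod.ext he (funext ha))⟩

end CountArrowings

end Tuples

/-! ### From factorizations to Hurwitz numbers. -/

section HurwitzNumbers

open Function Equiv Equiv.Perm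

set_option linter.unusedSectionVars false

section Arrowing

variable {α : Type*} [Fintype α] [DecidableEq α] {n : ℕ} {μ : Fin n → ℕ} {σ : Perm α}
  {a : Fin n → α}

theorem IsArrowing.cycleCount_eq (h : IsArrowing μ σ a) : cycleCount σ = n := by
  have h1 : cyclesAvoiding σ ∅ = Finset.univ.image (fun i => cycleSet σ (a i)) := by
    ext E
    simp only [mem_cyclesAvoiding, Finset.notMem_empty, false_imp_iff, implies_true, true_and,
      Finset.mem_image, Finset.mem_univ]
    constructor
    · rintro ⟨z, rfl⟩
      obtain ⟨i, hi, -⟩ := h.2 z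
      exact ⟨i, cycleSet_eq_iff.2 hi⟩
    · rintro ⟨i, rfl⟩
      exact ⟨_, rfl⟩
  rw [cycleCount, h1, Finset.card_image_of_injective, Finset.card_univ, Fintype.card_fin]
  intro i j hij
  exact (h.2 (a j)).unique (cycleSet_eq_iff.1 hij) (SameCycle.refl _ _)

theorem cycleWeight_eq_one (w : ℕ → ℚ) {M : Finset α} (h : ∀ z, ∃ m ∈ M, σ.SameCycle m z) :
    cycleWeight w σ M = 1 := by
  rw [cycleWeight, Finset.prod_eq_one]
  intro E hE
  obtain ⟨z, hz, -⟩ := mem_cyclesAvoiding.1 hE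
  obtain ⟨m, hm, hmz⟩ := h z
  exact absurd hmz (hz m hm)

end Arrowing

/-! ### Connectedness of graphs with one or two vertices. -/

section Transitivity

variable {α : Type*} [Fintype α] [DecidableEq α] {r s : ℕ} {σ : Perm α} {τ : Fin s → Perm α}

theorem prod_ofFn_mem_closure (φ : Perm α) (τ : Fin s → Perm α) :
    (List.ofFn τ).prod ∈ Subgroup.closure ({φ} ∪ Set.range τ) := by
  refine Subgroup.list_prod_mem _ fun x hx => ?_
  rw [List.mem_ofFn] at hx
  exact Subgroup.subset_closure (Or.inr hx)

theorem mem_closure_mul_prod_inv (σ : Perm α) (τ : Fin s → Perm α) :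
    σ ∈ Subgroup.closure ({σ * (List.ofFn τ).prod⁻¹} ∪ Set.range τ) := by
  have h1 : σ * (List.ofFn τ).prod⁻¹ ∈
      Subgroup.closure ({σ * (List.ofFn τ).prod⁻¹} ∪ Set.range τ) :=
    Subgroup.subset_closure (Or.inl rfl)
  have h2 := Subgroup.mul_mem _ h1 (prod_ofFn_mem_closure (σ * (List.ofFn τ).prod⁻¹) τ)
  rwa [inv_mul_cancel_right] at h2

theorem exists_mem_of_sameCycle {H : Subgroup (Perm α)} (hσ : σ ∈ H) {x y : α}
    (h : σ.SameCycle x y) : ∃ g ∈ H, g x = y := by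
  obtain ⟨i, hi⟩ := h
  exact ⟨σ ^ i, H.zpow_mem hσ i, hi⟩

theorem isPretransitive_of_forall {H : Subgroup (Perm α)} (x : α)
    (h : ∀ y, ∃ g ∈ H, g x = y) : MulAction.IsPretransitive H α := by
  refine ⟨fun y z => ?_⟩
  obtain ⟨g, hg, rfl⟩ := h y
  obtain ⟨g', hg', rfl⟩ := h z
  refine ⟨⟨g' * g⁻¹, H.mul_mem hg' (H.inv_mem hg)⟩, ?_⟩
  simp [Subgroup.smul_def]

/-- The group contains `σ`, so its orbits are unions of the two cycles of `σ`: it is transitive as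
soon as one edge links them. -/
theorem isPretransitive_iff_exists_crossing {a b : α}
    (hτ : ∀ i, (τ i).IsSwap) (hab : ¬ σ.SameCycle a b)
    (hall : ∀ z, σ.SameCycle a z ∨ σ.SameCycle b z) :
    MulAction.IsPretransitive
      (Subgroup.closure ({σ * (List.ofFn τ).prod⁻¹} ∪ Set.range τ)) α ↔
      ∃ i, ¬ ∀ x, τ i x ∈ cycleSet σ a ↔ x ∈ cycleSet σ a := by
  set S := cycleSet σ a with hS
  have hσS : ∀ x, σ x ∈ S ↔ x ∈ S := fun x => by
    rw [hS, mem_cycleSet, mem_cycleSet, sameCycle_apply_right]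
  constructor
  · intro h
    by_contra! hno
    -- The set stabilizer of `S` contains `σ` and, if no edge crosses, all edges, hence also the
    -- face permutation.
    let K : Subgroup (Perm α) :=
      { carrier := {g | ∀ x, g x ∈ S ↔ x ∈ S}
        mul_mem' := fun {g g'} hg hg' x => by rw [Perm.mul_apply, hg, hg']
        one_mem' := fun x => Iff.rfl
        inv_mem' := fun {g} hg x => by
          have := hg (g⁻¹ x)
          rw [← Perm.mul_apply, mul_inv_cancel, Perm.one_apply] at this
          exact this.symm }
    have hK : Subgroup.closure ({σ * (List.ofFn τ).prod⁻¹} ∪ Set.range τ) ≤ K := by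
      rw [Subgroup.closure_le]
      rintro g (rfl | ⟨i, rfl⟩)
      · refine K.mul_mem hσS (K.inv_mem (Subgroup.list_prod_mem _ fun x hx => ?_))
        rw [List.mem_ofFn] at hx
        obtain ⟨i, rfl⟩ := hx
        exact hno i
      · exact hno i
    obtain ⟨g, hg⟩ := h.exists_smul_eq a b
    have h1 := (hK g.2 a).2 (by simp [hS, SameCycle.refl])
    have h2 : g.1 a = b := hg
    rw [h2, hS, mem_cycleSet] at h1
    exact hab h1
  · rintro ⟨i, hi⟩
    set H := Subgroup.closure ({σ * (List.ofFn τ).prod⁻¹} ∪ Set.range τ) with hH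
    have hσ : σ ∈ H := mem_closure_mul_prod_inv σ τ
    obtain ⟨p, q, hpq, hτi⟩ := hτ i
    have hτH : τ i ∈ H := Subgroup.subset_closure (Or.inr ⟨i, rfl⟩)
    have hcross : ∃ p' ∈ S, τ i p' ∉ S := by
      rw [hτi, swap_preserves_iff] at hi
      by_cases hp : p ∈ S
      · exact ⟨p, hp, by rw [hτi, swap_apply_left]; tauto⟩
      · exact ⟨q, by tauto, by rwa [hτi, swap_apply_right]⟩
    obtain ⟨p', hp', hq'⟩ := hcross
    rw [hS, mem_cycleSet] at hp' hq'
    refine isPretransitive_of_forall a fun z => ?_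
    rcases hall z with hz | hz
    · exact exists_mem_of_sameCycle hσ hz
    · obtain ⟨g, hg, hga⟩ := exists_mem_of_sameCycle hσ hp'
      obtain ⟨g', hg', hgz⟩ := exists_mem_of_sameCycle hσ (((hall _).resolve_left hq').symm.trans hz)
      exact ⟨g' * (τ i * g), H.mul_mem hg' (H.mul_mem hτH hg), by
        rw [Perm.mul_apply, Perm.mul_apply, hga, hgz]⟩

end Transitivity

/-! ### Hurwitz numbers in terms of the weights. -/

section Counting

variable {N s n r : ℕ} {μ : Fin n → ℕ}

/-- Recording a graph by its vertices instead of its faces. -/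
def vertexPermEquiv (N s : ℕ) (X : Type*) :
    Perm (Fin N) × (Fin s → Perm (Fin N)) × X ≃ (Perm (Fin N) × X) × (Fin s → Perm (Fin N)) where
  toFun G := ((vertexPerm G.1 G.2.1, G.2.2), G.2.1)
  invFun q := (q.1.1 * (List.ofFn q.2).prod⁻¹, q.2, q.1.2)
  left_inv G := by simp [vertexPerm]
  right_inv q := by simp [vertexPerm]

/-- Pairs subject to a condition on the first component and a joint condition. -/
def subtypeProdAndEquivSigma {A B : Type*} (P : A → Prop) (R : A → B → Prop) :
    {q : A × B // P q.1 ∧ R q.1 q.2} ≃ Σ p : {a // P a}, {b // R p.1 b} where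
  toFun q := ⟨⟨q.1.1, q.2.1⟩, ⟨q.1.2, q.2.2⟩⟩
  invFun p := ⟨(p.1.1, p.2.1), p.1.2, p.2.2⟩
  left_inv _ := rfl
  right_inv _ := rfl

/-- The edges of a connected graph with given vertices. -/
def IsConnectedFactorization (r : ℕ) (σ : Perm (Fin N)) (τ : Fin s → Perm (Fin N)) : Prop :=
  IsHurwitzGraph r (σ * (List.ofFn τ).prod⁻¹) τ

theorem isConnectedFactorization_iff {σ : Perm (Fin N)} {τ : Fin s → Perm (Fin N)} :
    IsConnectedFactorization r σ τ ↔ IsFactorization r σ τ ∧ MulAction.IsPretransitive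
      (Subgroup.closure ({σ * (List.ofFn τ).prod⁻¹} ∪ Set.range τ)) (Fin N) :=
  and_left_comm.trans and_assoc.symm

/-- The faces are determined by the vertices and the edges. So one sums the number of edge tuples
over the arrowed permutations, of which there are `N!`. -/
theorem card_arrowed_graphs [∀ i, NeZero (μ i)] (hN : ∑ i, μ i = N) (C : ℚ)
    (hC : ∀ (σ : Perm (Fin N)) (a : Fin n → Fin N), IsArrowing μ σ a →
      (Nat.card {τ : Fin s → Perm (Fin N) // IsConnectedFactorization r σ τ} : ℚ) = C) :
    (Nat.card {G : Perm (Fin N) × (Fin s → Perm (Fin N)) × (Fin n → Fin N) //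
      IsHurwitzGraph r G.1 G.2.1 ∧ IsArrowing μ (vertexPerm G.1 G.2.1) G.2.2} : ℚ) =
      N.factorial * C := by
  classical
  have e1 : {G : Perm (Fin N) × (Fin s → Perm (Fin N)) × (Fin n → Fin N) //
      IsHurwitzGraph r G.1 G.2.1 ∧ IsArrowing μ (vertexPerm G.1 G.2.1) G.2.2} ≃
      {q : (Perm (Fin N) × (Fin n → Fin N)) × (Fin s → Perm (Fin N)) //
        IsArrowing μ q.1.1 q.1.2 ∧ IsConnectedFactorization r q.1.1 q.2} := by
    refine (vertexPermEquiv N s (Fin n → Fin N)).subtypeEquiv fun G => ?_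
    simp only [vertexPermEquiv, Equiv.coe_fn_mk, IsConnectedFactorization]
    rw [show vertexPerm G.1 G.2.1 * (List.ofFn G.2.1).prod⁻¹ = G.1 by simp [vertexPerm]]
    exact and_comm
  rw [Nat.card_congr e1, Nat.card_congr (subtypeProdAndEquivSigma
    (fun p : Perm (Fin N) × (Fin n → Fin N) => IsArrowing μ p.1 p.2)
    (fun p τ => IsConnectedFactorization r p.1 τ)), Nat.card_sigma, Nat.cast_sum,
    Finset.sum_congr rfl fun p _ => hC p.1.1 p.1.2 p.2, Finset.sum_const, nsmul_eq_mul,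
    Finset.card_univ, ← Nat.card_eq_fintype_card, card_isArrowing (by simpa using hN),
    Fintype.card_fin]

/-- Over each fixed graph, a labelling of the vertices extends to an arrowing in `∏ i, μ i` ways. -/
theorem arrowedHurwitzNumber_eq_prod_mul (r g : ℕ) (μ : Fin n → ℕ) :
    arrowedHurwitzNumber r g μ = (∏ i, (μ i : ℚ)) * orbifoldHurwitzNumber r g μ := by
  classical
  rw [arrowedHurwitzNumber, orbifoldHurwitzNumber, ← mul_div_assoc]
  congr 1
  rw [← Nat.cast_prod, ← Nat.cast_mul]
  congr 1
  generalize hs : edgeCount r g n (∑ i, μ i) = s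
  generalize hN : ∑ i, μ i = N
  have e : ∀ {X : Type} (Q : Perm (Fin N) → X → Prop),
      {G : Perm (Fin N) × (Fin s → Perm (Fin N)) × X //
        IsHurwitzGraph r G.1 G.2.1 ∧ Q (vertexPerm G.1 G.2.1) G.2.2} ≃
      Σ p : {p : Perm (Fin N) × (Fin s → Perm (Fin N)) // IsHurwitzGraph r p.1 p.2},
        {x // Q (vertexPerm p.1.1 p.1.2) x} := fun Q =>
    ((Equiv.prodAssoc _ _ _).symm.subtypeEquiv fun G => Iff.rfl).trans
      (subtypeProdAndEquivSigma (fun p => IsHurwitzGraph r p.1 p.2)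
        (fun p x => Q (vertexPerm p.1 p.2) x))
  have h1 := Nat.card_congr (e (IsArrowing μ))
  have h2 := Nat.card_congr (e (IsLabelling μ))
  rw [Nat.card_sigma] at h1 h2
  rw [Finset.sum_congr rfl fun p _ => card_arrowings μ (vertexPerm p.1.1 p.1.2),
    ← Finset.mul_sum, ← h2] at h1
  exact h1

theorem isEmpty_isConnectedFactorization (h : ¬ r ∣ N) (σ : Perm (Fin N)) :
    IsEmpty {τ : Fin s → Perm (Fin N) // IsConnectedFactorization r σ τ} := by
  refine ⟨fun τ => h ?_⟩
  have := cycleCount_mul_eq_card τ.2.1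
  rw [Fintype.card_fin] at this
  exact ⟨_, by rw [mul_comm]; exact this.symm⟩

variable {w : ℕ → ℚ} {u : ℕ → ℕ → ℚ}

theorem arrowedHurwitzNumber_eq_of_card [∀ i, NeZero (μ i)] (C : ℚ)
    (hC : ∀ (σ : Perm (Fin (∑ i, μ i))) (a : Fin n → Fin (∑ i, μ i)), IsArrowing μ σ a →
      (Nat.card {τ : Fin (edgeCount r 0 n (∑ i, μ i)) → Perm (Fin (∑ i, μ i)) //
        IsConnectedFactorization r σ τ} : ℚ) = (edgeCount r 0 n (∑ i, μ i)).factorial * C) :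
    arrowedHurwitzNumber r 0 μ = C := by
  have h := card_arrowed_graphs (μ := μ) rfl _ hC
  rw [arrowedHurwitzNumber]
  refine (congrArg (fun x : ℚ => x / _) h).trans ?_
  have h1 : ((∑ i, μ i).factorial : ℚ) ≠ 0 := by positivity
  have h2 : ((edgeCount r 0 n (∑ i, μ i)).factorial : ℚ) ≠ 0 := by positivity
  field_simp

/-- With a single vertex, `σ` is one cycle, so connectedness is automatic and only the weight of
that cycle remains. -/
theorem IsDiscWeight.arrowedHurwitzNumber_eq (hr : 1 ≤ r) (hw : IsDiscWeight r w) {d : ℕ}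
    (hd : 1 ≤ d) : arrowedHurwitzNumber r 0 ![d] = w d := by
  have : ∀ i, NeZero (![d] i) := fun i => ⟨by rw [Matrix.cons_val_fin_one]; omega⟩
  refine arrowedHurwitzNumber_eq_of_card (μ := ![d]) (w d) ?_
  have hN : ∑ i, ![d] i = d := by simp
  generalize ∑ i, ![d] i = N at hN
  subst hN
  intro σ a ha
  by_cases hdvd : r ∣ N
  · have hone : ∀ z, σ.SameCycle (a 0) z := fun z => by
      obtain ⟨i, hi, -⟩ := ha.2 z
      rwa [Subsingleton.elim i 0] at hi
    have hiff : ∀ τ : Fin (edgeCount r 0 1 N) → Perm (Fin N),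
        IsConnectedFactorization r σ τ ↔ IsFactorization r σ τ := fun τ =>
      isConnectedFactorization_iff.trans <| and_iff_left (isPretransitive_of_forall (a 0) fun z =>
        exists_mem_of_sameCycle (mem_closure_mul_prod_inv σ τ) (hone z))
    rw [Nat.card_congr (Equiv.subtypeEquivRight hiff), card_factorizations,
      hw.factorizationCount_eq hr, cycleWeight_eq_mul w (x := a 0) (by simp), ha.1,
      cycleWeight_eq_one w (fun z => ⟨a 0, by simp, hone z⟩)]
    · simp
    · rw [ha.cycleCount_eq, Fintype.card_fin]
      obtain ⟨m, rfl⟩ := hdvd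
      have hm : 1 ≤ m := Nat.pos_of_ne_zero (by rintro rfl; simp at hd)
      -- Since `m ≥ 1`, the truncated subtraction gives the true number `m - 1` of edges.
      rw [edgeCount, Nat.mul_div_cancel_left _ hr, show 2 * 0 + m + 1 - 2 + 1 = m by omega,
        mul_comm]
  · have := isEmpty_isConnectedFactorization (s := edgeCount r 0 1 N) hdvd σ
    rw [Nat.card_of_isEmpty, hw.eq_zero _ hdvd]
    simp

/-- The two cycles exhaust the dots, so each of the `m * n` choices of marked dots contributes the
same weight `u m n`. -/
theorem IsAnnulusWeight.arrowedHurwitzNumber_eq (hr : 1 ≤ r) (hw : IsDiscWeight r w)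
    (hu : IsAnnulusWeight r w u) (hu0 : ∀ m n, ¬ r ∣ m + n → u m n = 0) {m n : ℕ}
    (hm : 1 ≤ m) (hn : 1 ≤ n) : arrowedHurwitzNumber r 0 ![m, n] = m * n * u m n := by
  have : ∀ i, NeZero (![m, n] i) := fun i => ⟨by fin_cases i <;> simp <;> omega⟩
  refine arrowedHurwitzNumber_eq_of_card (μ := ![m, n]) (m * n * u m n) ?_
  have hN : ∑ i, ![m, n] i = m + n := by simp
  generalize ∑ i, ![m, n] i = N at hN
  intro σ a ha
  by_cases hdvd : r ∣ N
  · have hab : ¬ σ.SameCycle (a 0) (a 1) := fun h => by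
      simpa using (ha.2 (a 1)).unique h (SameCycle.refl _ _)
    have hall : ∀ z, σ.SameCycle (a 0) z ∨ σ.SameCycle (a 1) z := fun z => by
      obtain ⟨i, hi, -⟩ := ha.2 z
      fin_cases i
      · exact Or.inl hi
      · exact Or.inr hi
    have h0 : minimalPeriod σ (a 0) = m := by simpa using ha.1 0
    have h1 : minimalPeriod σ (a 1) = n := by simpa using ha.1 1
    have hcompl : (cycleSet σ (a 0))ᶜ = cycleSet σ (a 1) := by
      ext z
      rw [Finset.mem_compl, mem_cycleSet, mem_cycleSet]
      exact ⟨(hall z).resolve_left, fun h h' => hab (h'.trans h.symm)⟩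
    have hiff : ∀ τ : Fin (edgeCount r 0 2 N) → Perm (Fin N),
        IsConnectedFactorization r σ τ ↔ IsFactorization r σ τ ∧
          ∃ i, ¬ ∀ x, τ i x ∈ cycleSet σ (a 0) ↔ x ∈ cycleSet σ (a 0) := fun τ =>
      isConnectedFactorization_iff.trans <| and_congr_right fun h => isPretransitive_iff_exists_crossing h.1 hab hall
    rw [Nat.card_congr (Equiv.subtypeEquivRight hiff), card_crossing_factorizations,
      hu.crossingCount_eq hr hw, hcompl]
    · congr 1
      have hmark : ∀ x ∈ cycleSet σ (a 0), ∀ y ∈ cycleSet σ (a 1),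
          markedWeight w u σ x y = u m n := by
        intro x hx y hy
        rw [mem_cycleSet] at hx hy
        rw [markedWeight, ← minimalPeriod_eq_of_sameCycle hx, ← minimalPeriod_eq_of_sameCycle hy,
          h0, h1, cycleWeight_eq_one, mul_one]
        intro z
        rcases hall z with hz | hz
        · exact ⟨x, by simp, hx.symm.trans hz⟩
        · exact ⟨y, by simp, hy.symm.trans hz⟩
      rw [Finset.sum_congr rfl fun x hx => Finset.sum_congr rfl (hmark x hx)]
      simp only [Finset.sum_const, card_cycleSet, h0, h1, nsmul_eq_mul]
      ring
    · intro x
      rw [mem_cycleSet, mem_cycleSet, sameCycle_apply_right]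
    · rw [ha.cycleCount_eq, Fintype.card_fin]
      obtain ⟨k, rfl⟩ := hdvd
      -- There are `k` edges, two more than cuts alone would need to pass from `2` to `k` cycles.
      rw [edgeCount, Nat.mul_div_cancel_left _ hr, show 2 * 0 + k + 2 - 2 + 2 = k + 2 by omega]
      ring
  · have := isEmpty_isConnectedFactorization (s := edgeCount r 0 2 N) hdvd σ
    rw [Nat.card_of_isEmpty, hu0 _ _ (hN ▸ hdvd)]
    simp

end Counting

end HurwitzNumbers

/-! ### Lagrange inversion for `x = z e^{-z^r}`. -/

section Lagrange

open Filter

/-- `n ^ ⌊n / r⌋ / ⌊n / r⌋!`. -/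
def floorCoeff (r n : ℕ) : ℚ := (n : ℚ) ^ (n / r) / (n / r).factorial

/-- The weight `d ^ (d / r - 1) / (d / r)!` of one-vertex graphs. -/
def discWeight (r n : ℕ) : ℚ := if r ∣ n then floorCoeff r n / n else 0

/-- The weight of two-vertex graphs. -/
def annulusWeight (r m n : ℕ) : ℚ :=
  if r ∣ m + n ∧ m ≠ 0 ∧ n ≠ 0 then
    (if r ∣ m then 1 else (r : ℚ)) * floorCoeff r m * floorCoeff r n / (m + n) else 0

theorem HasSum.of_sum_antidiagonal {f : ℕ × ℕ → ℂ} {g : ℕ → ℂ} {S : ℂ}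
    (hf : Summable f) (hg : ∀ k, HasSum (fun j => f (k, j)) (g k))
    (hS : HasSum (fun n => ∑ p ∈ Finset.HasAntidiagonal.antidiagonal n, f p) S) : HasSum g S := by
  have h1 := hf.hasSum.prod_fiberwise hg
  have h2 : HasSum (fun q : Σ n : ℕ, Finset.HasAntidiagonal.antidiagonal n => f q.2.1) (∑' p, f p) :=
    Finset.HasAntidiagonal.sigmaAntidiagonalEquivProd.hasSum_iff.2 hf.hasSum
  have h3 := h2.sigma (g := fun n => ∑ p ∈ Finset.HasAntidiagonal.antidiagonal n, f p) fun n => by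
    have := hasSum_fintype (fun p : Finset.HasAntidiagonal.antidiagonal n => f p.1)
    rwa [Finset.univ_eq_attach, Finset.sum_attach] at this
  rwa [h3.unique hS] at h1

/-- Rearrangement of a series in `y e^{- r y}`. -/
theorem hasSum_mul_pow_mul_exp {r i : ℕ} {y : ℂ}
    (hy : Real.exp r * ‖y‖ * Real.exp (r * ‖y‖) < 1) {c : ℕ → ℂ}
    (hc : ∀ k, ‖c k‖ ≤ Real.exp (i + r * k)) {S : ℂ}
    (hS : HasSum (fun n => (∑ p ∈ Finset.HasAntidiagonal.antidiagonal n,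
      c p.1 * (-(i + r * p.1 : ℂ)) ^ p.2 / p.2.factorial) * y ^ n) S) :
    HasSum (fun k : ℕ => c k * y ^ k * exp (-(i + r * k) * y)) S := by
  -- Expanding the exponential gives this double series; its sums along the antidiagonals form the
  -- series in `hS`.
  set f : ℕ × ℕ → ℂ := fun p => c p.1 * y ^ p.1 * ((-(i + r * p.1) * y) ^ p.2 / p.2.factorial)
    with hf
  have hexp : ∀ z : ℂ, HasSum (fun j : ℕ => z ^ j / j.factorial) (exp z) := fun z => by
    rw [Complex.exp_eq_exp_ℂ]
    exact NormedSpace.expSeries_div_hasSum_exp z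
  have hrexp : ∀ z : ℝ, HasSum (fun j : ℕ => z ^ j / j.factorial) (Real.exp z) := fun z => by
    rw [Real.exp_eq_exp_ℝ]
    exact NormedSpace.expSeries_div_hasSum_exp z
  have hnorm : ∀ p, ‖f p‖ = ‖c p.1‖ * ‖y‖ ^ p.1 *
      (((i + r * p.1 : ℝ) * ‖y‖) ^ p.2 / p.2.factorial) := by
    intro p
    have : ‖(i + r * p.1 : ℂ)‖ = i + r * p.1 := by
      rw [show (i + r * p.1 : ℂ) = ((i + r * p.1 : ℕ) : ℂ) by push_cast; ring, Complex.norm_natCast]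
      push_cast; ring
    simp only [hf, norm_mul, norm_div, norm_pow, norm_neg, this, Complex.norm_natCast]
  have hsum : Summable f := by
    refine Summable.of_norm ((summable_prod_of_nonneg fun p => norm_nonneg _).2 ⟨fun k => ?_, ?_⟩)
    · simp only [hnorm]
      exact (hrexp _).summable.mul_left _
    · simp only [hnorm, tsum_mul_left, (hrexp _).tsum_eq]
      -- The bound on `c k` makes row `k` at most a constant times the `k`-th power of the number
      -- that `hy` places below `1`.
      have hgeo : Summable fun k : ℕ => Real.exp i * Real.exp (i * ‖y‖) *
          (Real.exp r * ‖y‖ * Real.exp (r * ‖y‖)) ^ k :=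
        (summable_geometric_of_lt_one (by positivity) hy).mul_left _
      refine hgeo.of_nonneg_of_le (fun k => by positivity) fun k => ?_
      calc ‖c k‖ * ‖y‖ ^ k * Real.exp ((i + r * k) * ‖y‖)
          ≤ Real.exp (i + r * k) * ‖y‖ ^ k * Real.exp ((i + r * k) * ‖y‖) := by gcongr; exact hc k
        _ = _ := by
          rw [mul_pow, mul_pow, ← Real.exp_nat_mul, ← Real.exp_nat_mul, Real.exp_add, add_mul,
            Real.exp_add, mul_comm (r : ℝ) k, mul_assoc (k : ℝ)]
          ring
  refine HasSum.of_sum_antidiagonal hsum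
    (fun k => (hexp (-(i + r * k) * y)).mul_left (c k * y ^ k)) ?_
  · refine hS.congr_fun fun n => ?_
    rw [Finset.sum_mul]
    refine Finset.sum_congr rfl fun p hp => ?_
    rw [Finset.HasAntidiagonal.mem_antidiagonal] at hp
    rw [← hp]
    simp only [hf, mul_pow, pow_add]
    ring

/-- Up to `n!` the convolution is the `n`-th finite difference of `f` at `0`, which can be evaluated
when `f` is a power of an affine function. -/
theorem sum_antidiagonal_alternating (n : ℕ) (f : ℕ → ℂ) :
    ∑ p ∈ Finset.HasAntidiagonal.antidiagonal n, f p.1 * (-1) ^ p.2 / (p.1.factorial * p.2.factorial) =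
      (∑ k ∈ Finset.range (n + 1), ((-1 : ℤ) ^ (n - k) * n.choose k) • f k) / n.factorial := by
  rw [Finset.Nat.sum_antidiagonal_eq_sum_range_succ_mk, Finset.sum_div]
  refine Finset.sum_congr rfl fun k hk => ?_
  have hk' : k ≤ n := by simpa [Nat.lt_succ_iff] using hk
  have h1 : (n.choose k : ℂ) * (k.factorial * (n - k).factorial) = n.factorial := by
    rw [← mul_assoc]; exact_mod_cast Nat.choose_mul_factorial_mul_factorial hk'
  have h2 : (k.factorial : ℂ) ≠ 0 := by exact_mod_cast k.factorial_ne_zero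
  have h3 : ((n - k).factorial : ℂ) ≠ 0 := by exact_mod_cast (n - k).factorial_ne_zero
  have h4 : (n.factorial : ℂ) ≠ 0 := by exact_mod_cast n.factorial_ne_zero
  rw [zsmul_eq_mul]
  push_cast
  rw [div_eq_div_iff (mul_ne_zero h2 h3) h4, ← h1]
  ring

/-- The two powers combine to degree `n`, and the `n`-th difference of `x ^ n` is `n!`. -/
theorem sum_antidiagonal_pow_self {r : ℕ} (hr : 1 ≤ r) (i n : ℕ) :
    ∑ p ∈ Finset.HasAntidiagonal.antidiagonal n, (i + r * p.1 : ℂ) ^ p.1 / p.1.factorial *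
      (-(i + r * p.1 : ℂ)) ^ p.2 / p.2.factorial = r ^ n := by
  have hr0 : (r : ℂ) ≠ 0 := by exact_mod_cast (by omega : r ≠ 0)
  have h1 : ∑ p ∈ Finset.HasAntidiagonal.antidiagonal n, (i + r * p.1 : ℂ) ^ p.1 / p.1.factorial *
      (-(i + r * p.1 : ℂ)) ^ p.2 / p.2.factorial = r ^ n * ∑ p ∈ Finset.HasAntidiagonal.antidiagonal n,
        (i / r + p.1 • (1 : ℂ)) ^ n * (-1) ^ p.2 / (p.1.factorial * p.2.factorial) := by
    rw [Finset.mul_sum]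
    refine Finset.sum_congr rfl fun p hp => ?_
    rw [Finset.HasAntidiagonal.mem_antidiagonal] at hp
    have : (i + r * p.1 : ℂ) = r * (i / r + p.1 • (1 : ℂ)) := by
      rw [nsmul_eq_mul]; field_simp
    rw [this, neg_eq_neg_one_mul, mul_pow (-1 : ℂ), ← hp, mul_pow, mul_pow, pow_add, pow_add]
    field_simp
  rw [h1, sum_antidiagonal_alternating n (fun k => (i / r + k • (1 : ℂ)) ^ n),
    ← fwdDiff_iter_eq_sum_shift 1 (fun x : ℂ => x ^ n) n (i / r), fwdDiff_iter_eq_factorial]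
  have h4 : (n.factorial : ℂ) ≠ 0 := by exact_mod_cast n.factorial_ne_zero
  simp [h4]

/-- For `n ≥ 2` the powers combine to degree `n - 1`, which the `n`-th difference kills. -/
theorem sum_antidiagonal_pow_pred (r n : ℕ) :
    ∑ p ∈ Finset.HasAntidiagonal.antidiagonal n, ((if p.1 = 0 then 0 else
      (r * p.1 : ℂ) ^ (p.1 - 1) / p.1.factorial) *
      (-((0 : ℕ) + r * p.1 : ℂ)) ^ p.2 / p.2.factorial) = if n = 1 then 1 else 0 := by
  rcases Nat.lt_or_ge n 2 with hn | hn
  · interval_cases n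
    · simp
    · rw [Finset.Nat.sum_antidiagonal_eq_sum_range_succ_mk]
      simp [Finset.sum_range_succ]
  rw [if_neg (by omega)]
  have h1 : ∑ p ∈ Finset.HasAntidiagonal.antidiagonal n, ((if p.1 = 0 then 0 else
      (r * p.1 : ℂ) ^ (p.1 - 1) / p.1.factorial) *
      (-((0 : ℕ) + r * p.1 : ℂ)) ^ p.2 / p.2.factorial) =
      r ^ (n - 1) * ∑ p ∈ Finset.HasAntidiagonal.antidiagonal n,
        (0 + p.1 • (1 : ℂ)) ^ (n - 1) * (-1) ^ p.2 / (p.1.factorial * p.2.factorial) := by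
    rw [Finset.mul_sum]
    refine Finset.sum_congr rfl fun p hp => ?_
    rw [Finset.HasAntidiagonal.mem_antidiagonal] at hp
    split_ifs with h0
    · rw [h0, zero_nsmul, zero_add, zero_pow (by omega)]; simp
    · rw [nsmul_eq_mul, show n - 1 = (p.1 - 1) + p.2 by omega, Nat.cast_zero, zero_add, zero_add,
        neg_eq_neg_one_mul, mul_pow (-1 : ℂ), mul_pow (r : ℂ), mul_pow (r : ℂ), mul_one, pow_add,
        pow_add]
      field_simp
  rw [h1, sum_antidiagonal_alternating n (fun k => (0 + k • (1 : ℂ)) ^ (n - 1)),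
    ← fwdDiff_iter_eq_sum_shift 1 (fun x : ℂ => x ^ (n - 1)) n 0,
    fwdDiff_iter_pow_eq_zero_of_lt (by omega)]
  simp

theorem floorCoeff_nonneg (r n : ℕ) : 0 ≤ floorCoeff r n := by
  unfold floorCoeff; positivity

theorem floorCoeff_le_exp (r n : ℕ) : (floorCoeff r n : ℝ) ≤ Real.exp n := by
  rw [floorCoeff]
  push_cast
  exact Real.pow_div_factorial_le_exp _ (by positivity) _

theorem eventually_exp_mul_lt_one {r : ℕ} (hr : 1 ≤ r) :
    ∀ᶠ z : ℂ in 𝓝 0, Real.exp r * ‖z ^ r‖ * Real.exp (r * ‖z ^ r‖) < 1 := by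
  have h : ContinuousAt (fun z : ℂ => Real.exp r * ‖z ^ r‖ * Real.exp (r * ‖z ^ r‖)) 0 := by
    fun_prop
  refine h.eventually_lt continuousAt_const ?_
  simp [zero_pow (by omega : r ≠ 0)]

theorem spectralX_pow (r n : ℕ) (z : ℂ) :
    spectralX r z ^ n = z ^ n * exp (-n * z ^ r) := by
  rw [spectralX, mul_pow, ← Complex.exp_nat_mul]
  congr 2
  ring

/-- For `n = i + r k` the coefficient is `(i + r k)^k / k!`, and `x^n = z^i y^k e^{-(i + r k) y}`
with `y = z^r`. Expanding in `y` leaves the geometric series in `r y`. -/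
theorem hasSum_floorCoeff_residue {r : ℕ} (hr : 1 ≤ r) {i : ℕ} (hi : i < r) {z : ℂ}
    (hz : Real.exp r * ‖z ^ r‖ * Real.exp (r * ‖z ^ r‖) < 1) :
    HasSum (fun n => (if n % r = i then (floorCoeff r n : ℂ) else 0) * spectralX r z ^ n)
      (z ^ i / (1 - r * z ^ r)) := by
  have hr0 : (0 : ℝ) < r := by exact_mod_cast hr
  have hlt : ‖(r : ℂ) * z ^ r‖ < 1 := by
    rw [norm_mul, Complex.norm_natCast]
    refine lt_of_le_of_lt ?_ hz
    have h1 : (r : ℝ) ≤ Real.exp r := by linarith [Real.add_one_le_exp (r : ℝ)]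
    have h2 : 1 ≤ Real.exp (r * ‖z ^ r‖) := Real.one_le_exp (by positivity)
    calc (r : ℝ) * ‖z ^ r‖ ≤ Real.exp r * ‖z ^ r‖ * 1 := by rw [mul_one]; gcongr
      _ ≤ _ := by gcongr
  have hgeo := hasSum_geometric_of_norm_lt_one hlt
  have key := hasSum_mul_pow_mul_exp (r := r) (i := i) hz
    (c := fun k => (i + r * k : ℂ) ^ k / k.factorial) (S := (1 - r * z ^ r)⁻¹) (fun k => by
      have := Real.pow_div_factorial_le_exp (i + r * k : ℝ) (by positivity) k
      rw [norm_div, norm_pow, Complex.norm_natCast,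
        show (i + r * k : ℂ) = ((i + r * k : ℝ) : ℂ) by push_cast; ring, Complex.norm_real,
        Real.norm_of_nonneg (by positivity)]
      exact this) (by
      refine hgeo.congr_fun fun n => ?_
      rw [sum_antidiagonal_pow_self hr, mul_pow])
  have hinj : Function.Injective (fun k : ℕ => r * k + i) := fun a b h => by
    simpa [show r ≠ 0 by omega] using h
  rw [← hinj.hasSum_iff]
  · rw [div_eq_mul_inv]
    refine (key.mul_left (z ^ i)).congr_fun fun k => ?_
    have h1 : (r * k + i) % r = i := by rw [Nat.mul_add_mod, Nat.mod_eq_of_lt hi]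
    have h2 : (r * k + i) / r = k := by
      rw [Nat.mul_add_div hr, Nat.div_eq_of_lt hi, add_zero]
    simp only [Function.comp_apply, h1, if_true, floorCoeff, h2, spectralX_pow]
    push_cast
    rw [pow_add, pow_mul, add_comm (i : ℂ)]
    ring
  · intro n hn
    rw [if_neg, zero_mul]
    rintro rfl
    exact hn ⟨n / r, Nat.div_add_mod n r⟩

/-- The same expansion with exponent `k - 1` leaves only the linear term `y = z^r`. The coefficient
at `0` is `0`, by the convention for division by zero in `discWeight`. -/
theorem hasSum_discWeight {r : ℕ} (hr : 1 ≤ r) {z : ℂ}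
    (hz : Real.exp r * ‖z ^ r‖ * Real.exp (r * ‖z ^ r‖) < 1) :
    HasSum (fun n => (discWeight r n : ℂ) * spectralX r z ^ n) (z ^ r) := by
  have hr0 : (0 : ℝ) < r := by exact_mod_cast hr
  have key := hasSum_mul_pow_mul_exp (r := r) (i := 0) hz
    (c := fun k => if k = 0 then 0 else (r * k : ℂ) ^ (k - 1) / k.factorial) (S := z ^ r)
    (fun k => by
      split_ifs with h0
      · rw [norm_zero]; positivity
      have := Real.pow_div_factorial_le_exp (r * k : ℝ) (by positivity) k
      rw [norm_div, norm_pow, Complex.norm_natCast,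
        show (r * k : ℂ) = ((r * k : ℝ) : ℂ) by push_cast; ring, Complex.norm_real,
        Real.norm_of_nonneg (by positivity), Nat.cast_zero, zero_add]
      refine le_trans ?_ this
      have h1 : (1 : ℝ) ≤ r * k := by exact_mod_cast Nat.mul_pos hr (Nat.pos_of_ne_zero h0)
      gcongr
      exact Nat.sub_le k 1) (by
      simp only [sum_antidiagonal_pow_pred r]
      have := hasSum_ite_eq 1 (z ^ r)
      refine this.congr_fun fun n => ?_
      split_ifs with h
      · rw [h]; simp
      · simp)
  have hinj : Function.Injective (fun k : ℕ => r * k) := fun a b h => by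
    simpa [show r ≠ 0 by omega] using h
  rw [← hinj.hasSum_iff]
  · refine key.congr_fun fun k => ?_
    simp only [Function.comp_apply, discWeight, dvd_mul_right, if_true, floorCoeff,
      Nat.mul_div_cancel_left _ hr, spectralX_pow]
    push_cast
    rcases Nat.eq_zero_or_pos k with rfl | hk
    · simp
    · obtain ⟨m, rfl⟩ := Nat.exists_eq_succ_of_ne_zero hk.ne'
      have h1 : (r : ℂ) ≠ 0 := by exact_mod_cast (by omega : r ≠ 0)
      have h2 : ((m + 1 : ℕ) : ℂ) ≠ 0 := by exact_mod_cast m.succ_ne_zero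
      rw [if_neg (by omega), Nat.succ_eq_add_one, Nat.add_sub_cancel, pow_mul, zero_add]
      field_simp
      ring
  · intro n hn
    rw [discWeight, if_neg, Rat.cast_zero, zero_mul]
    rintro ⟨k, rfl⟩
    exact hn ⟨k, rfl⟩

end Lagrange

/-! ### Products and uniqueness of power series; the one-vertex recursion. -/

section PowerSeries

open Filter

theorem HasSum.prod_of_norm {f g : ℕ → ℂ} {a b : ℂ} (hf : HasSum f a) (hg : HasSum g b) :
    HasSum (fun p : ℕ × ℕ => f p.1 * g p.2) (a * b) :=
  hf.mul hg (summable_mul_of_summable_norm hf.summable.norm hg.summable.norm)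

theorem HasSum.mul_antidiagonal {f g : ℕ → ℂ} {a b : ℂ} (hf : HasSum f a) (hg : HasSum g b) :
    HasSum (fun n => ∑ p ∈ Finset.HasAntidiagonal.antidiagonal n, f p.1 * g p.2) (a * b) := by
  have h := tsum_mul_tsum_eq_tsum_sum_antidiagonal_of_summable_norm hf.summable.norm
    hg.summable.norm
  rw [hf.tsum_eq, hg.tsum_eq] at h
  rw [h]
  exact (summable_norm_sum_mul_antidiagonal_of_summable_norm hf.summable.norm
    hg.summable.norm).of_norm.hasSum

theorem HasSum.mul_antidiagonal_fst {f : ℕ → ℂ} {g : ℕ × ℕ → ℂ} {a b : ℂ} (hf : HasSum f a)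
    (hg : HasSum g b) :
    HasSum (fun q : ℕ × ℕ => ∑ p ∈ Finset.HasAntidiagonal.antidiagonal q.1,
      f p.1 * g (p.2, q.2)) (a * b) := by
  have h1 : HasSum (fun x : ℕ × (ℕ × ℕ) => f x.1 * g x.2) (a * b) :=
    hf.mul hg (summable_mul_of_summable_norm hf.summable.norm hg.summable.norm)
  let e : (Σ q : ℕ × ℕ, Finset.HasAntidiagonal.antidiagonal q.1) ≃ ℕ × (ℕ × ℕ) :=
    { toFun := fun s => (s.2.1.1, (s.2.1.2, s.1.2))
      invFun := fun x => ⟨(x.1 + x.2.1, x.2.2), ⟨(x.1, x.2.1), by simp⟩⟩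
      left_inv := by
        rintro ⟨⟨m, n⟩, ⟨⟨i, j⟩, h⟩⟩
        rw [Finset.HasAntidiagonal.mem_antidiagonal] at h
        dsimp only at h
        subst h
        rfl
      right_inv := fun x => rfl }
  refine (e.hasSum_iff.2 h1).sigma fun q => ?_
  have := hasSum_fintype (fun p : Finset.HasAntidiagonal.antidiagonal q.1 =>
    f p.1.1 * g (p.1.2, q.2))
  rwa [Finset.univ_eq_attach, Finset.sum_attach (Finset.HasAntidiagonal.antidiagonal q.1)
    (fun p : ℕ × ℕ => f p.1 * g (p.2, q.2))] at this

theorem HasSum.mul_antidiagonal_snd {f : ℕ → ℂ} {g : ℕ × ℕ → ℂ} {a b : ℂ} (hf : HasSum f a)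
    (hg : HasSum g b) :
    HasSum (fun q : ℕ × ℕ => ∑ p ∈ Finset.HasAntidiagonal.antidiagonal q.2,
      f p.1 * g (q.1, p.2)) (a * b) := by
  have h1 : HasSum (g ∘ Equiv.prodComm ℕ ℕ) b := (Equiv.prodComm ℕ ℕ).hasSum_iff.2 hg
  have h2 := (Equiv.prodComm ℕ ℕ).hasSum_iff.2 (hf.mul_antidiagonal_fst h1)
  exact h2.congr_fun fun q => Finset.sum_congr rfl fun p _ => rfl

/-- Convergence at one non-zero point gives a positive radius; then zeros of an analytic function
are isolated unless its series vanishes. -/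
theorem eq_zero_of_hasSum_pow_zero {c : ℕ → ℂ}
    (h : ∀ᶠ x : ℂ in 𝓝[≠] 0, HasSum (fun n => c n * x ^ n) 0) (n : ℕ) : c n = 0 := by
  set p := FormalMultilinearSeries.ofScalars ℂ c with hp
  have hnorm : ∀ n, ‖p n‖ = ‖c n‖ := fun n => by
    rw [hp, FormalMultilinearSeries.ofScalars_norm]
  obtain ⟨x₀, hx₀, hx₀'⟩ := (h.and self_mem_nhdsWithin).exists
  have hx₀' : x₀ ≠ 0 := hx₀'
  have hrad : 0 < p.radius := by
    have h1 : (‖x₀‖₊ : ENNReal) ≤ p.radius := by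
      refine p.le_radius_of_summable ?_
      refine hx₀.summable.norm.congr fun n => ?_
      rw [hnorm, norm_mul, norm_pow]; rfl
    refine lt_of_lt_of_le ?_ h1
    simpa using hx₀'
  have hfp := p.hasFPowerSeriesOnBall hrad
  have hzero : ∀ᶠ x : ℂ in 𝓝[≠] 0, p.sum x = 0 := by
    filter_upwards [h] with x hx
    rw [FormalMultilinearSeries.sum, ← hx.tsum_eq]
    refine tsum_congr fun n => ?_
    rw [hp, FormalMultilinearSeries.ofScalars_apply_eq, smul_eq_mul]
  have hzero' : ∀ᶠ x : ℂ in 𝓝 0, p.sum x = 0 :=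
    hfp.analyticAt.frequently_zero_iff_eventually_zero.1 hzero.frequently
  have hp0 : p = 0 := (hfp.hasFPowerSeriesAt.congr hzero').eq_zero
  have := hnorm n
  rw [hp0] at this
  simpa using this.symm

/-- For fixed `x₂ ≠ 0` the disc `‖x₁‖ < ‖x₂‖` avoids the diagonal, so the one-variable result
applies first in `x₁`, then in `x₂`. -/
theorem eq_zero_of_hasSum_pow_mul_pow_zero {c : ℕ × ℕ → ℂ}
    (h : ∀ᶠ x : ℂ × ℂ in 𝓝 0, x.1 ≠ x.2 → HasSum (fun p => c p * (x.1 ^ p.1 * x.2 ^ p.2)) 0)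
    (p : ℕ × ℕ) : c p = 0 := by
  obtain ⟨δ, hδ, hball⟩ := Metric.eventually_nhds_iff.1 h
  have hball' : ∀ x₁ x₂ : ℂ, ‖x₁‖ < δ → ‖x₂‖ < δ → x₁ ≠ x₂ →
      HasSum (fun p => c p * (x₁ ^ p.1 * x₂ ^ p.2)) 0 := fun x₁ x₂ h1 h2 hne =>
    hball (y := (x₁, x₂)) (by simpa [Prod.dist_eq] using ⟨h1, h2⟩) hne
  refine eq_zero_of_hasSum_pow_zero (c := fun b => c (p.1, b)) ?_ p.2
  rw [eventually_nhdsWithin_iff]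
  filter_upwards [Metric.ball_mem_nhds (0 : ℂ) hδ] with x₂ hx₂ hx₂0
  have hx₂' : ‖x₂‖ < δ := by simpa using hx₂
  have hpos : 0 < ‖x₂‖ := norm_pos_iff.2 hx₂0
  have hfib : ∀ x₁ : ℂ, ‖x₁‖ < ‖x₂‖ → x₁ ≠ 0 → ∀ a, Summable fun b => c (a, b) * x₂ ^ b := by
    intro x₁ h1 h10 a
    have h2 := (hball' x₁ x₂ (h1.trans hx₂') hx₂' (by rintro rfl; exact lt_irrefl _ h1)).summable
    have h3 := (h2.prod_factor a).mul_left (x₁ ^ a)⁻¹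
    refine h3.congr fun b => ?_
    have : x₁ ^ a ≠ 0 := pow_ne_zero _ h10
    field_simp
  have hsum : ∀ a, Summable fun b => c (a, b) * x₂ ^ b := by
    -- Any non-zero `x₁` in the smaller disc shows that the rows converge.
    refine hfib (x₂ / 2) ?_ (by simpa using hx₂0)
    rw [norm_div]
    simpa using half_lt_self hpos
  have hz : ∀ a, ∑' b, c (a, b) * x₂ ^ b = 0 := by
    refine eq_zero_of_hasSum_pow_zero ?_
    refine eventually_nhdsWithin_of_eventually_nhds ?_
    filter_upwards [Metric.ball_mem_nhds (0 : ℂ) hpos] with x₁ hx₁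
    have h1 : ‖x₁‖ < ‖x₂‖ := by simpa using hx₁
    have h2 := hball' x₁ x₂ (h1.trans hx₂') hx₂' (by rintro rfl; exact lt_irrefl _ h1)
    refine h2.prod_fiberwise fun a => ?_
    refine ((hsum a).hasSum.mul_right (x₁ ^ a)).congr_fun fun b => ?_
    ring
  have := (hsum p.1).hasSum
  rwa [hz] at this

theorem hasStrictDerivAt_spectralX (r : ℕ) (z : ℂ) :
    HasStrictDerivAt (spectralX r) (exp (-z ^ r) * (1 - r * z ^ r)) z := by
  have h1 : HasStrictDerivAt (fun z : ℂ => z * exp (-z ^ r))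
      (1 * exp (-z ^ r) + z * (exp (-z ^ r) * (-(r * z ^ (r - 1))))) z :=
    (hasStrictDerivAt_id z).mul ((hasStrictDerivAt_pow r z).neg.cexp)
  refine h1.congr_deriv ?_
  rcases Nat.eq_zero_or_pos r with rfl | hr
  · simp
  · have : z ^ r = z * z ^ (r - 1) := by rw [← pow_succ', Nat.sub_add_cancel hr]
    linear_combination (r * exp (-z ^ r)) * this

theorem spectralX_zero (r : ℕ) : spectralX r 0 = 0 := by simp [spectralX]

/-- The derivative at `0` is `1`, so a statement for all `x` near `0` may be tested at `x = x(z)`.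
-/
theorem map_spectralX_nhds {r : ℕ} (hr : 1 ≤ r) : map (spectralX r) (𝓝 0) = 𝓝 0 := by
  have h := (hasStrictDerivAt_spectralX r 0).map_nhds_eq (by simp [zero_pow (by omega : r ≠ 0)])
  rwa [spectralX_zero] at h

theorem hasSum_mul_discWeight {r : ℕ} (hr : 1 ≤ r) {z : ℂ}
    (hz : Real.exp r * ‖z ^ r‖ * Real.exp (r * ‖z ^ r‖) < 1) :
    HasSum (fun n => (n * discWeight r n : ℂ) * spectralX r z ^ n)
      (1 / (1 - r * z ^ r) - 1) := by
  have h1 := hasSum_floorCoeff_residue hr (i := 0) (by omega) hz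
  have h2 := h1.sub (hasSum_ite_eq 0 (1 : ℂ))
  rw [pow_zero] at h2
  refine h2.congr_fun fun n => ?_
  rcases Nat.eq_zero_or_pos n with rfl | hn
  · simp [floorCoeff]
  · rw [if_neg hn.ne', sub_zero, discWeight]
    by_cases hd : r ∣ n
    · rw [if_pos hd, if_pos (Nat.mod_eq_zero_of_dvd hd)]
      have : (n : ℂ) ≠ 0 := by exact_mod_cast hn.ne'
      push_cast
      field_simp
    · rw [if_neg hd, if_neg (fun h => hd (Nat.dvd_of_mod_eq_zero h))]
      simp

theorem eventually_one_sub_mul_pow_ne_zero {r : ℕ} (hr : 1 ≤ r) :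
    ∀ᶠ z : ℂ in 𝓝 0, 1 - r * z ^ r ≠ 0 := by
  have h : ContinuousAt (fun z : ℂ => 1 - r * z ^ r) 0 := by fun_prop
  exact h.eventually_ne (by simp [zero_pow (by omega : r ≠ 0)])

theorem discWeight_zero (r : ℕ) : discWeight r 0 = 0 := by simp [discWeight]

/-- With `y = z^r` and `D = x d/dx` one has `D y = r y / (1 - r y)`, hence `D y - r y D y - r y =
0`; these are its coefficients. -/
theorem mul_discWeight_eq {r : ℕ} (hr : 1 ≤ r) (n : ℕ) :
    n * discWeight r n - r * ∑ p ∈ Finset.HasAntidiagonal.antidiagonal n,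
      discWeight r p.1 * (p.2 * discWeight r p.2) - r * discWeight r n = 0 := by
  have key := eq_zero_of_hasSum_pow_zero (c := fun n =>
    ((n * discWeight r n - r * ∑ p ∈ Finset.HasAntidiagonal.antidiagonal n,
      discWeight r p.1 * (p.2 * discWeight r p.2) - r * discWeight r n : ℚ) : ℂ)) ?_ n
  · exact_mod_cast key
  refine eventually_nhdsWithin_of_eventually_nhds ?_
  rw [← map_spectralX_nhds hr, eventually_map]
  filter_upwards [eventually_exp_mul_lt_one hr, eventually_one_sub_mul_pow_ne_zero hr]
    with z hz hne
  have h1 := hasSum_discWeight hr hz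
  have h2 := hasSum_mul_discWeight hr hz
  have h3 := (h2.sub ((h1.mul_antidiagonal h2).mul_left (r : ℂ))).sub (h1.mul_left (r : ℂ))
  have h4 : 1 / (1 - r * z ^ r) - 1 - r * (z ^ r * (1 / (1 - r * z ^ r) - 1)) - r * z ^ r = 0 := by
    field_simp
    ring
  rw [h4] at h3
  refine h3.congr_fun fun n => ?_
  push_cast
  rw [sub_mul, sub_mul, mul_assoc (r : ℂ), Finset.sum_mul, mul_assoc (r : ℂ)]
  congr 3
  refine Finset.sum_congr rfl fun p hp => ?_
  rw [Finset.HasAntidiagonal.mem_antidiagonal] at hp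
  rw [← hp, pow_add]
  ring

theorem sum_antidiagonal_eq_sum_Ico (n : ℕ) (f : ℕ → ℕ → ℚ) (h0 : ∀ k, f 0 k = 0)
    (h0' : ∀ k, f k 0 = 0) :
    ∑ p ∈ Finset.HasAntidiagonal.antidiagonal n, f p.1 p.2 =
      ∑ k ∈ Finset.Ico 1 n, f k (n - k) := by
  rw [Finset.Nat.sum_antidiagonal_eq_sum_range_succ_mk, Finset.sum_range_succ]
  simp only [Nat.sub_self, h0', add_zero]
  rcases Nat.eq_zero_or_pos n with rfl | hn
  · simp
  · rw [Finset.range_eq_Ico, Finset.sum_eq_sum_Ico_succ_bot hn]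
    simp [h0]

theorem isDiscWeight_discWeight {r : ℕ} (hr : 1 ≤ r) : IsDiscWeight r (discWeight r) where
  eq_zero n hn := by rw [discWeight, if_neg hn]
  apply_self := by
    have : (r : ℚ) ≠ 0 := by positivity
    simp [discWeight, floorCoeff, Nat.div_self hr, this]
  cutJoin n hn := by
    have h1 := mul_discWeight_eq hr n
    have h2 : ∑ p ∈ Finset.HasAntidiagonal.antidiagonal n,
        discWeight r p.1 * (p.2 * discWeight r p.2) = ∑ p ∈ Finset.HasAntidiagonal.antidiagonal n,
        discWeight r p.1 * (p.1 * discWeight r p.2) := by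
      rw [← Finset.Nat.sum_antidiagonal_swap]
      refine Finset.sum_congr rfl fun p _ => ?_
      simp only [Prod.fst_swap, Prod.snd_swap]; ring
    -- Write `n = p.1 + p.2`; by symmetry both halves of the sum are equal.
    have h3 : (n : ℚ) * ∑ p ∈ Finset.HasAntidiagonal.antidiagonal n,
        discWeight r p.1 * discWeight r p.2 = 2 * ∑ p ∈ Finset.HasAntidiagonal.antidiagonal n,
        discWeight r p.1 * (p.2 * discWeight r p.2) := by
      rw [two_mul]
      nth_rw 2 [h2]
      rw [← Finset.sum_add_distrib, Finset.mul_sum]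
      refine Finset.sum_congr rfl fun p hp => ?_
      rw [Finset.HasAntidiagonal.mem_antidiagonal] at hp
      rw [← hp]; push_cast; ring
    rw [← sum_antidiagonal_eq_sum_Ico n (fun a b => discWeight r a * discWeight r b)
      (by simp [discWeight_zero]) (by simp [discWeight_zero]), h3]
    have hr' : (r : ℚ) ≠ 0 := by positivity
    generalize ∑ p ∈ Finset.HasAntidiagonal.antidiagonal n,
      discWeight r p.1 * (p.2 * discWeight r p.2) = T at h1
    field_simp
    linear_combination -h1

end PowerSeries

/-! ### The two-variable series and its Euler derivatives. -/

section AnnulusSeries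

open Filter

theorem discWeight_nonneg (r n : ℕ) : 0 ≤ discWeight r n := by
  unfold discWeight
  split_ifs
  · exact div_nonneg (floorCoeff_nonneg r n) n.cast_nonneg
  · exact le_rfl

theorem annulusWeight_nonneg (r m n : ℕ) : 0 ≤ annulusWeight r m n := by
  have h1 := floorCoeff_nonneg r m
  have h2 := floorCoeff_nonneg r n
  unfold annulusWeight
  split_ifs <;> positivity

theorem norm_discWeight_le (r n : ℕ) : ‖(discWeight r n : ℂ)‖ ≤ Real.exp n := by
  rw [Complex.norm_ratCast, abs_of_nonneg (by exact_mod_cast discWeight_nonneg r n)]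
  refine le_trans ?_ (floorCoeff_le_exp r n)
  have h := floorCoeff_nonneg r n
  rw [Rat.cast_le, discWeight]
  split_ifs
  · rcases Nat.eq_zero_or_pos n with rfl | hn
    · simpa using h
    · exact div_le_self h (by exact_mod_cast hn)
  · exact h

/-- If `r ∣ m + n`, the residues are either both `0` or `i` and `r - i`, so the Euler derivative
splits into products of one-variable series. The factors `m` and `n` in the first product remove the
terms with a zero index. -/
theorem add_mul_annulusWeight {r : ℕ} (hr : 1 ≤ r) (m n : ℕ) :
    (m + n : ℚ) * annulusWeight r m n = (m * discWeight r m) * (n * discWeight r n) +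
      r * ∑ i ∈ Finset.Ico 1 r, (if m % r = i then floorCoeff r m else 0) *
        (if n % r = r - i then floorCoeff r n else 0) := by
  have hdisc : ∀ n : ℕ, n ≠ 0 → r ∣ n → (n : ℚ) * discWeight r n = floorCoeff r n := by
    intro n hn hd
    have : (n : ℚ) ≠ 0 := by exact_mod_cast hn
    rw [discWeight, if_pos hd]; field_simp
  by_cases hm : r ∣ m
  · rw [Finset.sum_eq_zero, mul_zero, add_zero]
    · by_cases h : r ∣ m + n ∧ m ≠ 0 ∧ n ≠ 0
      · have hn : r ∣ n := (Nat.dvd_add_right hm).1 h.1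
        have h1 : (m + n : ℚ) ≠ 0 := by
          have := h.2.1
          positivity
        rw [annulusWeight, if_pos h, if_pos hm, hdisc m h.2.1 hm, hdisc n h.2.2 hn]
        field_simp
      · rw [annulusWeight, if_neg h, mul_zero]
        by_cases hn : r ∣ n
        · rw [not_and_or, not_and_or, not_not, not_not] at h
          rcases h with h | rfl | rfl
          · exact absurd (dvd_add hm hn) h
          · simp
          · simp
        · rw [discWeight, discWeight, if_neg hn]; simp
    · intro i hi
      rw [Finset.mem_Ico] at hi
      rw [if_neg (by rw [Nat.mod_eq_zero_of_dvd hm]; omega), zero_mul]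
  · have hm0 : m % r ≠ 0 := fun h => hm (Nat.dvd_of_mod_eq_zero h)
    have hlt : m % r < r := Nat.mod_lt _ hr
    rw [Finset.sum_eq_single_of_mem (m % r) (Finset.mem_Ico.2 ⟨by omega, hlt⟩)
      (fun i _ hi => by rw [if_neg hi.symm, zero_mul]), if_pos rfl, discWeight, if_neg hm]
    have hiff : r ∣ m + n ↔ n % r = r - m % r := by
      have hltn : n % r < r := Nat.mod_lt _ hr
      rw [Nat.dvd_iff_mod_eq_zero, Nat.add_mod]
      constructor
      · intro h
        rcases Nat.lt_or_ge (m % r + n % r) r with h' | h'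
        · rw [Nat.mod_eq_of_lt h'] at h; omega
        · rw [Nat.mod_eq_sub_mod h', Nat.mod_eq_of_lt (by omega)] at h; omega
      · intro h
        rw [h, Nat.add_sub_cancel' hlt.le, Nat.mod_self]
    have hmne : m ≠ 0 := by rintro rfl; exact hm (dvd_zero r)
    by_cases hn : n % r = r - m % r
    · have hnne : n ≠ 0 := by rintro rfl; rw [Nat.zero_mod] at hn; omega
      have h1 : (m + n : ℚ) ≠ 0 := by positivity
      rw [annulusWeight, if_pos ⟨hiff.2 hn, hmne, hnne⟩, if_neg hm, if_pos hn]
      field_simp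
      ring
    · rw [annulusWeight, if_neg (fun h => hn (hiff.1 h.1)), if_neg hn]
      ring

theorem hasSum_add_mul_annulusWeight {r : ℕ} (hr : 1 ≤ r) {z₁ z₂ : ℂ}
    (hz₁ : Real.exp r * ‖z₁ ^ r‖ * Real.exp (r * ‖z₁ ^ r‖) < 1)
    (hz₂ : Real.exp r * ‖z₂ ^ r‖ * Real.exp (r * ‖z₂ ^ r‖) < 1) :
    HasSum (fun p : ℕ × ℕ => ((p.1 + p.2) * annulusWeight r p.1 p.2 : ℂ) *
      (spectralX r z₁ ^ p.1 * spectralX r z₂ ^ p.2))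
      ((1 / (1 - r * z₁ ^ r) - 1) * (1 / (1 - r * z₂ ^ r) - 1) +
        r * ∑ i ∈ Finset.Ico 1 r, z₁ ^ i / (1 - r * z₁ ^ r) * (z₂ ^ (r - i) / (1 - r * z₂ ^ r))) := by
  have h1 := (hasSum_mul_discWeight hr hz₁).prod_of_norm (hasSum_mul_discWeight hr hz₂)
  have h2 := hasSum_sum (s := Finset.Ico 1 r) fun i hi =>
    (hasSum_floorCoeff_residue hr (Finset.mem_Ico.1 hi).2 hz₁).prod_of_norm
      (hasSum_floorCoeff_residue hr (i := r - i)
        (by have := Finset.mem_Ico.1 hi; omega) hz₂)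
  refine (h1.add (h2.mul_left (r : ℂ))).congr_fun fun p => ?_
  have h3 := congrArg (fun q : ℚ => (q : ℂ)) (add_mul_annulusWeight hr p.1 p.2)
  push_cast at h3
  rw [h3, add_mul, mul_assoc (r : ℂ), Finset.sum_mul]
  congr 1
  · ring
  · congr 1
    refine Finset.sum_congr rfl fun i _ => ?_
    split_ifs <;> push_cast <;> ring

/-- Coefficients of at most exponential growth. -/
def ExpBounded (c : ℕ × ℕ → ℂ) : Prop :=
  ∃ M : ℝ, ∀ p, ‖c p‖ ≤ M * (Real.exp p.1 * Real.exp p.2)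

theorem ExpBounded.summable_norm {c : ℕ × ℕ → ℂ} (hc : ExpBounded c) {ρ₁ ρ₂ : ℝ} (h₁ : 0 ≤ ρ₁)
    (h₂ : 0 ≤ ρ₂) (h₁' : ρ₁ < Real.exp (-1)) (h₂' : ρ₂ < Real.exp (-1)) :
    Summable fun p : ℕ × ℕ => ‖c p‖ * (ρ₁ ^ p.1 * ρ₂ ^ p.2) := by
  obtain ⟨M, hM⟩ := hc
  have hlt : ∀ {ρ : ℝ}, 0 ≤ ρ → ρ < Real.exp (-1) → Summable fun n : ℕ => (Real.exp 1 * ρ) ^ n := by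
    intro ρ h h'
    refine summable_geometric_of_lt_one (by positivity) ?_
    calc Real.exp 1 * ρ < Real.exp 1 * Real.exp (-1) := by gcongr
      _ = 1 := by rw [← Real.exp_add]; simp
  have h := ((hlt h₁ h₁').mul_of_nonneg (hlt h₂ h₂') (fun n => by positivity)
    (fun n => by positivity)).mul_left M
  refine h.of_nonneg_of_le (fun p => by positivity) fun p => ?_
  calc ‖c p‖ * (ρ₁ ^ p.1 * ρ₂ ^ p.2)
      ≤ M * (Real.exp p.1 * Real.exp p.2) * (ρ₁ ^ p.1 * ρ₂ ^ p.2) := by gcongr; exact hM p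
    _ = _ := by
      rw [mul_pow, mul_pow, ← Real.exp_nat_mul, ← Real.exp_nat_mul, mul_one, mul_one]; ring

theorem ExpBounded.summable {c : ℕ × ℕ → ℂ} (hc : ExpBounded c) {x₁ x₂ : ℂ}
    (h₁ : ‖x₁‖ < Real.exp (-1)) (h₂ : ‖x₂‖ < Real.exp (-1)) :
    Summable fun p : ℕ × ℕ => c p * (x₁ ^ p.1 * x₂ ^ p.2) := by
  refine Summable.of_norm ((hc.summable_norm (norm_nonneg x₁) (norm_nonneg x₂) h₁ h₂).congr
    fun p => ?_)
  simp

theorem expBounded_add_mul_annulusWeight {r : ℕ} (hr : 1 ≤ r) :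
    ExpBounded fun p => ((p.1 + p.2) * annulusWeight r p.1 p.2 : ℂ) := by
  refine ⟨r, fun p => ?_⟩
  have hr' : (1 : ℝ) ≤ r := by exact_mod_cast hr
  have h1 := floorCoeff_le_exp r p.1
  have h2 := floorCoeff_le_exp r p.2
  have h3 : (0 : ℝ) ≤ floorCoeff r p.1 := by exact_mod_cast floorCoeff_nonneg r p.1
  have h4 : (0 : ℝ) ≤ floorCoeff r p.2 := by exact_mod_cast floorCoeff_nonneg r p.2
  have h5 := annulusWeight_nonneg r p.1 p.2
  have h6 : ((p.1 + p.2) * annulusWeight r p.1 p.2 : ℂ) =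
      (((p.1 + p.2) * annulusWeight r p.1 p.2 : ℚ) : ℂ) := by push_cast; ring
  beta_reduce
  rw [h6, Complex.norm_ratCast, abs_of_nonneg (by exact_mod_cast by positivity), annulusWeight]
  split_ifs with h hm
  · have h7 : (p.1 + p.2 : ℝ) ≠ 0 := by
      have := h.2.1
      positivity
    push_cast
    rw [mul_div_cancel₀ _ h7, one_mul, ← one_mul ((floorCoeff r p.1 : ℝ) * _)]
    gcongr
  · have h7 : (p.1 + p.2 : ℝ) ≠ 0 := by
      have := h.2.1
      positivity
    push_cast
    rw [mul_div_cancel₀ _ h7, mul_assoc]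
    gcongr
  · simp only [mul_zero, Rat.cast_zero]
    positivity

theorem ExpBounded.mono {c c' : ℕ × ℕ → ℂ} (hc : ExpBounded c) (h : ∀ p, ‖c' p‖ ≤ ‖c p‖) :
    ExpBounded c' := by
  obtain ⟨M, hM⟩ := hc
  exact ⟨M, fun p => (h p).trans (hM p)⟩

theorem norm_annulusWeight_mul_le {r : ℕ} {a m n : ℕ} (h : a ≤ m + n) :
    ‖(a * annulusWeight r m n : ℂ)‖ ≤ ‖((m + n) * annulusWeight r m n : ℂ)‖ := by
  rw [norm_mul, norm_mul, ← Nat.cast_add, Complex.norm_natCast, Complex.norm_natCast]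
  gcongr

theorem expBounded_annulusWeight {r : ℕ} (hr : 1 ≤ r) :
    ExpBounded fun p => (annulusWeight r p.1 p.2 : ℂ) := by
  refine (expBounded_add_mul_annulusWeight hr).mono fun p => ?_
  by_cases h : p.1 = 0
  · have : annulusWeight r p.1 p.2 = 0 := by simp [annulusWeight, h]
    simp [this]
  · simpa using norm_annulusWeight_mul_le (r := r) (a := 1) (m := p.1) (n := p.2) (by omega)

theorem hasDerivAt_tsum_mul_pow {ι : Type*} {c : ι → ℂ} {N : ι → ℕ} {ρ : ℝ}
    (h₀ : Summable fun i => ‖c i‖ * ρ ^ N i) (h₁ : Summable fun i => ‖N i * c i‖ * ρ ^ N i)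
    {t : ℂ} (ht : ‖t‖ < ρ) :
    ∃ D, HasDerivAt (fun t => ∑' i, c i * t ^ N i) D t ∧
      t * D = ∑' i, (N i * c i) * t ^ N i := by
  have hρ : 0 < ρ := (norm_nonneg t).trans_lt ht
  have hu : Summable fun i => ‖N i * c i‖ * ρ ^ (N i - 1) := by
    refine (h₁.mul_left ρ⁻¹).congr fun i => ?_
    rcases Nat.eq_zero_or_pos (N i) with h | h
    · simp [h]
    · obtain ⟨k, hk⟩ := Nat.exists_eq_succ_of_ne_zero h.ne'
      rw [hk, Nat.succ_eq_add_one, Nat.add_sub_cancel, pow_succ]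
      field_simp
  refine ⟨∑' i, c i * (N i * t ^ (N i - 1)), ?_, ?_⟩
  · refine hasDerivAt_tsum_of_isPreconnected (g := fun i t => c i * t ^ N i)
      (g' := fun i t => c i * (N i * t ^ (N i - 1))) hu (t := Metric.ball 0 ρ) Metric.isOpen_ball
      (convex_ball 0 ρ).isPreconnected (fun i y _ => (hasDerivAt_pow (N i) y).const_mul (c i))
      (fun i y hy => ?_) (y₀ := t) (by simpa using ht) ?_ (by simpa using ht)
    · have hy' : ‖y‖ < ρ := by simpa using hy
      rw [show c i * (N i * y ^ (N i - 1)) = N i * c i * y ^ (N i - 1) by ring, norm_mul, norm_pow]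
      gcongr
    · refine Summable.of_norm (h₀.of_nonneg_of_le (fun i => norm_nonneg _) fun i => ?_)
      rw [norm_mul, norm_pow]
      gcongr
  · rw [← tsum_mul_left]
    refine tsum_congr fun i => ?_
    rcases Nat.eq_zero_or_pos (N i) with h | h
    · simp [h]
    · obtain ⟨k, hk⟩ := Nat.exists_eq_succ_of_ne_zero h.ne'
      rw [hk, Nat.succ_eq_add_one, Nat.add_sub_cancel, pow_succ]
      ring

/-- The two-variable generating series of the weights of two-vertex graphs. -/
noncomputable def annulusSeries (r : ℕ) (x₁ x₂ : ℂ) : ℂ :=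
  ∑' p : ℕ × ℕ, (annulusWeight r p.1 p.2 : ℂ) * (x₁ ^ p.1 * x₂ ^ p.2)

variable {r : ℕ}

theorem hasDerivAt_annulusSeries_fst (hr : 1 ≤ r) {x₁ x₂ : ℂ} (h₁ : ‖x₁‖ < Real.exp (-1))
    (h₂ : ‖x₂‖ < Real.exp (-1)) :
    ∃ D, HasDerivAt (fun t => annulusSeries r t x₂) D x₁ ∧ x₁ * D =
      ∑' p : ℕ × ℕ, (p.1 * annulusWeight r p.1 p.2 : ℂ) * (x₁ ^ p.1 * x₂ ^ p.2) := by
  obtain ⟨ρ, hρ, hρ'⟩ := exists_between h₁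
  have hρ0 : 0 ≤ ρ := (norm_nonneg x₁).trans hρ.le
  have hb := (expBounded_add_mul_annulusWeight hr).mono
    (c' := fun p => (p.1 * annulusWeight r p.1 p.2 : ℂ))
    fun p => norm_annulusWeight_mul_le (Nat.le_add_right _ _)
  obtain ⟨D, hD, hD'⟩ := hasDerivAt_tsum_mul_pow (ι := ℕ × ℕ) (N := Prod.fst) (ρ := ρ) (t := x₁)
    (c := fun p => (annulusWeight r p.1 p.2 : ℂ) * x₂ ^ p.2)
    (((expBounded_annulusWeight hr).summable_norm hρ0 (norm_nonneg x₂) hρ' h₂).congr fun p => by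
      rw [norm_mul, norm_pow]; ring)
    ((hb.summable_norm hρ0 (norm_nonneg x₂) hρ' h₂).congr fun p => by
      rw [norm_mul, norm_mul, norm_mul, norm_pow]; ring) hρ
  refine ⟨D, ?_, ?_⟩
  · convert hD using 2 with t
    rw [annulusSeries]
    refine tsum_congr fun p => ?_
    ring
  · rw [hD']
    refine tsum_congr fun p => ?_
    ring

theorem annulusWeight_comm (r m n : ℕ) : annulusWeight r m n = annulusWeight r n m := by
  unfold annulusWeight
  by_cases h : r ∣ m + n
  · have hiff : r ∣ m ↔ r ∣ n :=
      ⟨fun h' => (Nat.dvd_add_right h').1 h, fun h' => (Nat.dvd_add_left h').1 h⟩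
    rw [add_comm n m, add_comm (n : ℚ), if_congr hiff rfl rfl]
    refine if_congr (by tauto) ?_ rfl
    ring
  · rw [if_neg (fun h' => h h'.1), if_neg (fun h' => h (add_comm n m ▸ h'.1))]

theorem annulusSeries_comm (r : ℕ) (x₁ x₂ : ℂ) : annulusSeries r x₁ x₂ = annulusSeries r x₂ x₁ := by
  rw [annulusSeries, annulusSeries, ← (Equiv.prodComm ℕ ℕ).tsum_eq]
  refine tsum_congr fun p => ?_
  simp only [Equiv.prodComm_apply, Prod.fst_swap, Prod.snd_swap]
  rw [annulusWeight_comm, mul_comm (x₁ ^ _)]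

theorem hasDerivAt_annulusSeries_snd (hr : 1 ≤ r) {x₁ x₂ : ℂ} (h₁ : ‖x₁‖ < Real.exp (-1))
    (h₂ : ‖x₂‖ < Real.exp (-1)) :
    ∃ D, HasDerivAt (fun t => annulusSeries r x₁ t) D x₂ ∧ x₂ * D =
      ∑' p : ℕ × ℕ, (p.2 * annulusWeight r p.1 p.2 : ℂ) * (x₁ ^ p.1 * x₂ ^ p.2) := by
  obtain ⟨D, hD, hD'⟩ := hasDerivAt_annulusSeries_fst hr h₂ h₁
  refine ⟨D, ?_, ?_⟩
  · simpa only [annulusSeries_comm r x₁] using hD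
  · rw [hD', ← (Equiv.prodComm ℕ ℕ).tsum_eq]
    refine tsum_congr fun p => ?_
    simp only [Equiv.prodComm_apply, Prod.fst_swap, Prod.snd_swap]
    rw [annulusWeight_comm, mul_comm (x₁ ^ _)]

/-- Along a complex line through the origin, `t d/dt` multiplies the term of index `(m, n)` by `m +
n`. -/
theorem hasDerivAt_annulusSeries_scale (hr : 1 ≤ r) {x₁ x₂ : ℂ} {R : ℝ}
    (h₁ : R * ‖x₁‖ < Real.exp (-1)) (h₂ : R * ‖x₂‖ < Real.exp (-1)) {t : ℂ} (ht : ‖t‖ < R) :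
    ∃ D, HasDerivAt (fun t => annulusSeries r (t * x₁) (t * x₂)) D t ∧ t * D =
      ∑' p : ℕ × ℕ, ((p.1 + p.2) * annulusWeight r p.1 p.2 : ℂ) *
        ((t * x₁) ^ p.1 * (t * x₂) ^ p.2) := by
  have hR : 0 ≤ R := (norm_nonneg t).trans ht.le
  obtain ⟨D, hD, hD'⟩ := hasDerivAt_tsum_mul_pow (ι := ℕ × ℕ) (N := fun p => p.1 + p.2) (ρ := R)
    (t := t) (c := fun p => (annulusWeight r p.1 p.2 : ℂ) * (x₁ ^ p.1 * x₂ ^ p.2))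
    (((expBounded_annulusWeight hr).summable_norm (by positivity) (by positivity) h₁ h₂).congr
      fun p => by rw [norm_mul, norm_mul, norm_pow, norm_pow]; ring)
    (((expBounded_add_mul_annulusWeight hr).summable_norm (by positivity) (by positivity)
      h₁ h₂).congr fun p => by
      push_cast
      rw [norm_mul, norm_mul, norm_mul, norm_mul, norm_pow, norm_pow]; ring) ht
  refine ⟨D, ?_, ?_⟩
  · convert hD using 2 with t
    rw [annulusSeries]
    refine tsum_congr fun p => ?_
    ring
  · rw [hD']
    refine tsum_congr fun p => ?_
    push_cast
    ring

theorem continuousOn_annulusSeries (hr : 1 ≤ r) {ρ : ℝ} (hρ : 0 ≤ ρ) (hρ' : ρ < Real.exp (-1)) :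
    ContinuousOn (fun x : ℂ × ℂ => annulusSeries r x.1 x.2)
      (Metric.closedBall 0 ρ ×ˢ Metric.closedBall 0 ρ) := by
  refine continuousOn_tsum (fun p => by fun_prop)
    ((expBounded_annulusWeight hr).summable_norm hρ hρ hρ' hρ') fun p x hx => ?_
  have h1 : ‖x.1‖ ≤ ρ := by simpa using hx.1
  have h2 : ‖x.2‖ ≤ ρ := by simpa using hx.2
  rw [norm_mul, norm_mul, norm_pow, norm_pow]
  gcongr

end AnnulusSeries

/-! ### The logarithmic formula and its Euler derivative. -/

section LogFormula

open Filter

/-- The divided difference of `spectralX r`. -/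
noncomputable def spectralDivDiff (r : ℕ) (p : ℂ × ℂ) : ℂ :=
  exp (-p.1 ^ r) - p.2 * exp (-p.2 ^ r) * dslope exp 0 (p.2 ^ r - p.1 ^ r) *
    ∑ i ∈ Finset.range r, p.1 ^ i * p.2 ^ (r - 1 - i)

/-- Writing `(e^w - 1) / w` as a `dslope` and `(z₁^r - z₂^r) / (z₁ - z₂)` as a geometric sum makes
the quotient analytic across the diagonal. -/
theorem sub_mul_spectralDivDiff (r : ℕ) (p : ℂ × ℂ) :
    (p.1 - p.2) * spectralDivDiff r p = spectralX r p.1 - spectralX r p.2 := by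
  have h1 := sub_smul_dslope exp 0 (p.2 ^ r - p.1 ^ r)
  have h2 := geom_sum₂_mul p.1 p.2 r
  have h3 : exp (-p.1 ^ r) = exp (-p.2 ^ r) * exp (p.2 ^ r - p.1 ^ r) := by
    rw [← Complex.exp_add]; congr 1; ring
  rw [sub_zero, Complex.exp_zero, smul_eq_mul] at h1
  simp only [spectralDivDiff, spectralX]
  linear_combination (-p.2 * exp (-p.2 ^ r) * dslope exp 0 (p.2 ^ r - p.1 ^ r)) * h2 +
    p.2 * exp (-p.2 ^ r) * h1 - p.2 * h3

theorem sum_range_pow_mul_pow_self {r : ℕ} (z : ℂ) :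
    ∑ i ∈ Finset.range r, z ^ i * z ^ (r - 1 - i) = r * z ^ (r - 1) := by
  rw [Finset.sum_congr rfl (g := fun _ => z ^ (r - 1)), Finset.sum_const, nsmul_eq_mul,
    Finset.card_range]
  intro i hi
  rw [Finset.mem_range] at hi
  rw [← pow_add]; congr 1; omega

theorem spectralDivDiff_self (r : ℕ) (z : ℂ) :
    spectralDivDiff r (z, z) = exp (-z ^ r) * (1 - r * z ^ r) := by
  have h : dslope exp 0 (0 : ℂ) = 1 := by
    rw [dslope_same, Complex.deriv_exp, Complex.exp_zero]
  simp only [spectralDivDiff, sub_self, h, sum_range_pow_mul_pow_self]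
  rcases Nat.eq_zero_or_pos r with rfl | hr
  · simp
  · have : z ^ r = z * z ^ (r - 1) := by rw [← pow_succ', Nat.sub_add_cancel hr]
    linear_combination (r * exp (-z ^ r)) * this

theorem analyticAt_spectralDivDiff (r : ℕ) (p : ℂ × ℂ) : AnalyticAt ℂ (spectralDivDiff r) p := by
  have h1 : Differentiable ℂ (dslope exp (0 : ℂ)) := by
    rw [← differentiableOn_univ, Complex.differentiableOn_dslope univ_mem]
    exact Complex.differentiable_exp.differentiableOn
  have h2 : AnalyticAt ℂ (fun p : ℂ × ℂ => dslope exp 0 (p.2 ^ r - p.1 ^ r)) p :=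
    (h1.analyticAt _).fun_comp ((analyticAt_snd.fun_pow r).fun_sub (analyticAt_fst.fun_pow r))
  have h3 : AnalyticAt ℂ (fun p : ℂ × ℂ => p.1) p := analyticAt_fst
  have h4 : AnalyticAt ℂ (fun p : ℂ × ℂ => p.2) p := analyticAt_snd
  exact (h3.fun_pow r).fun_neg.cexp.fun_sub (((h4.fun_mul (h4.fun_pow r).fun_neg.cexp).fun_mul h2).fun_mul
    (Finset.analyticAt_fun_sum _ fun i _ => (h3.fun_pow i).fun_mul (h4.fun_pow (r - 1 - i))))

theorem spectralDivDiff_zero {r : ℕ} (hr : 1 ≤ r) : spectralDivDiff r 0 = 1 := by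
  have := spectralDivDiff_self r 0
  rw [← Prod.mk_zero_zero]
  simpa [zero_pow (by omega : r ≠ 0)] using this

theorem deriv_spectralX (r : ℕ) (z : ℂ) :
    deriv (spectralX r) z = exp (-z ^ r) * (1 - r * z ^ r) :=
  (hasStrictDerivAt_spectralX r z).hasDerivAt.deriv

theorem diffQuot_id_spectralX (r : ℕ) (z₁ z₂ : ℂ) :
    diffQuot (fun t => t) (spectralX r) z₁ z₂ = (spectralDivDiff r (z₁, z₂))⁻¹ := by
  rw [diffQuot]
  split_ifs with h
  · subst h
    rw [deriv_spectralX, spectralDivDiff_self, deriv_id'', one_div]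
  · have h1 := sub_mul_spectralDivDiff r (z₁, z₂)
    have h2 : z₁ - z₂ ≠ 0 := sub_ne_zero.2 h
    simp only at h1
    rw [← h1, div_mul_cancel_left₀ h2]

/-- Split `x₁ z₁^r - x₂ z₂^r = (x₁ - x₂) z₁^r + x₂ (z₁^r - z₂^r)`. The result is visibly continuous
across the diagonal. -/
theorem diffQuot_mul_spectralX {r : ℕ} {z₁ z₂ : ℂ}
    (h : spectralDivDiff r (z₁, z₂) ≠ 0) :
    diffQuot (fun t => spectralX r t * t ^ r) (spectralX r) z₁ z₂ =
      z₁ ^ r + spectralX r z₂ * (∑ i ∈ Finset.range r, z₁ ^ i * z₂ ^ (r - 1 - i)) /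
        spectralDivDiff r (z₁, z₂) := by
  rw [diffQuot]
  split_ifs with heq
  · subst heq
    have h1 := (hasStrictDerivAt_spectralX r z₁).hasDerivAt.mul (hasDerivAt_pow r z₁)
    rw [sum_range_pow_mul_pow_self, deriv_spectralX, ← spectralDivDiff_self]
    rw [← spectralDivDiff_self] at h1
    have h2 : deriv (fun t => spectralX r t * t ^ r) z₁ = _ := h1.deriv
    rw [h2]
    field_simp
  · have h1 := sub_mul_spectralDivDiff r (z₁, z₂)
    have h2 : z₁ - z₂ ≠ 0 := sub_ne_zero.2 heq
    have h3 := geom_sum₂_mul z₁ z₂ r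
    simp only at h1
    rw [← h1]
    field_simp
    linear_combination (-spectralX r z₂) * h3 - z₁ ^ r * h1

/-- The closed formula for the free energy. -/
noncomputable def logForm (r : ℕ) (p : ℂ × ℂ) : ℂ :=
  log (spectralDivDiff r p)⁻¹ - (p.1 ^ r + p.2 ^ r)

theorem eventually_mem_slitPlane {r : ℕ} (hr : 1 ≤ r) :
    ∀ᶠ p : ℂ × ℂ in 𝓝 0, spectralDivDiff r p ≠ 0 ∧ (spectralDivDiff r p)⁻¹ ∈ slitPlane := by
  have h1 : ContinuousAt (spectralDivDiff r) 0 := (analyticAt_spectralDivDiff r 0).continuousAt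
  have h0 : spectralDivDiff r 0 ≠ 0 := by rw [spectralDivDiff_zero hr]; exact one_ne_zero
  refine (h1.eventually_ne h0).and
    ((h1.inv₀ h0).eventually_mem (isOpen_slitPlane.mem_nhds ?_))
  rw [Pi.inv_apply, spectralDivDiff_zero hr, inv_one]
  exact one_mem_slitPlane

theorem analyticAt_logForm {r : ℕ} {p : ℂ × ℂ} (h : spectralDivDiff r p ≠ 0)
    (h' : (spectralDivDiff r p)⁻¹ ∈ slitPlane) : AnalyticAt ℂ (logForm r) p :=
  (((analyticAt_spectralDivDiff r p).inv h).clog h').sub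
    ((analyticAt_fst.fun_pow r).fun_add (analyticAt_snd.fun_pow r))

theorem logForm_zero {r : ℕ} (hr : 1 ≤ r) : logForm r 0 = 0 := by
  simp [logForm, spectralDivDiff_zero hr, zero_pow (by omega : r ≠ 0)]

theorem spectralDivDiff_inv_eq {r : ℕ} {p : ℂ × ℂ} (h : p.1 ≠ p.2) :
    (spectralDivDiff r p)⁻¹ = (p.1 - p.2) / (spectralX r p.1 - spectralX r p.2) := by
  rw [← sub_mul_spectralDivDiff, div_mul_cancel_left₀ (sub_ne_zero.2 h)]

theorem exists_spectralX_inverse {r : ℕ} (hr : 1 ≤ r) :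
    ∃ ζ : ℂ → ℂ, ζ 0 = 0 ∧ (∀ᶠ z in 𝓝 0, ζ (spectralX r z) = z) ∧ ∀ᶠ s in 𝓝 0, spectralX r (ζ s) = s ∧
      HasDerivAt ζ (exp (-ζ s ^ r) * (1 - r * ζ s ^ r))⁻¹ s := by
  have hd := hasStrictDerivAt_spectralX r 0
  have hne : exp (-(0 : ℂ) ^ r) * (1 - r * (0 : ℂ) ^ r) ≠ 0 := by simp [zero_pow (by omega : r ≠ 0)]
  set ζ := hd.localInverse _ _ _ hne with hζ
  have h0 : ζ 0 = 0 := by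
    have := HasStrictFDerivAt.localInverse_apply_image (hd.hasStrictFDerivAt_equiv hne)
    rw [spectralX_zero] at this
    exact this
  have hright : ∀ᶠ s in 𝓝 0, spectralX r (ζ s) = s := by
    have := HasStrictFDerivAt.eventually_right_inverse (hd.hasStrictFDerivAt_equiv hne)
    rwa [spectralX_zero] at this
  have hstrict := hd.to_localInverse hne
  rw [spectralX_zero] at hstrict
  -- Strict differentiability at `0` gives a Lipschitz bound nearby, hence continuity at all points
  -- near `0`, as needed to differentiate the inverse there.
  have hcont : ∀ᶠ s in 𝓝 0, ContinuousAt ζ s := by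
    obtain ⟨K, S, hS, hK⟩ := hstrict.hasStrictFDerivAt.exists_lipschitzOnWith
    filter_upwards [eventually_eventually_nhds.2 hS] with s hs
    exact hK.continuousOn.continuousAt hs
  have hne' : ∀ᶠ s in 𝓝 0, 1 - r * ζ s ^ r ≠ 0 := by
    have : Tendsto ζ (𝓝 0) (𝓝 0) := by
      have := hcont.self_of_nhds.tendsto
      rwa [h0] at this
    exact this.eventually (eventually_one_sub_mul_pow_ne_zero hr)
  refine ⟨ζ, h0, (hd.hasStrictFDerivAt_equiv hne).eventually_left_inverse, ?_⟩
  filter_upwards [hright, hcont, hne', eventually_eventually_nhds.2 hright] with s h1 h2 h3 h4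
  exact ⟨h1, HasDerivAt.of_local_left_inverse h2 (hasStrictDerivAt_spectralX r _).hasDerivAt
    (mul_ne_zero (exp_ne_zero _) h3) h4⟩

theorem sum_Ico_pow_mul_sub {r : ℕ} (hr : 1 ≤ r) (z₁ z₂ : ℂ) :
    (∑ i ∈ Finset.Ico 1 r, z₁ ^ i * z₂ ^ (r - i)) * (z₁ - z₂) = z₁ ^ r * z₂ - z₁ * z₂ ^ r := by
  obtain ⟨k, rfl⟩ := Nat.exists_eq_succ_of_ne_zero (by omega : r ≠ 0)
  have h1 : ∑ i ∈ Finset.Ico 1 k.succ, z₁ ^ i * z₂ ^ (k.succ - i) =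
      z₁ * z₂ * ∑ i ∈ Finset.range k, z₁ ^ i * z₂ ^ (k - 1 - i) := by
    rw [Finset.sum_Ico_eq_sum_range, Finset.mul_sum]
    refine Finset.sum_congr rfl fun i hi => ?_
    rw [Finset.mem_range] at hi
    replace hi : i < k := by omega
    rw [show k.succ - (1 + i) = (k - 1 - i) + 1 by omega, add_comm 1 i]
    ring
  rw [h1, mul_assoc, geom_sum₂_mul, Nat.succ_eq_add_one]
  ring

theorem eventually_fst {P : ℂ → Prop} (h : ∀ᶠ z in 𝓝 0, P z) : ∀ᶠ p : ℂ × ℂ in 𝓝 0, P p.1 :=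
  (continuous_fst.tendsto' (0 : ℂ × ℂ) 0 rfl).eventually h

theorem eventually_snd {P : ℂ → Prop} (h : ∀ᶠ z in 𝓝 0, P z) : ∀ᶠ p : ℂ × ℂ in 𝓝 0, P p.2 :=
  (continuous_snd.tendsto' (0 : ℂ × ℂ) 0 rfl).eventually h

/-- The left side is the sum of the differentiated series; the right side is what `x₁ ∂/∂x₁ + x₂
∂/∂x₂` makes of the logarithmic formula, since `x dz/dx = z / (1 - r z^r)`. -/
theorem euler_logForm_eq {r : ℕ} (hr : 1 ≤ r) {z₁ z₂ : ℂ} (h : z₁ ≠ z₂) (h₁ : 1 - r * z₁ ^ r ≠ 0)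
    (h₂ : 1 - r * z₂ ^ r ≠ 0) :
    (1 / (1 - r * z₁ ^ r) - 1) * (1 / (1 - r * z₂ ^ r) - 1) +
        r * ∑ i ∈ Finset.Ico 1 r, z₁ ^ i / (1 - r * z₁ ^ r) * (z₂ ^ (r - i) / (1 - r * z₂ ^ r)) =
      (z₁ / (1 - r * z₁ ^ r) - z₂ / (1 - r * z₂ ^ r)) / (z₁ - z₂) - 1 -
        (r * z₁ ^ r / (1 - r * z₁ ^ r) + r * z₂ ^ r / (1 - r * z₂ ^ r)) := by
  have h3 : z₁ - z₂ ≠ 0 := sub_ne_zero.2 h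
  have h4 := sum_Ico_pow_mul_sub hr z₁ z₂
  have h5 : ∑ i ∈ Finset.Ico 1 r, z₁ ^ i / (1 - r * z₁ ^ r) * (z₂ ^ (r - i) / (1 - r * z₂ ^ r)) =
      (∑ i ∈ Finset.Ico 1 r, z₁ ^ i * z₂ ^ (r - i)) / ((1 - r * z₁ ^ r) * (1 - r * z₂ ^ r)) := by
    rw [Finset.sum_div]
    refine Finset.sum_congr rfl fun i _ => ?_
    field_simp
  rw [h5]
  generalize ∑ i ∈ Finset.Ico 1 r, z₁ ^ i * z₂ ^ (r - i) = T at h4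
  field_simp
  linear_combination (r : ℂ) * h4

theorem hasDerivAt_logForm_scale {r : ℕ} (hr : 1 ≤ r) {ζ : ℂ → ℂ} {x₁ x₂ t : ℂ} (hx : x₁ ≠ x₂)
    (ht : t ≠ 0) (h₁ : ∀ᶠ s in 𝓝 (t * x₁), spectralX r (ζ s) = s)
    (h₂ : ∀ᶠ s in 𝓝 (t * x₂), spectralX r (ζ s) = s)
    (hd₁ : HasDerivAt ζ (exp (-ζ (t * x₁) ^ r) * (1 - r * ζ (t * x₁) ^ r))⁻¹ (t * x₁))
    (hd₂ : HasDerivAt ζ (exp (-ζ (t * x₂) ^ r) * (1 - r * ζ (t * x₂) ^ r))⁻¹ (t * x₂))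
    (hne₁ : 1 - r * ζ (t * x₁) ^ r ≠ 0) (hne₂ : 1 - r * ζ (t * x₂) ^ r ≠ 0)
    (hslit : (spectralDivDiff r (ζ (t * x₁), ζ (t * x₂)))⁻¹ ∈ slitPlane) :
    ∃ D, HasDerivAt (fun t => logForm r (ζ (t * x₁), ζ (t * x₂))) D t ∧
      t * D = (1 / (1 - r * ζ (t * x₁) ^ r) - 1) * (1 / (1 - r * ζ (t * x₂) ^ r) - 1) +
        r * ∑ i ∈ Finset.Ico 1 r, ζ (t * x₁) ^ i / (1 - r * ζ (t * x₁) ^ r) *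
          (ζ (t * x₂) ^ (r - i) / (1 - r * ζ (t * x₂) ^ r)) := by
  have hζ : ∀ {s}, t ≠ 0 → spectralX r (ζ (s * x₁)) = s * x₁ → spectralX r (ζ (s * x₂)) = s * x₂ →
      s ≠ 0 → ζ (s * x₁) ≠ ζ (s * x₂) := by
    intro s _ e1 e2 hs h
    rw [h, e2] at e1
    exact hx (mul_left_cancel₀ hs e1).symm
  have hc₁ : Tendsto (fun t => t * x₁) (𝓝 t) (𝓝 (t * x₁)) := by
    exact (continuous_mul_const x₁).tendsto t
  have hc₂ : Tendsto (fun t => t * x₂) (𝓝 t) (𝓝 (t * x₂)) := by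
    exact (continuous_mul_const x₂).tendsto t
  have hev : (fun t => logForm r (ζ (t * x₁), ζ (t * x₂))) =ᶠ[𝓝 t] fun t =>
      log ((ζ (t * x₁) - ζ (t * x₂)) / (t * x₁ - t * x₂)) -
        (ζ (t * x₁) ^ r + ζ (t * x₂) ^ r) := by
    filter_upwards [hc₁.eventually h₁, hc₂.eventually h₂, eventually_ne_nhds ht] with s e1 e2 hs
    rw [logForm, spectralDivDiff_inv_eq (hζ ht e1 e2 hs), e1, e2]
  have e1 := h₁.self_of_nhds
  have e2 := h₂.self_of_nhds
  have hne := hζ ht e1 e2 ht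
  rw [spectralDivDiff_inv_eq hne] at hslit
  simp only [e1, e2] at hslit
  have hx' : t * x₁ - t * x₂ ≠ 0 := by
    rw [← mul_sub]; exact mul_ne_zero ht (sub_ne_zero.2 hx)
  have hd₁' : HasDerivAt (fun t => ζ (t * x₁)) _ t := hd₁.comp t (hasDerivAt_mul_const x₁)
  have hd₂' : HasDerivAt (fun t => ζ (t * x₂)) _ t := hd₂.comp t (hasDerivAt_mul_const x₂)
  have hD := (((hd₁'.sub hd₂').div ((hasDerivAt_mul_const x₁).sub (hasDerivAt_mul_const x₂))
    hx').clog hslit).sub ((hd₁'.pow r).add (hd₂'.pow r))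
  refine ⟨_, HasDerivAt.congr_of_eventuallyEq hD hev, ?_⟩
  rw [euler_logForm_eq hr hne hne₁ hne₂]
  have h3 : ζ (t * x₁) - ζ (t * x₂) ≠ 0 := sub_ne_zero.2 hne
  have hp : ∀ z : ℂ, z * z ^ (r - 1) = z ^ r := fun z => by
    rw [← pow_succ', Nat.sub_add_cancel hr]
  have k1 := hp (ζ (t * x₁))
  have k2 := hp (ζ (t * x₂))
  -- In the coordinate `z` the field `x d/dx` is `z / (1 - r z^r) d/dz`.
  have e : ∀ z x : ℂ, spectralX r z = t * x → 1 - r * z ^ r ≠ 0 →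
      t * ((exp (-z ^ r) * (1 - r * z ^ r))⁻¹ * x) = z / (1 - r * z ^ r) := by
    intro z x h hc
    have hE := exp_ne_zero (-z ^ r)
    rw [spectralX] at h
    generalize exp (-z ^ r) = E at *
    generalize 1 - r * z ^ r = c at *
    field_simp
    linear_combination -h
  have a1 := e _ _ e1 hne₁
  have a2 := e _ _ e2 hne₂
  change t * ((((_ - _) * (t * x₁ - t * x₂) - (ζ (t * x₁) - ζ (t * x₂)) * (x₁ - x₂)) /
    (t * x₁ - t * x₂) ^ 2) / ((ζ (t * x₁) - ζ (t * x₂)) / (t * x₁ - t * x₂)) -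
    (r * ζ (t * x₁) ^ (r - 1) * _ + r * ζ (t * x₂) ^ (r - 1) * _)) = _
  generalize (exp (-ζ (t * x₁) ^ r) * (1 - r * ζ (t * x₁) ^ r))⁻¹ * x₁ = A at a1 ⊢
  generalize (exp (-ζ (t * x₂) ^ r) * (1 - r * ζ (t * x₂) ^ r))⁻¹ * x₂ = B at a2 ⊢
  rw [mul_div_assoc, mul_div_assoc, ← a1, ← a2]
  have b1 : ζ (t * x₁) ^ r / (1 - r * ζ (t * x₁) ^ r) = ζ (t * x₁) ^ (r - 1) * (t * A) := by
    rw [a1, ← mul_div_assoc, mul_comm _ (ζ (t * x₁)), k1]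
  have b2 : ζ (t * x₂) ^ r / (1 - r * ζ (t * x₂) ^ r) = ζ (t * x₂) ^ (r - 1) * (t * B) := by
    rw [a2, ← mul_div_assoc, mul_comm _ (ζ (t * x₂)), k2]
  rw [b1, b2]
  generalize ζ (t * x₁) - ζ (t * x₂) = N at h3 ⊢
  rw [← mul_sub] at hx' ⊢
  have hx'' : x₁ - x₂ ≠ 0 := sub_ne_zero.2 hx
  generalize x₁ - x₂ = X at *
  field_simp

end LogFormula

/-! ### Proof of the closed formula. -/

section ClosedFormula

open Filter

theorem eventually_eq_of_off_diagonal {f g : ℂ × ℂ → ℂ} (hf : ∀ᶠ p in 𝓝 0, ContinuousAt f p)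
    (hg : ∀ᶠ p in 𝓝 0, ContinuousAt g p) (h : ∀ᶠ p : ℂ × ℂ in 𝓝 0, p.1 ≠ p.2 → f p = g p) :
    ∀ᶠ p in 𝓝 0, f p = g p := by
  filter_upwards [hf, hg, h, eventually_eventually_nhds.2 h] with p hfp hgp hp hev
  by_cases hne : p.1 = p.2
  · have ht : Tendsto (fun t : ℂ => (p.1 + t, p.2)) (𝓝[≠] 0) (𝓝 p) :=
      tendsto_nhdsWithin_of_tendsto_nhds
        (Continuous.tendsto' (by fun_prop) 0 p (by simp))
    refine tendsto_nhds_unique (hfp.tendsto.comp ht) ((hgp.tendsto.comp ht).congr' ?_)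
    filter_upwards [ht.eventually hev, self_mem_nhdsWithin] with t h1 h2
    exact (h1 fun h3 => h2 (by simpa [hne] using h3)).symm
  · exact hp hne

/-- The point `0` is left to continuity because Euler identities determine `t * D`, hence `D` only
for `t ≠ 0`. The radius `2` makes `1` an interior point. -/
theorem eq_of_hasDerivAt_zero {G : ℂ → ℂ} (hG : ContinuousAt G 0)
    (hderiv : ∀ t : ℂ, t ≠ 0 → ‖t‖ < 2 → HasDerivAt G 0 t) : G 1 = G 0 := by
  have hderiv' : ∀ t : ℝ, t ∈ Set.Ioo (0 : ℝ) 2 → HasDerivAt (fun t : ℝ => G t) 0 t := by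
    intro t ht
    refine (hderiv t (by exact_mod_cast ht.1.ne') ?_).comp_ofReal
    rw [Complex.norm_real, Real.norm_of_nonneg ht.1.le]; exact ht.2
  have hconst : ∀ t ∈ Set.Ioo (0 : ℝ) 2, G t = G 1 := by
    intro t ht
    have := isOpen_Ioo.is_const_of_deriv_eq_zero (isPreconnected_Ioo)
      (fun s hs => (hderiv' s hs).differentiableAt.differentiableWithinAt)
      (fun s hs => (hderiv' s hs).deriv) ht (by norm_num : (1 : ℝ) ∈ Set.Ioo (0 : ℝ) 2)
    simpa using this
  have hlim : Tendsto (fun t : ℝ => G t) (𝓝[>] 0) (𝓝 (G 0)) := by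
    refine (hG.tendsto.comp ?_).mono_left nhdsWithin_le_nhds
    exact Complex.continuous_ofReal.tendsto' 0 0 (by simp)
  have hlim' : Tendsto (fun t : ℝ => G t) (𝓝[>] 0) (𝓝 (G 1)) := by
    refine tendsto_const_nhds.congr' ?_
    filter_upwards [Ioo_mem_nhdsGT (zero_lt_two (α := ℝ))] with t ht
    exact (hconst t ht).symm
  exact tendsto_nhds_unique hlim' hlim

/-- The derivative of `t ↦ f (t • p)`, multiplied by `t`, is the radial derivative at `t • p`; so
`f` is constant on complex lines through the origin. -/
theorem AnalyticAt.eventually_eq_of_radial_deriv_eq_zero {E : Type*} [NormedAddCommGroup E]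
    [NormedSpace ℂ E] {f : E → ℂ} (hf : AnalyticAt ℂ f 0)
    (h : ∀ᶠ p in 𝓝 0, fderiv ℂ f p p = 0) : ∀ᶠ p in 𝓝 0, f p = f 0 := by
  obtain ⟨δ, hδ, hball⟩ := Metric.eventually_nhds_iff.1 (hf.eventually_analyticAt.and h)
  filter_upwards [Metric.ball_mem_nhds (0 : E) (half_pos hδ)] with p hp
  rw [mem_ball_zero_iff] at hp
  have hmem : ∀ t : ℂ, ‖t‖ < 2 → dist (t • p) 0 < δ := by
    intro t ht
    rw [dist_zero_right, norm_smul]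
    nlinarith [norm_nonneg p]
  have hline : ∀ t : ℂ, HasDerivAt (fun t : ℂ => t • p) p t := fun t => by
    simpa using (hasDerivAt_id t).smul_const p
  have hd : ∀ t : ℂ, ‖t‖ < 2 → HasDerivAt (fun t : ℂ => f (t • p)) (fderiv ℂ f (t • p) p) t :=
    fun t ht => (hball (hmem t ht)).1.differentiableAt.hasFDerivAt.comp_hasDerivAt t (hline t)
  have := eq_of_hasDerivAt_zero (hd 0 (by simp)).continuousAt fun t ht0 ht => by
    have h0 := (hball (hmem t ht)).2
    rw [map_smul, smul_eq_zero] at h0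
    have h1 := hd t ht
    rwa [h0.resolve_left ht0] at h1
  simpa using this

variable {r : ℕ}

theorem continuousAt_annulusSeries (hr : 1 ≤ r) {x : ℂ × ℂ} (h₁ : ‖x.1‖ < Real.exp (-1))
    (h₂ : ‖x.2‖ < Real.exp (-1)) : ContinuousAt (fun x : ℂ × ℂ => annulusSeries r x.1 x.2) x := by
  obtain ⟨ρ, hρ, hρ'⟩ := exists_between (max_lt h₁ h₂)
  have h := (norm_nonneg x.1).trans ((le_max_left _ _).trans hρ.le)
  refine (continuousOn_annulusSeries hr h hρ').continuousAt (prod_mem_nhds ?_ ?_) <;>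
  · refine Filter.mem_of_superset (Metric.isOpen_ball.mem_nhds ?_) Metric.ball_subset_closedBall
    rw [mem_ball_zero_iff]
    exact (by simp : _ ≤ max ‖x.1‖ ‖x.2‖).trans_lt hρ

theorem annulusSeries_zero_left (r : ℕ) (x : ℂ) : annulusSeries r 0 x = 0 := by
  refine (tsum_congr fun p => ?_).trans tsum_zero
  rcases Nat.eq_zero_or_pos p.1 with h | h
  · rw [annulusWeight, if_neg (by simp [h])]; simp
  · rw [zero_pow h.ne']; simp

theorem eventually_norm_spectralX_lt (hr : 1 ≤ r) {ρ : ℝ} (hρ : 0 < ρ) :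
    ∀ᶠ z in 𝓝 0, ‖spectralX r z‖ < ρ := by
  have h : Tendsto (spectralX r) (𝓝 0) (𝓝 0) := (map_spectralX_nhds hr).le
  exact h.norm.eventually_lt_const (by simpa using hρ)

/-- In the coordinates `x₁ ≠ x₂` both sides have the same derivative in `t` along `t ↦ (t x₁, t x₂)`
and vanish at `t = 0`. The diagonal follows by continuity. -/
theorem annulusSeries_eq_logForm (hr : 1 ≤ r) :
    ∀ᶠ p : ℂ × ℂ in 𝓝 0, annulusSeries r (spectralX r p.1) (spectralX r p.2) = logForm r p := by
  obtain ⟨ζ, hζ0, hleft, hζ⟩ := exists_spectralX_inverse hr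
  have hζc : ContinuousAt ζ 0 := hζ.self_of_nhds.2.continuousAt
  have hζt : Tendsto ζ (𝓝 0) (𝓝 0) := by simpa [ContinuousAt, hζ0] using hζc
  have he : (0 : ℝ) < Real.exp (-1) / 2 := by positivity
  have hsingle : ∀ᶠ s in 𝓝 0, (∀ᶠ s' in 𝓝 s, spectralX r (ζ s') = s') ∧
      HasDerivAt ζ (exp (-ζ s ^ r) * (1 - r * ζ s ^ r))⁻¹ s ∧ 1 - r * ζ s ^ r ≠ 0 ∧
      Real.exp r * ‖ζ s ^ r‖ * Real.exp (r * ‖ζ s ^ r‖) < 1 := by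
    filter_upwards [eventually_eventually_nhds.2 hζ,
      hζt.eventually (eventually_one_sub_mul_pow_ne_zero hr),
      hζt.eventually (eventually_exp_mul_lt_one hr)] with s h1 h2 h3
    exact ⟨h1.mono fun _ h => h.1, h1.self_of_nhds.2, h2, h3⟩
  have hpt : Tendsto (fun x : ℂ × ℂ => (ζ x.1, ζ x.2)) (𝓝 0) (𝓝 0) := by
    rw [← Prod.mk_zero_zero, nhds_prod_eq]
    exact hζt.prodMap hζt
  have hpair := (hpt.eventually (eventually_mem_slitPlane hr)).and
    ((eventually_fst hsingle).and (eventually_snd hsingle))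
  obtain ⟨δ, hδ, hball⟩ := Metric.eventually_nhds_iff.1 hpair
  have hx : ∀ᶠ x : ℂ × ℂ in 𝓝 0, x.1 ≠ x.2 →
      annulusSeries r x.1 x.2 = logForm r (ζ x.1, ζ x.2) := by
    filter_upwards [Metric.ball_mem_nhds (0 : ℂ × ℂ) (half_pos hδ),
      Metric.ball_mem_nhds (0 : ℂ × ℂ) he] with x hx hx' hne
    rw [mem_ball_zero_iff] at hx hx'
    have hn₁ : 2 * ‖x.1‖ < Real.exp (-1) := by have := norm_fst_le x; linarith
    have hn₂ : 2 * ‖x.2‖ < Real.exp (-1) := by have := norm_snd_le x; linarith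
    set G : ℂ → ℂ := fun t => annulusSeries r (t * x.1) (t * x.2) -
      logForm r (ζ (t * x.1), ζ (t * x.2)) with hG
    have hderiv : ∀ t : ℂ, t ≠ 0 → ‖t‖ < 2 → HasDerivAt G 0 t := by
      intro t ht0 ht
      have htx : dist (t * x.1, t * x.2) 0 < δ := by
        have : (t * x.1, t * x.2) = t • x := rfl
        rw [dist_zero_right, this, norm_smul]
        nlinarith [norm_nonneg x]
      obtain ⟨h1, ⟨h2, h3, h4, h5⟩, h6, h7, h8, h9⟩ := hball htx
      obtain ⟨D₁, hD₁, hD₁'⟩ := hasDerivAt_annulusSeries_scale hr hn₁ hn₂ ht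
      obtain ⟨D₂, hD₂, hD₂'⟩ := hasDerivAt_logForm_scale hr hne ht0 h2 h6 h3 h7 h4 h8 h1.2
      have hs := (hasSum_add_mul_annulusWeight hr h5 h9).tsum_eq
      simp only [h2.self_of_nhds, h6.self_of_nhds] at hs
      rw [hs, ← hD₂'] at hD₁'
      have := hD₁.sub hD₂
      rwa [mul_left_cancel₀ ht0 hD₁', sub_self] at this
    have hG0 : ContinuousAt G 0 := by
      have h1 : ContinuousAt (fun t : ℂ => (t * x.1, t * x.2)) 0 := by fun_prop
      have h2 : ContinuousAt (fun x : ℂ × ℂ => annulusSeries r x.1 x.2) (0 * x.1, 0 * x.2) :=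
        continuousAt_annulusSeries hr (by simp [Real.exp_pos]) (by simp [Real.exp_pos])
      have h3 : ContinuousAt (fun x : ℂ × ℂ => logForm r (ζ x.1, ζ x.2)) (0 * x.1, 0 * x.2) := by
        simp only [zero_mul, Prod.mk_zero_zero]
        have h0 := (eventually_mem_slitPlane hr).self_of_nhds
        have := (analyticAt_logForm h0.1 h0.2).continuousAt
        refine ContinuousAt.comp (f := fun x : ℂ × ℂ => (ζ x.1, ζ x.2)) (g := logForm r) ?_ ?_
        · simp only [Prod.fst_zero, Prod.snd_zero, hζ0]
          exact this
        · simp only [ContinuousAt, Prod.fst_zero, Prod.snd_zero, hζ0]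
          exact hpt
      exact (ContinuousAt.comp (f := fun t : ℂ => (t * x.1, t * x.2)) h2 h1).sub
        (ContinuousAt.comp (f := fun t : ℂ => (t * x.1, t * x.2)) h3 h1)
    have hG00 : G 0 = 0 := by
      simp only [hG, zero_mul, annulusSeries_zero_left, hζ0]
      rw [Prod.mk_zero_zero, logForm_zero hr, sub_zero]
    have := eq_of_hasDerivAt_zero hG0 hderiv
    rw [hG00] at this
    simpa [hG, sub_eq_zero] using this
  have hspec : Tendsto (spectralX r) (𝓝 0) (𝓝 0) := (map_spectralX_nhds hr).le
  have hspec₂ : Tendsto (fun p : ℂ × ℂ => (spectralX r p.1, spectralX r p.2)) (𝓝 0) (𝓝 0) := by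
    rw [← Prod.mk_zero_zero, nhds_prod_eq]
    exact hspec.prodMap hspec
  refine eventually_eq_of_off_diagonal ?_ ?_ ?_
  · have hn := eventually_norm_spectralX_lt hr (Real.exp_pos (-1))
    have hc : Continuous (spectralX r) := by unfold spectralX; fun_prop
    filter_upwards [eventually_fst hn, eventually_snd hn] with p h1 h2
    exact ContinuousAt.comp (f := fun p : ℂ × ℂ => (spectralX r p.1, spectralX r p.2))
      (g := fun x : ℂ × ℂ => annulusSeries r x.1 x.2)
      (continuousAt_annulusSeries hr h1 h2) (by fun_prop)
  · filter_upwards [eventually_mem_slitPlane hr] with p hp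
    exact (analyticAt_logForm hp.1 hp.2).continuousAt
  · filter_upwards [hspec₂.eventually hx, eventually_fst hleft, eventually_snd hleft]
      with p h1 h2 h3 hne
    rw [h2, h3] at h1
    exact h1 fun h => hne (by rw [← h2, h, h3])

end ClosedFormula

/-! ### From the closed formula to the recursion for two vertices. -/

section EdgeContraction

open Filter

variable {r : ℕ}

/-- Summing over `p.1 + p.2 = n` gives `(x₁^{n+1} - x₂^{n+1}) / (x₁ - x₂)` times the weight. -/
theorem hasSum_discWeight_add (hr : 1 ≤ r) {z₁ z₂ : ℂ}
    (hz₁ : Real.exp r * ‖z₁ ^ r‖ * Real.exp (r * ‖z₁ ^ r‖) < 1)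
    (hz₂ : Real.exp r * ‖z₂ ^ r‖ * Real.exp (r * ‖z₂ ^ r‖) < 1)
    (h₁ : ‖spectralX r z₁‖ < Real.exp (-1)) (h₂ : ‖spectralX r z₂‖ < Real.exp (-1))
    (hne : spectralX r z₁ ≠ spectralX r z₂) :
    HasSum (fun p : ℕ × ℕ => (discWeight r (p.1 + p.2) : ℂ) *
      (spectralX r z₁ ^ p.1 * spectralX r z₂ ^ p.2))
      ((spectralX r z₁ * z₁ ^ r - spectralX r z₂ * z₂ ^ r) /
        (spectralX r z₁ - spectralX r z₂)) := by
  have hb : ExpBounded fun p => (discWeight r (p.1 + p.2) : ℂ) := by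
    refine ⟨1, fun p => ?_⟩
    have := norm_discWeight_le r (p.1 + p.2)
    rwa [one_mul, ← Real.exp_add, ← Nat.cast_add]
  have hs := (hb.summable h₁ h₂).hasSum
  have e1 := hasSum_discWeight hr hz₁
  have e2 := hasSum_discWeight hr hz₂
  generalize spectralX r z₁ = x₁ at *
  generalize spectralX r z₂ = x₂ at *
  have hd : x₁ - x₂ ≠ 0 := sub_ne_zero.2 hne
  generalize ∑' p : ℕ × ℕ, (discWeight r (p.1 + p.2) : ℂ) * (x₁ ^ p.1 * x₂ ^ p.2) = S at hs
  suffices S = (x₁ * z₁ ^ r - x₂ * z₂ ^ r) / (x₁ - x₂) by rwa [this] at hs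
  rw [eq_div_iff hd]
  have h3 : HasSum (fun n : ℕ => ∑ p ∈ Finset.HasAntidiagonal.antidiagonal n,
      (discWeight r (p.1 + p.2) : ℂ) * (x₁ ^ p.1 * x₂ ^ p.2)) S := by
    refine (Finset.HasAntidiagonal.sigmaAntidiagonalEquivProd.hasSum_iff.2 hs).sigma fun n => ?_
    have := hasSum_fintype (fun p : Finset.HasAntidiagonal.antidiagonal n =>
      (discWeight r (p.1.1 + p.1.2) : ℂ) * (x₁ ^ p.1.1 * x₂ ^ p.1.2))
    rwa [Finset.univ_eq_attach, Finset.sum_attach (Finset.HasAntidiagonal.antidiagonal n)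
      (fun p : ℕ × ℕ => (discWeight r (p.1 + p.2) : ℂ) * (x₁ ^ p.1 * x₂ ^ p.2))] at this
  refine (h3.mul_right (x₁ - x₂)).unique
    (((e1.mul_left x₁).sub (e2.mul_left x₂)).congr_fun fun n => ?_)
  have h4 := geom_sum₂_mul x₁ x₂ (n + 1)
  have h5 : ∑ p ∈ Finset.HasAntidiagonal.antidiagonal n,
      (discWeight r (p.1 + p.2) : ℂ) * (x₁ ^ p.1 * x₂ ^ p.2) =
      discWeight r n * ∑ i ∈ Finset.range (n + 1), x₁ ^ i * x₂ ^ (n + 1 - 1 - i) := by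
    rw [Nat.add_sub_cancel, ← Finset.Nat.sum_antidiagonal_eq_sum_range_succ
      (fun i j => x₁ ^ i * x₂ ^ j), Finset.mul_sum]
    refine Finset.sum_congr rfl fun p hp => ?_
    rw [Finset.HasAntidiagonal.mem_antidiagonal.1 hp]
  rw [h5]
  linear_combination (discWeight r n : ℂ) * h4

/-- The chain rule gives `z₁ ∂/∂z₁ = (1 - r z₁^r) x₁ ∂/∂x₁`. Apply one side to the logarithmic
formula and the other to the series. -/
theorem one_sub_mul_tsum_fst (hr : 1 ≤ r) :
    ∀ᶠ p : ℂ × ℂ in 𝓝 0, p.1 ≠ p.2 → (1 - r * p.1 ^ r) *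
      ∑' q : ℕ × ℕ, (q.1 * annulusWeight r q.1 q.2 : ℂ) *
        (spectralX r p.1 ^ q.1 * spectralX r p.2 ^ q.2) =
      p.1 / (p.1 - p.2) -
        spectralX r p.1 * (1 - r * p.1 ^ r) / (spectralX r p.1 - spectralX r p.2) -
        r * p.1 ^ r := by
  have hn := eventually_norm_spectralX_lt hr (Real.exp_pos (-1))
  filter_upwards [eventually_eventually_nhds.2 (annulusSeries_eq_logForm hr),
    eventually_mem_slitPlane hr, eventually_fst hn, eventually_snd hn] with p h1 h2 h3 h4 hne
  obtain ⟨D, hD, hD'⟩ := hasDerivAt_annulusSeries_fst hr h3 h4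
  have hX := (hasStrictDerivAt_spectralX r p.1).hasDerivAt
  have hcomp : HasDerivAt (fun t => annulusSeries r (spectralX r t) (spectralX r p.2)) _ p.1 :=
    hD.comp p.1 hX
  have ht : Tendsto (fun t : ℂ => (t, p.2)) (𝓝 p.1) (𝓝 p) :=
    Continuous.tendsto' (by fun_prop) _ _ rfl
  have hev : (fun t => annulusSeries r (spectralX r t) (spectralX r p.2)) =ᶠ[𝓝 p.1] fun t =>
      log ((t - p.2) / (spectralX r t - spectralX r p.2)) - (t ^ r + p.2 ^ r) := by
    filter_upwards [ht.eventually h1, eventually_ne_nhds hne] with t h5 h6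
    rw [h5, logForm, spectralDivDiff_inv_eq h6]
  have hdd := sub_mul_spectralDivDiff r p
  have h0 : p.1 - p.2 ≠ 0 := sub_ne_zero.2 hne
  have hx0 : spectralX r p.1 - spectralX r p.2 ≠ 0 := by
    rw [← hdd]; exact mul_ne_zero h0 h2.1
  have hslit := h2.2
  rw [spectralDivDiff_inv_eq hne] at hslit
  have hlog := (((((hasDerivAt_id p.1).sub_const p.2).fun_div (hX.sub_const (spectralX r p.2))
    hx0).clog hslit).fun_sub ((hasDerivAt_pow r p.1).add_const (p.2 ^ r)))
  have heq := (hcomp.congr_of_eventuallyEq hev.symm).unique hlog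
  have hp : p.1 * p.1 ^ (r - 1) = p.1 ^ r := by rw [← pow_succ', Nat.sub_add_cancel hr]
  rw [← hD']
  simp only [id] at heq
  have hx : spectralX r p.1 = p.1 * exp (-p.1 ^ r) := rfl
  generalize spectralX r p.2 = x₂ at *
  generalize exp (-p.1 ^ r) = E at *
  have key : (1 - r * p.1 ^ r) * (spectralX r p.1 * D) = p.1 * (D * (E * (1 - r * p.1 ^ r))) := by
    rw [hx]; ring
  rw [key, heq, ← hp]
  generalize p.1 ^ (r - 1) = q at *
  rw [show spectralX r p.1 * (1 - r * (p.1 * q)) = p.1 * (E * (1 - r * (p.1 * q))) by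
    rw [hx]; ring]
  generalize spectralX r p.1 - x₂ = X at *
  generalize p.1 - p.2 = N at *
  field_simp

theorem one_sub_mul_tsum_snd (hr : 1 ≤ r) :
    ∀ᶠ p : ℂ × ℂ in 𝓝 0, p.1 ≠ p.2 → (1 - r * p.2 ^ r) *
      ∑' q : ℕ × ℕ, (q.2 * annulusWeight r q.1 q.2 : ℂ) *
        (spectralX r p.1 ^ q.1 * spectralX r p.2 ^ q.2) =
      p.2 / (p.2 - p.1) -
        spectralX r p.2 * (1 - r * p.2 ^ r) / (spectralX r p.2 - spectralX r p.1) -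
        r * p.2 ^ r := by
  have ht : Tendsto (Prod.swap : ℂ × ℂ → ℂ × ℂ) (𝓝 0) (𝓝 0) :=
    continuous_swap.tendsto' _ _ rfl
  filter_upwards [ht.eventually (one_sub_mul_tsum_fst hr)] with p h hne
  rw [Prod.fst_swap, Prod.snd_swap] at h
  rw [← h hne.symm, ← (Equiv.prodComm ℕ ℕ).tsum_eq]
  congr 1
  refine tsum_congr fun q => ?_
  simp only [Equiv.prodComm_apply, Prod.fst_swap, Prod.snd_swap]
  rw [annulusWeight_comm, mul_comm (spectralX r p.1 ^ _)]

theorem one_sub_mul_tsum_add (hr : 1 ≤ r) :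
    ∀ᶠ p : ℂ × ℂ in 𝓝 0, p.1 ≠ p.2 →
      (1 - r * p.1 ^ r) * ∑' q : ℕ × ℕ, (q.1 * annulusWeight r q.1 q.2 : ℂ) *
        (spectralX r p.1 ^ q.1 * spectralX r p.2 ^ q.2) +
      (1 - r * p.2 ^ r) * ∑' q : ℕ × ℕ, (q.2 * annulusWeight r q.1 q.2 : ℂ) *
        (spectralX r p.1 ^ q.1 * spectralX r p.2 ^ q.2) =
      r * ((spectralX r p.1 * p.1 ^ r - spectralX r p.2 * p.2 ^ r) /
        (spectralX r p.1 - spectralX r p.2) - (p.1 ^ r + p.2 ^ r)) := by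
  filter_upwards [one_sub_mul_tsum_fst hr, one_sub_mul_tsum_snd hr, eventually_mem_slitPlane hr]
    with p h1 h2 h3 hne
  have hN : p.1 - p.2 ≠ 0 := sub_ne_zero.2 hne
  have hX : spectralX r p.1 - spectralX r p.2 ≠ 0 := by
    rw [← sub_mul_spectralDivDiff]; exact mul_ne_zero hN h3.1
  rw [h1 hne, h2 hne, ← neg_sub p.1, ← neg_sub (spectralX r p.1), div_neg, div_neg]
  generalize p.1 ^ r = y₁
  generalize p.2 ^ r = y₂
  field_simp
  ring

/-- The last two terms encode `r y₁ + r y₂` as two-variable series supported on the axes; they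
affect only coefficients with a zero index. -/
theorem HasSum.edgeContraction {w : ℕ → ℚ} {u : ℕ → ℕ → ℚ} {x₁ x₂ y₁ y₂ P₁ P₂ Q : ℂ} (r : ℕ)
    (h₁ : HasSum (fun n => (w n : ℂ) * x₁ ^ n) y₁) (h₂ : HasSum (fun n => (w n : ℂ) * x₂ ^ n) y₂)
    (hP₁ : HasSum (fun p : ℕ × ℕ => (p.1 * u p.1 p.2 : ℂ) * (x₁ ^ p.1 * x₂ ^ p.2)) P₁)
    (hP₂ : HasSum (fun p : ℕ × ℕ => (p.2 * u p.1 p.2 : ℂ) * (x₁ ^ p.1 * x₂ ^ p.2)) P₂)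
    (hQ : HasSum (fun p : ℕ × ℕ => (w (p.1 + p.2) : ℂ) * (x₁ ^ p.1 * x₂ ^ p.2)) Q) :
    HasSum (fun p : ℕ × ℕ =>
      ((p.1 * u p.1 p.2 + p.2 * u p.1 p.2 -
        r * ∑ q ∈ Finset.HasAntidiagonal.antidiagonal p.1, w q.1 * (q.2 * u q.2 p.2) -
        r * ∑ q ∈ Finset.HasAntidiagonal.antidiagonal p.2, w q.1 * (q.2 * u p.1 q.2) -
        r * w (p.1 + p.2) + r * (w p.1 * if p.2 = 0 then 1 else 0) +
        r * ((if p.1 = 0 then 1 else 0) * w p.2) : ℚ) : ℂ) * (x₁ ^ p.1 * x₂ ^ p.2))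
      (P₁ + P₂ - r * (y₁ * P₁) - r * (y₂ * P₂) - r * Q + r * (y₁ * 1) + r * (1 * y₂)) := by
  have hone : HasSum (fun n : ℕ => if n = 0 then (1 : ℂ) else 0) 1 := hasSum_ite_eq 0 1
  have a₁ := h₁.prod_of_norm hone
  have a₂ := hone.prod_of_norm h₂
  have hall := ((((((hP₁.add hP₂).sub ((h₁.mul_antidiagonal_fst hP₁).mul_left (r : ℂ))).sub
    ((h₂.mul_antidiagonal_snd hP₂).mul_left (r : ℂ))).sub (hQ.mul_left (r : ℂ))).add
    (a₁.mul_left (r : ℂ))).add (a₂.mul_left (r : ℂ)))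
  refine hall.congr_fun fun q => ?_
  have hs1 : ∑ i ∈ Finset.HasAntidiagonal.antidiagonal q.1,
      (w i.1 : ℂ) * x₁ ^ i.1 * ((i.2 * u i.2 q.2) *
        (x₁ ^ i.2 * x₂ ^ q.2)) =
      (∑ i ∈ Finset.HasAntidiagonal.antidiagonal q.1,
        (w i.1 : ℂ) * (i.2 * u i.2 q.2)) *
        (x₁ ^ q.1 * x₂ ^ q.2) := by
    rw [Finset.sum_mul]
    refine Finset.sum_congr rfl fun i hi => ?_
    rw [← Finset.HasAntidiagonal.mem_antidiagonal.1 hi, pow_add]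
    ring
  have hs2 : ∑ i ∈ Finset.HasAntidiagonal.antidiagonal q.2,
      (w i.1 : ℂ) * x₂ ^ i.1 * ((i.2 * u q.1 i.2) *
        (x₁ ^ q.1 * x₂ ^ i.2)) =
      (∑ i ∈ Finset.HasAntidiagonal.antidiagonal q.2,
        (w i.1 : ℂ) * (i.2 * u q.1 i.2)) *
        (x₁ ^ q.1 * x₂ ^ q.2) := by
    rw [Finset.sum_mul]
    refine Finset.sum_congr rfl fun i hi => ?_
    rw [← Finset.HasAntidiagonal.mem_antidiagonal.1 hi, pow_add]
    ring
  rw [hs1, hs2]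
  have k1 : (if q.1 = 0 then (1 : ℂ) else 0) = ((if q.1 = 0 then 1 else 0 : ℚ) : ℂ) *
      x₁ ^ q.1 := by
    split_ifs with h <;> simp [h]
  have k2 : (if q.2 = 0 then (1 : ℂ) else 0) = ((if q.2 = 0 then 1 else 0 : ℚ) : ℂ) *
      x₂ ^ q.2 := by
    split_ifs with h <;> simp [h]
  rw [k1, k2]
  push_cast
  ring

theorem hasSum_edgeContraction (hr : 1 ≤ r) :
    ∀ᶠ x : ℂ × ℂ in 𝓝 0, x.1 ≠ x.2 → HasSum (fun p : ℕ × ℕ =>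
      ((p.1 * annulusWeight r p.1 p.2 + p.2 * annulusWeight r p.1 p.2 -
        r * ∑ q ∈ Finset.HasAntidiagonal.antidiagonal p.1,
          discWeight r q.1 * (q.2 * annulusWeight r q.2 p.2) -
        r * ∑ q ∈ Finset.HasAntidiagonal.antidiagonal p.2,
          discWeight r q.1 * (q.2 * annulusWeight r p.1 q.2) -
        r * discWeight r (p.1 + p.2) + r * (discWeight r p.1 * if p.2 = 0 then 1 else 0) +
        r * ((if p.1 = 0 then 1 else 0) * discWeight r p.2) : ℚ) : ℂ) *
      (x.1 ^ p.1 * x.2 ^ p.2)) 0 := by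
  have hmap : 𝓝 (0 : ℂ × ℂ) = map (fun p : ℂ × ℂ => (spectralX r p.1, spectralX r p.2)) (𝓝 0) := by
    rw [← Prod.mk_zero_zero, nhds_prod_eq]
    conv_lhs => rw [← map_spectralX_nhds hr]
    rw [prod_map_map_eq]
  rw [hmap, eventually_map]
  have hn := eventually_norm_spectralX_lt hr (Real.exp_pos (-1))
  have hz := eventually_exp_mul_lt_one hr
  filter_upwards [one_sub_mul_tsum_add hr, eventually_fst hn,
    eventually_snd hn, eventually_fst hz, eventually_snd hz] with p h1 hn1 hn2 hz1 hz2 hne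
  have hne' : p.1 ≠ p.2 := fun h => hne (by rw [h])
  specialize h1 hne'
  have hP1 := (((expBounded_add_mul_annulusWeight hr).mono
    (c' := fun p => (p.1 * annulusWeight r p.1 p.2 : ℂ))
    fun p => norm_annulusWeight_mul_le (Nat.le_add_right _ _)).summable hn1 hn2).hasSum
  have hP2 := (((expBounded_add_mul_annulusWeight hr).mono
    (c' := fun p => (p.2 * annulusWeight r p.1 p.2 : ℂ))
    fun p => norm_annulusWeight_mul_le (Nat.le_add_left _ _)).summable hn1 hn2).hasSum
  have e1 := hasSum_discWeight hr hz1
  have e2 := hasSum_discWeight hr hz2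
  have e3 := hasSum_discWeight_add hr hz1 hz2 hn1 hn2 hne
  refine (?_ : (_ : ℂ) = 0) ▸ HasSum.edgeContraction (u := annulusWeight r) r e1 e2 hP1 hP2 e3
  generalize ∑' q : ℕ × ℕ, (q.1 * annulusWeight r q.1 q.2 : ℂ) *
    (spectralX r p.1 ^ q.1 * spectralX r p.2 ^ q.2) = P₁ at *
  generalize ∑' q : ℕ × ℕ, (q.2 * annulusWeight r q.1 q.2 : ℂ) *
    (spectralX r p.1 ^ q.1 * spectralX r p.2 ^ q.2) = P₂ at *
  linear_combination h1

theorem sum_Ico_one_reflect (l : ℕ) (F : ℕ → ℕ → ℚ) :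
    ∑ k ∈ Finset.Ico 1 l, F (l - k) k = ∑ k ∈ Finset.Ico 1 l, F k (l - k) := by
  rcases Nat.eq_zero_or_pos l with rfl | hl
  · simp
  have h := Finset.sum_Ico_reflect (fun k => F (l - k) k) 1 (Nat.le_succ l)
  rw [show l + 1 - l = 1 by omega, show l + 1 - 1 = l by omega] at h
  rw [← h]
  refine Finset.sum_congr rfl fun k hk => ?_
  rw [Finset.mem_Ico] at hk
  rw [show l - (l - k) = k by omega]

/-- For `m, n ≥ 1` the axis terms drop out, and the coefficient of `x₁^m x₂^n` is the recursion
multiplied by `r`. -/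
theorem isAnnulusWeight_annulusWeight (hr : 1 ≤ r) :
    IsAnnulusWeight r (discWeight r) (annulusWeight r) := by
  intro m n hm hn
  have h := eq_zero_of_hasSum_pow_mul_pow_zero (hasSum_edgeContraction hr) (m, n)
  rw [Rat.cast_eq_zero] at h
  dsimp only at h
  rw [if_neg (by omega), if_neg (by omega),
    sum_antidiagonal_eq_sum_Ico m (fun i j => discWeight r i * (j * annulusWeight r j n))
      (by simp [discWeight_zero]) (by simp),
    sum_antidiagonal_eq_sum_Ico n (fun i j => discWeight r i * (j * annulusWeight r m j))
      (by simp [discWeight_zero]) (by simp)] at h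
  have hrefl : ∀ (l : ℕ) (f : ℕ → ℚ),
      ∑ k ∈ Finset.Ico 1 l, discWeight r k * ((l - k : ℕ) * f (l - k)) =
        ∑ k ∈ Finset.Ico 1 l, k * f k * discWeight r (l - k) := fun l f =>
    (sum_Ico_one_reflect l fun i j => discWeight r j * (i * f i)).trans
      (Finset.sum_congr rfl fun k _ => mul_comm _ _)
  rw [hrefl m (fun k => annulusWeight r k n), hrefl n (annulusWeight r m)] at h
  have hr' : (r : ℚ) ≠ 0 := by positivity
  push_cast
  field_simp
  linear_combination h

end EdgeContraction

/-! ### Explicit Hurwitz numbers and the free energy. -/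

section GenusZero

variable {r : ℕ}

theorem annulusWeight_eq_zero {m n : ℕ} (h : ¬ r ∣ m + n) : annulusWeight r m n = 0 :=
  if_neg fun h' => h h'.1

theorem arrowedHurwitzNumber_one (hr : 1 ≤ r) {d : ℕ} (hd : 1 ≤ d) :
    arrowedHurwitzNumber r 0 ![d] = discWeight r d :=
  (isDiscWeight_discWeight hr).arrowedHurwitzNumber_eq hr hd

theorem arrowedHurwitzNumber_two (hr : 1 ≤ r) {m n : ℕ} (hm : 1 ≤ m) (hn : 1 ≤ n) :
    arrowedHurwitzNumber r 0 ![m, n] = m * n * annulusWeight r m n :=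
  (isAnnulusWeight_annulusWeight hr).arrowedHurwitzNumber_eq hr (isDiscWeight_discWeight hr)
    (fun _ _ => annulusWeight_eq_zero) hm hn

theorem arrowedHurwitzNumber_edgeContraction (hr : 1 ≤ r) {m n : ℕ} (hm : 1 ≤ m) (hn : 1 ≤ n) :
    ((m + n : ℕ) : ℚ) / r * arrowedHurwitzNumber r 0 ![m, n] =
      m * n * arrowedHurwitzNumber r 0 ![m + n] +
      m * ∑ k ∈ Finset.Ico 1 m,
        arrowedHurwitzNumber r 0 ![k] * arrowedHurwitzNumber r 0 ![m - k, n] +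
      n * ∑ k ∈ Finset.Ico 1 n,
        arrowedHurwitzNumber r 0 ![k] * arrowedHurwitzNumber r 0 ![m, n - k] := by
  have h := isAnnulusWeight_annulusWeight hr m n hm hn
  have h1 : ∑ k ∈ Finset.Ico 1 m,
      arrowedHurwitzNumber r 0 ![k] * arrowedHurwitzNumber r 0 ![m - k, n] =
      n * ∑ k ∈ Finset.Ico 1 m, k * annulusWeight r k n * discWeight r (m - k) := by
    rw [← sum_Ico_one_reflect m fun i j => i * annulusWeight r i n * discWeight r j,
      Finset.mul_sum]
    refine Finset.sum_congr rfl fun k hk => ?_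
    rw [Finset.mem_Ico] at hk
    rw [arrowedHurwitzNumber_one hr hk.1, arrowedHurwitzNumber_two hr (by omega) hn]
    ring
  have h2 : ∑ k ∈ Finset.Ico 1 n,
      arrowedHurwitzNumber r 0 ![k] * arrowedHurwitzNumber r 0 ![m, n - k] =
      m * ∑ k ∈ Finset.Ico 1 n, k * annulusWeight r m k * discWeight r (n - k) := by
    rw [← sum_Ico_one_reflect n fun i j => i * annulusWeight r m i * discWeight r j,
      Finset.mul_sum]
    refine Finset.sum_congr rfl fun k hk => ?_
    rw [Finset.mem_Ico] at hk
    rw [arrowedHurwitzNumber_one hr hk.1, arrowedHurwitzNumber_two hr hm (by omega)]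
    ring
  rw [h1, h2, arrowedHurwitzNumber_one hr (by omega), arrowedHurwitzNumber_two hr hm hn]
  linear_combination (m * n : ℚ) * h

theorem freeEnergyTerm_two (hr : 1 ≤ r) (x₁ x₂ : ℂ) (μ : Fin 2 → ℕ+) :
    freeEnergyTerm r 0 ![x₁, x₂] μ =
      annulusWeight r (μ 0) (μ 1) * (x₁ ^ (μ 0 : ℕ) * x₂ ^ (μ 1 : ℕ)) := by
  have h : (fun i => (μ i : ℕ)) = ![(μ 0 : ℕ), (μ 1 : ℕ)] := by
    ext i; fin_cases i <;> rfl
  have h0 : (μ 0 : ℂ) ≠ 0 := by exact_mod_cast (μ 0).ne_zero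
  have h1 : (μ 1 : ℂ) ≠ 0 := by exact_mod_cast (μ 1).ne_zero
  rw [freeEnergyTerm, h, arrowedHurwitzNumber_two hr (μ 0).pos (μ 1).pos, Fin.prod_univ_two,
    Fin.prod_univ_two]
  push_cast
  field_simp

theorem injective_coe_pnat_pair :
    Function.Injective fun μ : Fin 2 → ℕ+ => ((μ 0 : ℕ), (μ 1 : ℕ)) := by
  intro μ ν h
  rw [Prod.mk.injEq] at h
  funext i; fin_cases i
  · exact PNat.coe_injective h.1
  · exact PNat.coe_injective h.2

theorem annulusWeight_eq_zero_of_notMem_range {p : ℕ × ℕ}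
    (hp : p ∉ Set.range fun μ : Fin 2 → ℕ+ => ((μ 0 : ℕ), (μ 1 : ℕ))) :
    annulusWeight r p.1 p.2 = 0 := by
  refine if_neg fun h => hp ⟨![⟨p.1, Nat.pos_of_ne_zero h.2.1⟩, ⟨p.2, Nat.pos_of_ne_zero h.2.2⟩], rfl⟩

/-- `annulusWeight` is zero when an index is zero, so summing over all of `ℕ × ℕ` adds nothing. -/
theorem freeEnergy_two (hr : 1 ≤ r) (x₁ x₂ : ℂ) :
    freeEnergy r 0 ![x₁, x₂] = annulusSeries r x₁ x₂ := by
  rw [freeEnergy, annulusSeries, ← injective_coe_pnat_pair.tsum_eq]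
  · exact tsum_congr fun μ => freeEnergyTerm_two hr x₁ x₂ μ
  · intro p hp
    by_contra h
    exact hp (by simp [annulusWeight_eq_zero_of_notMem_range h])

theorem hasSum_freeEnergyTerm_two (hr : 1 ≤ r) {x₁ x₂ : ℂ} (h₁ : ‖x₁‖ < Real.exp (-1))
    (h₂ : ‖x₂‖ < Real.exp (-1)) :
    HasSum (freeEnergyTerm r 0 ![x₁, x₂]) (annulusSeries r x₁ x₂) := by
  have h := ((expBounded_annulusWeight hr).summable h₁ h₂).hasSum
  rw [← injective_coe_pnat_pair.hasSum_iff
    (fun p hp => by simp [annulusWeight_eq_zero_of_notMem_range hp])] at h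
  exact h.congr_fun fun μ => freeEnergyTerm_two hr x₁ x₂ μ

theorem orbifoldHurwitzNumber_one (hr : 1 ≤ r) {d : ℕ} (hd : 1 ≤ d) :
    (orbifoldHurwitzNumber r 0 ![d] : ℝ) =
      if r ∣ d then (d : ℝ) ^ (((d / r : ℕ) : ℤ) - 2) / ((d / r).factorial : ℝ) else 0 := by
  have h := arrowedHurwitzNumber_eq_prod_mul r 0 ![d]
  rw [arrowedHurwitzNumber_one hr hd, Fin.prod_univ_one, Matrix.cons_val_zero] at h
  have hd0 : (d : ℚ) ≠ 0 := by positivity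
  have hd0' : (d : ℝ) ≠ 0 := by positivity
  have h' : orbifoldHurwitzNumber r 0 ![d] = discWeight r d / d := by
    rw [h, mul_div_cancel_left₀ _ hd0]
  rw [h', discWeight]
  split_ifs
  · rw [floorCoeff, zpow_sub₀ hd0', zpow_natCast]
    push_cast
    rw [zpow_ofNat]
    field_simp
  · simp

/-- The two residues modulo `r` add up to `0` if `r ∣ m` and to `r` otherwise. -/
theorem rpow_fract_add_fract (hr : 1 ≤ r) {m n : ℕ} (h : r ∣ m + n) :
    (r : ℝ) ^ (Int.fract ((m : ℝ) / r) + Int.fract ((n : ℝ) / r)) =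
      if r ∣ m then 1 else (r : ℝ) := by
  have hr0 : (r : ℝ) ≠ 0 := by positivity
  rw [Int.fract_div_natCast_eq_div_natCast_mod, Int.fract_div_natCast_eq_div_natCast_mod,
    ← add_div, ← Nat.cast_add]
  split_ifs with hm
  · rw [Nat.mod_eq_zero_of_dvd hm, Nat.mod_eq_zero_of_dvd ((Nat.dvd_add_right hm).1 h)]
    simp
  · have h1 : m % r ≠ 0 := fun h => hm (Nat.dvd_of_mod_eq_zero h)
    have h2 : m % r < r := Nat.mod_lt _ hr
    have h3 : n % r < r := Nat.mod_lt _ hr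
    have h4 : r ∣ m % r + n % r := by
      rw [Nat.dvd_iff_mod_eq_zero, ← Nat.add_mod]
      exact Nat.mod_eq_zero_of_dvd h
    have h5 : m % r + n % r = r := by
      obtain ⟨c, hc⟩ := h4
      have hc1 : c = 1 := by
        have : 0 < c := Nat.pos_of_ne_zero (by rintro rfl; omega)
        have : c < 2 := by by_contra hcc; nlinarith
        omega
      rw [hc, hc1, mul_one]
    rw [h5, div_self hr0, Real.rpow_one]

theorem orbifoldHurwitzNumber_two (hr : 1 ≤ r) {m n : ℕ} (hm : 1 ≤ m) (hn : 1 ≤ n) :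
    (orbifoldHurwitzNumber r 0 ![m, n] : ℝ) =
      if r ∣ m + n then
        (r : ℝ) ^ (Int.fract ((m : ℝ) / r) + Int.fract ((n : ℝ) / r)) * (1 / ((m : ℝ) + n)) *
          ((m : ℝ) ^ (m / r) * (n : ℝ) ^ (n / r) /
            (((m / r).factorial : ℝ) * ((n / r).factorial : ℝ)))
      else 0 := by
  have h := arrowedHurwitzNumber_eq_prod_mul r 0 ![m, n]
  rw [arrowedHurwitzNumber_two hr hm hn, Fin.prod_univ_two, Matrix.cons_val_zero,
    Matrix.cons_val_one, Matrix.cons_val_zero] at h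
  have hm0 : (m : ℚ) ≠ 0 := by positivity
  have hn0 : (n : ℚ) ≠ 0 := by positivity
  rw [← mul_left_cancel₀ (mul_ne_zero hm0 hn0) h]
  split_ifs with hd
  · rw [rpow_fract_add_fract hr hd, annulusWeight, if_pos ⟨hd, by omega, by omega⟩, floorCoeff,
      floorCoeff]
    split_ifs <;> push_cast <;> field_simp
  · rw [annulusWeight_eq_zero hd, Rat.cast_zero]

end GenusZero

/-! ### The first-order equation and uniqueness of its solution. -/

section AxisVanishingSolution

open Filter

variable {r : ℕ}

theorem deriv_slice_fst {f : ℂ × ℂ → ℂ} {p : ℂ × ℂ} (hf : DifferentiableAt ℂ f p) :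
    deriv (fun t => f (t, p.2)) p.1 = fderiv ℂ f p (1, 0) :=
  (hf.hasFDerivAt.comp_hasDerivAt (f := fun t : ℂ => (t, p.2)) p.1
    ((hasDerivAt_id p.1).prodMk (hasDerivAt_const p.1 p.2))).deriv

theorem deriv_slice_snd {f : ℂ × ℂ → ℂ} {p : ℂ × ℂ} (hf : DifferentiableAt ℂ f p) :
    deriv (fun t => f (p.1, t)) p.2 = fderiv ℂ f p (0, 1) :=
  (hf.hasFDerivAt.comp_hasDerivAt (f := fun t : ℂ => (p.1, t)) p.2
    ((hasDerivAt_const p.2 p.1).prodMk (hasDerivAt_id p.2))).deriv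

theorem mul_deriv_slice_add {f : ℂ × ℂ → ℂ} {p : ℂ × ℂ} (hf : DifferentiableAt ℂ f p) :
    p.1 * deriv (fun t => f (t, p.2)) p.1 + p.2 * deriv (fun t => f (p.1, t)) p.2 =
      fderiv ℂ f p p := by
  rw [deriv_slice_fst hf, deriv_slice_snd hf, ← smul_eq_mul, ← smul_eq_mul, ← map_smul, ← map_smul,
    ← map_add]
  simp

/-- The difference has zero radial derivative, so it is constant near the origin; of the vanishing
on the axes only the value at the origin is used. -/
theorem IsAxisVanishingSolution.eventually_eq (hr : 1 ≤ r) {f g : ℂ × ℂ → ℂ}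
    (hf : IsAxisVanishingSolution r f) (hg : IsAxisVanishingSolution r g) :
    ∀ᶠ p in 𝓝 0, f p = g p := by
  obtain ⟨hfa, hfe, hfz, -⟩ := hf
  obtain ⟨hga, hge, hgz, -⟩ := hg
  have h := (hfa.fun_sub hga).eventually_eq_of_radial_deriv_eq_zero (by
    filter_upwards [hfa.eventually_analyticAt, hga.eventually_analyticAt, hfe, hge]
      with p h1 h2 h3 h4
    rw [mul_deriv_slice_add h1.differentiableAt] at h3
    rw [mul_deriv_slice_add h2.differentiableAt, ← h3] at h4
    have hr' : 1 / (r : ℂ) ≠ 0 := one_div_ne_zero (by exact_mod_cast (by omega : r ≠ 0))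
    rw [fderiv_fun_sub h1.differentiableAt h2.differentiableAt, sub_apply,
      mul_left_cancel₀ hr' h4, sub_self])
  filter_upwards [h] with p hp
  have h1 : f 0 = 0 := hfz.self_of_nhds
  have h2 : g 0 = 0 := hgz.self_of_nhds
  rwa [h1, h2, sub_self, sub_eq_zero] at hp

theorem mul_deriv_spectralX {u : ℂ → ℂ} {z D P : ℂ}
    (hD : HasDerivAt u D (spectralX r z)) (hP : spectralX r z * D = P) :
    z * deriv (fun t => u (spectralX r t)) z = (1 - r * z ^ r) * P := by
  have h : HasDerivAt (fun t => u (spectralX r t)) _ z :=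
    hD.comp z (hasStrictDerivAt_spectralX r z).hasDerivAt
  rw [h.deriv, ← hP, spectralX]
  ring

theorem continuousAt_diffQuot_mul_spectralX {p : ℂ × ℂ}
    (h : ∀ᶠ p in 𝓝 p, spectralDivDiff r p ≠ 0) :
    ContinuousAt (fun p : ℂ × ℂ =>
      diffQuot (fun t => spectralX r t * t ^ r) (spectralX r) p.1 p.2) p := by
  have h1 := (analyticAt_spectralDivDiff r p).continuousAt
  have h2 : Continuous (spectralX r) := by unfold spectralX; fun_prop
  have h3 : ContinuousAt (fun p : ℂ × ℂ => p.1 ^ r + spectralX r p.2 *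
      (∑ i ∈ Finset.range r, p.1 ^ i * p.2 ^ (r - 1 - i)) / spectralDivDiff r p) p :=
    ContinuousAt.add (by fun_prop) (ContinuousAt.div (by fun_prop) h1 h.self_of_nhds)
  refine h3.congr ?_
  filter_upwards [h] with q hq
  exact (diffQuot_mul_spectralX hq).symm

/-- Analyticity comes from the closed formula. Off the diagonal the equation is
`one_sub_mul_tsum_add`; both sides are continuous, so it extends to the diagonal. -/
theorem isAxisVanishingSolution_annulusSeries (hr : 1 ≤ r) :
    IsAxisVanishingSolution r
      (fun p => annulusSeries r (spectralX r p.1) (spectralX r p.2)) := by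
  have h0 := (eventually_mem_slitPlane hr).self_of_nhds
  have ha : AnalyticAt ℂ (fun p : ℂ × ℂ => annulusSeries r (spectralX r p.1) (spectralX r p.2)) 0 :=
    (analyticAt_logForm h0.1 h0.2).congr (EventuallyEq.symm (annulusSeries_eq_logForm hr))
  refine ⟨ha, ?_, Eventually.of_forall fun z => ?_, Eventually.of_forall fun z => ?_⟩
  · have hn := eventually_norm_spectralX_lt hr (Real.exp_pos (-1))
    have key := eventually_eq_of_off_diagonal (f := fun p => 1 / (r : ℂ) * fderiv ℂ
      (fun p : ℂ × ℂ => annulusSeries r (spectralX r p.1) (spectralX r p.2)) p p)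
      (g := fun p => diffQuot (fun t => spectralX r t * t ^ r) (spectralX r) p.1 p.2 -
        (p.1 ^ r + p.2 ^ r)) ?_ ?_ ?_
    · filter_upwards [key, ha.eventually_analyticAt] with p h1 h2
      rw [mul_deriv_slice_add h2.differentiableAt, h1]
    · filter_upwards [ha.eventually_analyticAt] with p hp
      exact continuousAt_const.mul (hp.fderiv.continuousAt.clm_apply continuousAt_id)
    · filter_upwards [eventually_eventually_nhds.2 (eventually_mem_slitPlane hr)] with p hp
      exact (continuousAt_diffQuot_mul_spectralX (hp.mono fun _ h => h.1)).sub (by fun_prop)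
    · filter_upwards [ha.eventually_analyticAt, eventually_fst hn, eventually_snd hn,
        one_sub_mul_tsum_add hr] with p h1 h2 h3 h4 hne
      obtain ⟨D₁, hD₁, hP₁⟩ := hasDerivAt_annulusSeries_fst hr h2 h3
      obtain ⟨D₂, hD₂, hP₂⟩ := hasDerivAt_annulusSeries_snd hr h2 h3
      rw [← mul_deriv_slice_add h1.differentiableAt, diffQuot, if_neg hne,
        mul_deriv_spectralX hD₁ hP₁, mul_deriv_spectralX hD₂ hP₂, h4 hne, ← mul_assoc,
        one_div_mul_cancel (by exact_mod_cast (by omega : r ≠ 0)), one_mul]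
  · beta_reduce
    rw [spectralX_zero, annulusSeries_comm, annulusSeries_zero_left]
  · beta_reduce
    rw [spectralX_zero, annulusSeries_zero_left]

end AxisVanishingSolution

theorem mainTheorem4 (r : ℕ) (hr : 1 ≤ r) :
    -- the closed formula (with convergence of the series), near the origin
    (∃ ε : ℝ, 0 < ε ∧ ∀ z₁ z₂ : ℂ, ‖z₁‖ < ε → ‖z₂‖ < ε →
      HasSum (freeEnergyTerm r 0 ![spectralX r z₁, spectralX r z₂])
        (Complex.log (diffQuot (fun t => t) (spectralX r) z₁ z₂) - (z₁ ^ r + z₂ ^ r))) ∧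
    -- the edge-contraction formula for `(g,n) = (0,2)`
    (∀ μ₁ μ₂ : ℕ, 1 ≤ μ₁ → 1 ≤ μ₂ →
      ((μ₁ + μ₂ : ℕ) : ℚ) / r * arrowedHurwitzNumber r 0 ![μ₁, μ₂] =
        μ₁ * μ₂ * arrowedHurwitzNumber r 0 ![μ₁ + μ₂] +
        μ₁ * ∑ α ∈ Finset.Ico 1 μ₁,
          arrowedHurwitzNumber r 0 ![α] * arrowedHurwitzNumber r 0 ![μ₁ - α, μ₂] +
        μ₂ * ∑ α ∈ Finset.Ico 1 μ₂,
          arrowedHurwitzNumber r 0 ![α] * arrowedHurwitzNumber r 0 ![μ₁, μ₂ - α]) ∧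
    -- the free energy is the unique analytic solution of the resulting equation
    IsAxisVanishingSolution r
      (fun p => freeEnergy r 0 ![spectralX r p.1, spectralX r p.2]) ∧
    (∀ f : ℂ × ℂ → ℂ, IsAxisVanishingSolution r f →
      ∀ᶠ p : ℂ × ℂ in 𝓝 0, f p = freeEnergy r 0 ![spectralX r p.1, spectralX r p.2]) ∧
    -- the formula for the `(0,1)` orbifold Hurwitz numbers
    (∀ d : ℕ, 1 ≤ d →
      (orbifoldHurwitzNumber r 0 ![d] : ℝ) =
        if r ∣ d then (d : ℝ) ^ (((d / r : ℕ) : ℤ) - 2) / ((d / r).factorial : ℝ) else 0) ∧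
    -- the formula for the `(0,2)` orbifold Hurwitz numbers
    (∀ μ₁ μ₂ : ℕ, 1 ≤ μ₁ → 1 ≤ μ₂ →
      (orbifoldHurwitzNumber r 0 ![μ₁, μ₂] : ℝ) =
        if r ∣ μ₁ + μ₂ then
          (r : ℝ) ^ (Int.fract ((μ₁ : ℝ) / r) + Int.fract ((μ₂ : ℝ) / r)) *
            (1 / ((μ₁ : ℝ) + μ₂)) *
            ((μ₁ : ℝ) ^ (μ₁ / r) * (μ₂ : ℝ) ^ (μ₂ / r) /
              (((μ₁ / r).factorial : ℝ) * ((μ₂ / r).factorial : ℝ)))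
        else 0) := by
  refine ⟨?_, fun μ₁ μ₂ => arrowedHurwitzNumber_edgeContraction hr, ?_, ?_,
    fun d => orbifoldHurwitzNumber_one hr, fun μ₁ μ₂ => orbifoldHurwitzNumber_two hr⟩
  · have hn := eventually_norm_spectralX_lt hr (Real.exp_pos (-1))
    obtain ⟨ε, hε, h⟩ := Metric.eventually_nhds_iff.1
      ((annulusSeries_eq_logForm hr).and ((eventually_fst hn).and (eventually_snd hn)))
    refine ⟨ε, hε, fun z₁ z₂ h₁ h₂ => ?_⟩
    obtain ⟨h3, h4, h5⟩ := h (y := (z₁, z₂)) (by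
      rw [dist_zero_right, Prod.norm_def]; exact max_lt h₁ h₂)
    have h6 := hasSum_freeEnergyTerm_two hr h4 h5
    rwa [h3, logForm, ← diffQuot_id_spectralX] at h6
  · simp only [freeEnergy_two hr]
    exact isAxisVanishingSolution_annulusSeries hr
  · intro f hf
    simp only [freeEnergy_two hr]
    exact hf.eventually_eq hr (isAxisVanishingSolution_annulusSeries hr)
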